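/- Let $S$ be a finite semigroup and $g\in S$. The index of $g$ is $t=\min\{j\ge 1 : g^j=g^k \text{ for some } k>j\}$, and the period of $g$ is $r=\min\{j\ge 1 : g^t=g^{t+j}\}$. Suppose that $S$ is given as a black box with unique encodings of length $n$: an injective map $\mathrm{enc}\colon S\to\{0,1\}^n$, and an oracle $|x\rangle|y\rangle|z\rangle\mapsto|x\rangle|y\rangle|z\oplus f(x,y)\rangle$ on $3n$ qubits, where $f\colon\{0,1\}^n\times\{0,1\}^n\to\{0,1\}^n$ satisfies $f(\mathrm{enc}(a),\mathrm{enc}(b))=\mathrm{enc}(ab)$ for all $a,b\in S$ and is arbitrary on strings that encode no element. There is a single quantum algorithm (a fixed program, independent of $S$, of the encoding and of $n$, for a classical random access machine with logarithmic cost that can prepare, transform by gates from a fixed finite universal set, and measure qubits, and can query the oracle) and there are polynomials $p,q$ such that the following holds for every such black-box semigroup and every $g\in S$. Given $n$, the encoding of $g$, and an upper bound $N$ on the order $t+r-1$ of $g$ (the number of distinct powers $g,g^2,g^3,\dots$; for example $N=|S|$), the algorithm always halts, after at most $p(n+\log_2 N)$ elementary steps (bit cost) and at most $q(\log_2 N)$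 oracle queries, and with probability at least $2/3$ it outputs both the index $t$ and the period $r$ of $g$. -/

import Mathlib

universe u

/-! ### Index and period of an element of a semigroup -/

/-- `spow g j` is the power `g ^ j` for `j ≥ 1`, in a semigroup, which need not have an identity.
The value at `j = 0` is a dummy that the definitions below never use. -/
def spow {S : Type*} [Semigroup S] (g : S) : ℕ → S
  | 0 => g
  | 1 => g
  | j + 2 => spow g (j + 1) * g

/-- The index of `g`: the least `j ≥ 1` such that `g ^ j = g ^ k` for some `k > j`. -/
noncomputable def sgIndex {S : Type*} [Semigroup S] (g : S) : ℕ :=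
  sInf {j : ℕ | 1 ≤ j ∧ ∃ k : ℕ, j < k ∧ spow g j = spow g k}

/-- The period of `g`: the least `j ≥ 1` such that `g ^ t = g ^ (t + j)`, where `t` is the index
of `g`. -/
noncomputable def sgPeriod {S : Type*} [Semigroup S] (g : S) : ℕ :=
  sInf {j : ℕ | 1 ≤ j ∧ spow g (sgIndex g) = spow g (sgIndex g + j)}

/-! ### Black-box semigroups -/

/-- Bit strings of length `n`. -/
abbrev Bits (n : ℕ) : Type := Fin n → Bool

/-- A black box for the semigroup `S` with encodings of length `n`: every element has a unique
encoding, distinct elements have distinct encodings, and the black box `mul` takes the encodings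
of `a` and `b` to the encoding of `a * b`. Its answers on strings that encode no element are
arbitrary. -/
structure BlackBox (S : Type*) [Semigroup S] (n : ℕ) where
  enc : S → Bits n
  enc_injective : Function.Injective enc
  mul : Bits n → Bits n → Bits n
  mul_enc : ∀ a b : S, mul (enc a) (enc b) = enc (a * b)

/-! ### Quantum memory -/

/-- A pure state, not necessarily normalised, of a quantum memory whose qubits are numbered by the
natural numbers. A computational basis state is given by the finite set of the qubits that are in
the state `1`. -/
abbrev QState : Type := Finset ℕ →₀ ℂ

/-- The squared norm of a state. -/
noncomputable def QState.weight (ψ : QState) : ℝ := ψ.sum fun _ a => ‖a‖ ^ 2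

/-- The linear operator with the given values on the computational basis states. -/
noncomputable def QState.apply (f : Finset ℕ → QState) (ψ : QState) : QState :=
  Finsupp.linearCombination ℂ f ψ

/-- The projection of a state to the subspace in which qubit `i` has the value `b`. -/
noncomputable def QState.project (i : ℕ) (b : Bool) (ψ : QState) : QState :=
  ψ.filter fun s => decide (i ∈ s) = b

/-- Elementary gates: NOT, Hadamard, the phase gates `S = diag(1, i)` and
`T = diag(1, exp(π i / 4))`, CNOT and Toffoli (target last). The arguments name the classical
registers that hold the numbers of the qubits to which the gate is applied. -/
inductive Gate where
  | not (i : ℕ)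
  | had (i : ℕ)
  | phaseS (i : ℕ)
  | phaseT (i : ℕ)
  | cnot (i t : ℕ)
  | toffoli (i j t : ℕ)

/-- The action of a gate on computational basis states, where `ρ` gives the contents of the
classical registers. A controlled gate whose target is one of its controls does nothing. -/
noncomputable def Gate.onBasis (ρ : ℕ → ℕ) : Gate → Finset ℕ → QState
  | .not i, s => Finsupp.single (symmDiff s {ρ i}) 1
  | .had i, s =>
      Finsupp.single (s.erase (ρ i)) (1 / (Real.sqrt 2 : ℂ)) +
        Finsupp.single (insert (ρ i) s) ((if ρ i ∈ s then -1 else 1) / (Real.sqrt 2 : ℂ))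
  | .phaseS i, s => Finsupp.single s (if ρ i ∈ s then Complex.I else 1)
  | .phaseT i, s => Finsupp.single s (if ρ i ∈ s then Complex.exp (Real.pi * Complex.I / 4) else 1)
  | .cnot i t, s =>
      Finsupp.single (if ρ i ∈ s ∧ ρ t ≠ ρ i then symmDiff s {ρ t} else s) 1
  | .toffoli i j t, s =>
      Finsupp.single (if ρ i ∈ s ∧ ρ j ∈ s ∧ ρ t ≠ ρ i ∧ ρ t ≠ ρ j then symmDiff s {ρ t} else s) 1

/-- The total bit length of the qubit numbers to which a gate is applied. -/
def Gate.addressLength (ρ : ℕ → ℕ) : Gate → ℕ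
  | .not i | .had i | .phaseS i | .phaseT i => (ρ i).size
  | .cnot i t => (ρ i).size + (ρ t).size
  | .toffoli i j t => (ρ i).size + (ρ j).size + (ρ t).size

/-- The contents of the block of qubits `a, a + 1, …, a + n - 1` in the basis state `s`. -/
def readBits (n a : ℕ) (s : Finset ℕ) : Bits n := fun i => decide (a + i ∈ s)

/-- The basis state `s` after the string `w` has been added modulo 2 to the block of qubits
`c, c + 1, …, c + n - 1`. -/
def xorBits {n : ℕ} (c : ℕ) (w : Bits n) (s : Finset ℕ) : Finset ℕ :=
  symmDiff s (Finset.image (fun i : Fin n => c + (i : ℕ)) {i : Fin n | w i = true})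

/-- One quantum query `|x⟩|y⟩|z⟩ ↦ |x⟩|y⟩|z ⊕ f(x, y)⟩` to the black box `f`, on the blocks of `n`
qubits that start at `a`, `b` and `c`. It does nothing if the third block meets one of the
others. -/
noncomputable def oracleOnBasis {n : ℕ} (f : Bits n → Bits n → Bits n) (a b c : ℕ)
    (s : Finset ℕ) : QState :=
  if (a + n ≤ c ∨ c + n ≤ a) ∧ (b + n ≤ c ∨ c + n ≤ b) then
    Finsupp.single (xorBits c (f (readBits n a s) (readBits n b s)) s) 1
  else Finsupp.single s 1

/-! ### Quantum algorithms

A quantum algorithm is a fixed program for a classical random access machine with logarithmic cost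
(its registers hold natural numbers, and an operation is charged according to the bit lengths of
its operands) that also controls a quantum memory. -/

/-- Arithmetic operations on natural numbers. Subtraction is truncated, `a / 0 = 0` and
`a % 0 = a`. -/
inductive ArithOp where
  | add
  | sub
  | mul
  | div
  | mod

/-- The value of an arithmetic operation. -/
def ArithOp.eval : ArithOp → ℕ → ℕ → ℕ
  | .add, a, b => a + b
  | .sub, a, b => a - b
  | .mul, a, b => a * b
  | .div, a, b => a / b
  | .mod, a, b => a % b

/-- Programs. The letters `x y z` name classical registers.
* `const x k`: set `x` to the constant `k`;
* `arith o x y z`: set `x` to the value of the operation `o` at the contents of `y` and `z`;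
* `size x y`: set `x` to the bit length of the content of `y`;
* `ifLe x y c d`: execute `c` if the content of `x` is at most that of `y`, and `d` otherwise;
* `loop x c`: execute `c` as many times as the content of `x` says when the loop is entered;
* `gate G`: apply an elementary gate;
* `measure x y`: measure, in the computational basis, the qubit whose number is in `y`, and store
  the outcome in `x`;
* `query x y z`: query the black box on the blocks of qubits that start at the numbers in
  `x`, `y` and `z`.

Every program halts, since it can only use bounded loops. -/
inductive Prog where
  | skip
  | const (x k : ℕ)
  | arith (o : ArithOp) (x y z : ℕ)
  | size (x y : ℕ)
  | seq (c d : Prog)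
  | ifLe (x y : ℕ) (c d : Prog)
  | loop (x : ℕ) (c : Prog)
  | gate (G : Gate)
  | measure (x y : ℕ)
  | query (x y z : ℕ)

/-- A configuration in a run of a program: the contents of the classical registers, the state of
the quantum memory (its squared norm is the probability of the measurement outcomes so far), the
time used and the number of queries made. -/
structure Config where
  reg : ℕ → ℕ
  mem : QState
  time : ℕ
  queries : ℕ

/-- Let `k` units of time pass. -/
def Config.tick (k : ℕ) (s : Config) : Config := { s with time := s.time + k }

/-- Set register `x` to `v`. -/
def Config.set (x v : ℕ) (s : Config) : Config := { s with reg := Function.update s.reg x v }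

/-- Apply a linear operator to the quantum memory. -/
noncomputable def Config.apply (f : Finset ℕ → QState) (s : Config) : Config :=
  { s with mem := s.mem.apply f }

/-- The final configurations of a program with access to the black box `f`, when it is started
from a given configuration: one for each sequence of measurement outcomes. -/
noncomputable def Prog.run {n : ℕ} (f : Bits n → Bits n → Bits n) : Prog → Config → List Config
  | .skip, s => [s.tick 1]
  | .const x k, s => [(s.tick (1 + k.size)).set x k]
  | .arith o x y z, s =>
      [(s.tick ((1 + (s.reg y).size) * (1 + (s.reg z).size))).set x (o.eval (s.reg y) (s.reg z))]
  | .size x y, s => [(s.tick (1 + (s.reg y).size)).set x (s.reg y).size]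
  | .seq c d, s => (c.run f s).flatMap fun s' => d.run f s'
  | .ifLe x y c d, s =>
      let s' := s.tick (1 + (s.reg x).size + (s.reg y).size)
      if s.reg x ≤ s.reg y then c.run f s' else d.run f s'
  | .loop x c, s =>
      let k := 1 + (s.reg x).size
      (fun l : List Config => l.flatMap fun s' => c.run f (s'.tick k))^[s.reg x] [s.tick k]
  | .gate G, s => [(s.tick (1 + G.addressLength s.reg)).apply (G.onBasis s.reg)]
  | .measure x y, s =>
      [false, true].map fun b =>
        { (s.tick (1 + (s.reg y).size)).set x b.toNat with mem := s.mem.project (s.reg y) b }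
  | .query x y z, s =>
      let s' := s.tick (1 + 3 * n + (s.reg x).size + (s.reg y).size + (s.reg z).size)
      [{ s'.apply (oracleOnBasis f (s.reg x) (s.reg y) (s.reg z)) with queries := s.queries + 1 }]

/-- The initial configuration on input `(n, N, w)`, where `w` is a string of length `n`: the numbers
`n` and `N` are in the registers `0` and `1`, all other registers hold `0`, the string `w` is in
the qubits `0, …, n - 1`, and all other qubits are in the state `0`. -/
noncomputable def initConfig (n N : ℕ) (w : Bits n) : Config where
  reg := fun x => if x = 0 then n else if x = 1 then N else 0
  mem := Finsupp.single (xorBits 0 w ∅) 1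
  time := 0
  queries := 0

/-- The probability that a final configuration satisfies `P`, where `l` lists the final
configurations of the run. -/
noncomputable def prob (l : List Config) (P : Config → Prop) [DecidablePred P] : ℝ :=
  (l.map fun s => if P s then s.mem.weight else 0).sum

/-!
The algorithm finds the period by phase estimation and then the index by binary search.

*Period.* Let `r` be the period and `t` the index of `g`. Repeated squaring yields the encodings of
`g ^ (2 ^ j)`. There is no identity in a semigroup, so a control qubit of weight `2 ^ j` cannot
choose between multiplying by `g ^ (2 ^ j)` and not multiplying; it chooses between multiplying by
`g ^ (2 ^ (j + 1))` and by `g ^ (2 ^ j)`. The exponentiation circuit thus writes `g ^ (T + e)`, where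
`e` is the sum of the weights of the control qubits that are `1` and `T` is a constant, and then
erases whatever else depends on them (`exponentiateProg_det`, `expMap_spec`). As `T ≥ t`, only the cycle
`g ^ T, …, g ^ (T + r - 1)` matters, on which multiplication by `g` is a cyclic shift. Its
eigenvalues are the powers of `exp (-2 * π * i / r)`, and the state of the circuit is an equal
superposition of its eigenvectors (`eigenState`, `mapDomain_expMap_uniformState`), each of which
leaves the control qubits unentangled. The gates allow no exact Fourier transform, but a digit of the
phase `s / r` can be found by a majority vote among `K` qubits of the same weight, where the digits
found before are taken into account by rotating by a multiple of `1 / 8` of a full turn. The vote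
goes wrong with probability at most `(71 / 72) ^ K` (`voteVal_ge_of_zero`, `digitVal_ge`,
`phaseProg_wp`). The Euclidean algorithm recovers the reduced denominator of `s / r` from its digits
(`approxDenominator_eq`). It is `r` if `s` is coprime to `r`, which has probability
`φ(r) / r ≥ 1 / (log₂ r + 1)` (`le_totient_mul_log_add_one`), so the largest of logarithmically many
denominators is `r` with high probability (`sample_iterate`, `two_thirds_le_sampleVal`).

*Index.* For `e ≥ 1`, `g ^ e = g ^ (e + r)` if and only if `t ≤ e`. Since encodings are unique, this
can be tested, and a binary search finds `t` (`searchProg_det`).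

*Method.* Runs are analysed by weakest preexpectations (`Prog.wp`): the final value of a functional
of registers and memory, summed over all outcomes. `Det` is the special case of a program whose
result is certain. The time bound is syntactic (`Prog.tame_bounds`): a program in which only a few
registers that are never overwritten control loops, and in which products are clamped, increases the
bit lengths of its registers by a bounded amount in each step.

*Registers.* `0`: `n`; `1`: `N`; `2`: number `J` of digits; `3`: number `K` of votes; `4`: number of
samples; `5`: number of Euclidean steps; `6`, `7`, `8`, `41`, `42`: the constants `0`, `1`, `2`, `3`,
`4`; `9`: first fresh qubit; `10`: largest denominator; `11` to `19` and `33`: pointers to qubits;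
`20` to `25`: phase estimation; `26` to `31`: Euclidean algorithm; `34` to `40`: binary search.
-/

section

/-! ### Weakest preexpectations of programs -/

/-- `p.wp f Φ ρ ψ` is the sum of the values of `Φ` over the final configurations of `p` when it is
started with the registers `ρ` and the quantum memory `ψ`. Time and queries are ignored. -/
noncomputable def Prog.wp {n : ℕ} (f : Bits n → Bits n → Bits n) :
    Prog → ((ℕ → ℕ) → QState → ℝ) → (ℕ → ℕ) → QState → ℝ
  | .skip, Φ, ρ, ψ => Φ ρ ψ
  | .const x k, Φ, ρ, ψ => Φ (Function.update ρ x k) ψ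
  | .arith o x y z, Φ, ρ, ψ => Φ (Function.update ρ x (o.eval (ρ y) (ρ z))) ψ
  | .size x y, Φ, ρ, ψ => Φ (Function.update ρ x (ρ y).size) ψ
  | .seq c d, Φ, ρ, ψ => c.wp f (d.wp f Φ) ρ ψ
  | .ifLe x y c d, Φ, ρ, ψ => if ρ x ≤ ρ y then c.wp f Φ ρ ψ else d.wp f Φ ρ ψ
  | .loop x c, Φ, ρ, ψ => (c.wp f)^[ρ x] Φ ρ ψ
  | .gate G, Φ, ρ, ψ => Φ ρ (ψ.apply (G.onBasis ρ))
  | .measure x y, Φ, ρ, ψ =>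
      Φ (Function.update ρ x 0) (ψ.project (ρ y) false) +
        Φ (Function.update ρ x 1) (ψ.project (ρ y) true)
  | .query x y z, Φ, ρ, ψ => Φ ρ (ψ.apply (oracleOnBasis f (ρ x) (ρ y) (ρ z)))

variable {n : ℕ} {f : Bits n → Bits n → Bits n}

theorem List.sum_map_flatMap {α β : Type*} (l : List α) (g : α → List β) (F : β → ℝ) :
    ((l.flatMap g).map F).sum = (l.map fun a => ((g a).map F).sum).sum := by
  induction l with
  | nil => simp
  | cons a l ih => simp [ih]

/-- A sum over the final configurations of a run, such as a success probability, is a weakest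
preexpectation. -/
theorem Prog.sum_run (c : Prog) (Φ : (ℕ → ℕ) → QState → ℝ) (s : Config) :
    ((c.run f s).map fun s' => Φ s'.reg s'.mem).sum = c.wp f Φ s.reg s.mem := by
  induction c generalizing Φ s with
  | skip => simp [Prog.run, Prog.wp, Config.tick]
  | const x k => simp [Prog.run, Prog.wp, Config.tick, Config.set]
  | arith o x y z => simp [Prog.run, Prog.wp, Config.tick, Config.set]
  | size x y => simp [Prog.run, Prog.wp, Config.tick, Config.set]
  | seq c d hc hd =>
    simp only [Prog.run, Prog.wp, List.sum_map_flatMap, hd]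
    exact hc (d.wp f Φ) s
  | ifLe x y c d hc hd =>
    simp only [Prog.run, Prog.wp]
    split_ifs
    · rw [hc]; rfl
    · rw [hd]; rfl
  | loop x c hc =>
    simp only [Prog.run, Prog.wp]
    have key : ∀ (k t : ℕ) (Φ : (ℕ → ℕ) → QState → ℝ) (l : List Config),
        (((fun l : List Config => l.flatMap fun s' => c.run f (s'.tick t))^[k] l).map
          fun s' => Φ s'.reg s'.mem).sum =
        (l.map fun s' => (c.wp f)^[k] Φ s'.reg s'.mem).sum := by
      intro k t
      induction k with
      | zero => intros; rfl
      | succ k ih =>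
        intro Φ l
        rw [Function.iterate_succ_apply, ih, List.sum_map_flatMap, Function.iterate_succ_apply']
        congr 2
        funext s'
        rw [hc]; rfl
    rw [key]
    simp [Config.tick]
  | gate G => simp [Prog.run, Prog.wp, Config.tick, Config.apply]
  | measure x y => simp [Prog.run, Prog.wp, Config.tick, Config.set]
  | query x y z => simp [Prog.run, Prog.wp, Config.tick, Config.apply]

theorem Prog.wp_mono (c : Prog) {Φ Φ' : (ℕ → ℕ) → QState → ℝ} (h : ∀ ρ ψ, Φ ρ ψ ≤ Φ' ρ ψ)
    (ρ : ℕ → ℕ) (ψ : QState) : c.wp f Φ ρ ψ ≤ c.wp f Φ' ρ ψ := by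
  induction c generalizing Φ Φ' ρ ψ with
  | seq c d hc hd => exact hc (fun ρ ψ => hd h ρ ψ) ρ ψ
  | ifLe x y c d hc hd =>
    simp only [Prog.wp]
    split_ifs
    · exact hc h ρ ψ
    · exact hd h ρ ψ
  | loop x c hc =>
    simp only [Prog.wp]
    generalize ρ x = k
    induction k generalizing Φ Φ' with
    | zero => exact h ρ ψ
    | succ k ih => exact ih (fun ρ ψ => hc h ρ ψ)
  | measure x y => exact add_le_add (h _ _) (h _ _)
  | _ => exact h _ _

theorem Prog.wp_zero (c : Prog) (ρ : ℕ → ℕ) (ψ : QState) :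
    c.wp f (fun _ _ => 0) ρ ψ = 0 := by
  induction c generalizing ρ ψ with
  | seq c d hc hd =>
    have : d.wp f (fun _ _ => 0) = fun _ _ => 0 := by funext; exact hd _ _
    simp [Prog.wp, this, hc]
  | ifLe x y c d hc hd => simp [Prog.wp, hc, hd]
  | loop x c hc =>
    have : c.wp f (fun _ _ => 0) = fun _ _ => 0 := by funext; exact hc _ _
    simp only [Prog.wp]
    rw [Function.iterate_fixed this]
  | _ => simp [Prog.wp]

theorem Prog.wp_nonneg (c : Prog) {Φ : (ℕ → ℕ) → QState → ℝ} (h : ∀ ρ ψ, 0 ≤ Φ ρ ψ)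
    (ρ : ℕ → ℕ) (ψ : QState) : 0 ≤ c.wp f Φ ρ ψ :=
  (c.wp_zero ρ ψ).symm.le.trans (c.wp_mono h ρ ψ)

theorem Prog.iterate_wp_nonneg (c : Prog) (k : ℕ) {Φ : (ℕ → ℕ) → QState → ℝ}
    (h : ∀ ρ ψ, 0 ≤ Φ ρ ψ) : ∀ ρ ψ, 0 ≤ (c.wp f)^[k] Φ ρ ψ := by
  induction k generalizing Φ with
  | zero => exact h
  | succ k ih => exact ih (c.wp_nonneg h)

/-- The registers to which a program may write. -/
def Prog.writes : Prog → List ℕ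
  | .skip | .gate _ | .query _ _ _ => []
  | .const x _ | .arith _ x _ _ | .size x _ | .measure x _ => [x]
  | .seq c d | .ifLe _ _ c d => c.writes ++ d.writes
  | .loop _ c => c.writes

/-- In a preexpectation, only register contents that agree with the initial ones outside the written
registers matter. -/
theorem Prog.wp_congr_frame (c : Prog) {Φ Φ' : (ℕ → ℕ) → QState → ℝ} (ρ₀ ρ : ℕ → ℕ) (ψ : QState)
    (L : List ℕ) (hL : c.writes ⊆ L) (h : ∀ ρ', (∀ x ∉ L, ρ' x = ρ₀ x) → ∀ ψ, Φ ρ' ψ = Φ' ρ' ψ)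
    (hρ : ∀ x ∉ L, ρ x = ρ₀ x) : c.wp f Φ ρ ψ = c.wp f Φ' ρ ψ := by
  have upd : ∀ (ρ : ℕ → ℕ) (x v : ℕ), x ∈ L → (∀ x ∉ L, ρ x = ρ₀ x) →
      ∀ y ∉ L, Function.update ρ x v y = ρ₀ y := by
    intro ρ x v hx hρ y hy
    rw [Function.update_of_ne (by rintro rfl; exact hy hx)]
    exact hρ y hy
  induction c generalizing Φ Φ' ρ ψ with
  | skip => exact h _ hρ _
  | gate G => exact h _ hρ _
  | query x y z => exact h _ hρ _
  | const x k => exact h _ (upd _ _ _ (hL (by simp [Prog.writes])) hρ) _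
  | arith o x y z => exact h _ (upd _ _ _ (hL (by simp [Prog.writes])) hρ) _
  | size x y => exact h _ (upd _ _ _ (hL (by simp [Prog.writes])) hρ) _
  | measure x y =>
    exact congrArg₂ _ (h _ (upd _ _ _ (hL (by simp [Prog.writes])) hρ) _)
      (h _ (upd _ _ _ (hL (by simp [Prog.writes])) hρ) _)
  | seq c d hc hd =>
    simp only [Prog.writes, List.append_subset] at hL
    exact hc ρ ψ hL.1 (fun ρ' hρ' ψ => hd ρ' ψ hL.2 h hρ') hρ
  | ifLe x y c d hc hd =>
    simp only [Prog.writes, List.append_subset] at hL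
    simp only [Prog.wp]
    rw [hc ρ ψ hL.1 h hρ, hd ρ ψ hL.2 h hρ]
  | loop x c hc =>
    simp only [Prog.wp]
    generalize ρ x = k
    induction k generalizing Φ Φ' with
    | zero => exact h ρ hρ ψ
    | succ k ih => exact ih (fun ρ' hρ' ψ => hc ρ' ψ hL h hρ')

/-! ### Certain outcomes -/

/-- `Det f c ρ ψ Q` says that a run of `c` from the registers `ρ` and the memory `ψ` ends with
certainty in a configuration that satisfies `Q`, the norm of the memory being unchanged. This is
phrased as a lower bound for every nonnegative preexpectation, so that it can be chained with
probabilistic lower bounds. -/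
def Det {n : ℕ} (f : Bits n → Bits n → Bits n) (c : Prog) (ρ : ℕ → ℕ) (ψ : QState)
    (Q : (ℕ → ℕ) → QState → Prop) : Prop :=
  ∀ (Φ : (ℕ → ℕ) → QState → ℝ) (v : ℝ), (∀ ρ ψ, 0 ≤ Φ ρ ψ) → (∀ ρ' ψ', Q ρ' ψ' → v ≤ Φ ρ' ψ') →
    v ≤ c.wp f Φ ρ ψ

namespace Det

variable {c d : Prog} {ρ : ℕ → ℕ} {ψ : QState} {Q R : (ℕ → ℕ) → QState → Prop}

theorem mono (h : Det f c ρ ψ R) (hRQ : ∀ ρ' ψ', R ρ' ψ' → Q ρ' ψ') : Det f c ρ ψ Q :=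
  fun Φ v h0 hΦ => h Φ v h0 fun _ _ hr => hΦ _ _ (hRQ _ _ hr)

theorem seq (h : Det f c ρ ψ R) (h' : ∀ ρ' ψ', R ρ' ψ' → Det f d ρ' ψ' Q) :
    Det f (.seq c d) ρ ψ Q :=
  fun Φ v h0 hΦ => h _ v (d.wp_nonneg h0) fun _ _ hr => h' _ _ hr Φ v h0 hΦ

theorem skip (h : Q ρ ψ) : Det f .skip ρ ψ Q := fun _ _ _ hΦ => hΦ _ _ h

theorem arith {o : ArithOp} {x y z : ℕ} (h : Q (Function.update ρ x (o.eval (ρ y) (ρ z))) ψ) :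
    Det f (.arith o x y z) ρ ψ Q := fun _ _ _ hΦ => hΦ _ _ h

theorem query {x y z : ℕ} (h : Q ρ (ψ.apply (oracleOnBasis f (ρ x) (ρ y) (ρ z)))) :
    Det f (.query x y z) ρ ψ Q := fun _ _ _ hΦ => hΦ _ _ h

theorem ifLe {x y : ℕ} (hc : ρ x ≤ ρ y → Det f c ρ ψ Q) (hd : ρ y < ρ x → Det f d ρ ψ Q) :
    Det f (.ifLe x y c d) ρ ψ Q := by
  intro Φ v h0 hΦ
  simp only [Prog.wp]
  split_ifs with h
  · exact hc h Φ v h0 hΦ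
  · exact hd (not_le.1 h) Φ v h0 hΦ

/-- Registers that a program does not write keep their contents. -/
theorem frame (h : Det f c ρ ψ Q) :
    Det f c ρ ψ fun ρ' ψ' => Q ρ' ψ' ∧ ∀ x ∉ c.writes, ρ' x = ρ x := by
  classical
  intro Φ v h0 hΦ
  rw [c.wp_congr_frame (Φ' := fun ρ' ψ' => if ∀ x ∉ c.writes, ρ' x = ρ x then Φ ρ' ψ' else
    max v 0) ρ ρ ψ c.writes (List.Subset.refl _) (fun ρ' hρ' ψ => (if_pos hρ').symm)
    (fun _ _ => rfl)]
  apply h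
  · intro ρ' ψ'
    split_ifs
    · exact h0 _ _
    · exact le_max_right _ _
  · intro ρ' ψ' hQ
    split_ifs with hf
    · exact hΦ _ _ ⟨hQ, hf⟩
    · exact le_max_left _ _

theorem iterate {k : ℕ} (I : ℕ → (ℕ → ℕ) → QState → Prop) (h0 : I 0 ρ ψ)
    (hI : ∀ i < k, ∀ ρ ψ, I i ρ ψ → Det f c ρ ψ (I (i + 1))) {Φ : (ℕ → ℕ) → QState → ℝ} {v : ℝ}
    (hΦ : ∀ ρ ψ, 0 ≤ Φ ρ ψ) (hv : ∀ ρ' ψ', I k ρ' ψ' → v ≤ Φ ρ' ψ') :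
    v ≤ (c.wp f)^[k] Φ ρ ψ := by
  induction k generalizing Φ with
  | zero => exact hv _ _ h0
  | succ k ih =>
    exact ih (fun i hi => hI i (by omega)) (c.wp_nonneg hΦ)
      fun ρ' ψ' h => hI k (by omega) ρ' ψ' h Φ v hΦ hv

/-- The rule for loops: the invariant `I` may use that the registers that the body does not write
keep their contents. -/
theorem loop {x : ℕ} (I : ℕ → (ℕ → ℕ) → QState → Prop) (h0 : I 0 ρ ψ)
    (hI : ∀ i < ρ x, ∀ ρ' ψ', (∀ y ∉ c.writes, ρ' y = ρ y) → I i ρ' ψ' →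
      Det f c ρ' ψ' (I (i + 1)))
    (hQ : ∀ ρ' ψ', (∀ y ∉ c.writes, ρ' y = ρ y) → I (ρ x) ρ' ψ' → Q ρ' ψ') :
    Det f (.loop x c) ρ ψ Q := by
  intro Φ v hΦ hv
  refine iterate (fun i ρ' ψ' => (∀ y ∉ c.writes, ρ' y = ρ y) ∧ I i ρ' ψ') ⟨fun _ _ => rfl, h0⟩
    (fun i hi ρ' ψ' h => ((hI i hi ρ' ψ' h.1 h.2).frame).mono fun ρ'' ψ'' h' =>
      ⟨fun y hy => (h'.2 y hy).trans (h.1 y hy), h'.1⟩) hΦ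
    fun ρ' ψ' h => hv _ _ (hQ _ _ h.1 h.2)

end Det

/-! ### Syntactic bounds on running time -/

/-- The program multiplies and then resets the product if it exceeds the content of `w`. -/
def clampedMul (x y z w : ℕ) : Prog :=
  .seq (.arith .mul x y z) (.ifLe x w .skip (.const x 0))

/-- `isClampedMul c d` says that `c` followed by `d` is a clamped multiplication. -/
def Prog.isClampedMul : Prog → Prog → Bool
  | .arith .mul x _ _, .ifLe x' w .skip (.const x'' 0) => x == x' && x == x'' && x != w
  | _, _ => false

/-- The program makes no queries. -/
def Prog.queryFree : Prog → Bool
  | .query _ _ _ => false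
  | .seq c d | .ifLe _ _ c d => c.queryFree && d.queryFree
  | .loop _ c => c.queryFree
  | _ => true

/-- The program does not write to the registers in `F`, only these control loops, products are
clamped, and the loops that are controlled by register `0` make no queries. -/
def Prog.tame (F : List ℕ) : Prog → Bool
  | .skip | .gate _ | .query _ _ _ => true
  | .const x _ | .size x _ | .measure x _ => !F.contains x
  | .arith .mul _ _ _ => false
  | .arith _ x _ _ => !F.contains x
  | .seq c d =>
      (c.isClampedMul d && (c.writes.all fun x => !F.contains x)) || (c.tame F && d.tame F)
  | .ifLe _ _ c d => c.tame F && d.tame F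
  | .loop x c => F.contains x && (x != 0 || c.queryFree) && c.tame F

/-- A bound on the number of elementary steps, if the loops controlled by `x` run at most `β x`
times. -/
def Prog.steps (β : ℕ → ℕ) : Prog → ℕ
  | .const _ k => 1 + k.size
  | .seq c d | .ifLe _ _ c d => 1 + c.steps β + d.steps β
  | .loop x c => 1 + β x * (1 + c.steps β)
  | _ => 1

/-- A bound on the number of queries, if every loop with queries runs at most `b` times. -/
def Prog.queryBound (b : ℕ) : Prog → ℕ
  | .query _ _ _ => 1
  | .seq c d | .ifLe _ _ c d => c.queryBound b + d.queryBound b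
  | .loop _ c => b * c.queryBound b
  | _ => 0

theorem Prog.queryBound_of_queryFree {c : Prog} (h : c.queryFree) (b : ℕ) :
    c.queryBound b = 0 := by
  induction c <;> simp_all [Prog.queryFree, Prog.queryBound]

theorem Prog.isClampedMul_spec {c d : Prog} (h : c.isClampedMul d) :
    ∃ x y z w, x ≠ w ∧ c = .arith .mul x y z ∧ d = .ifLe x w .skip (.const x 0) := by
  unfold Prog.isClampedMul at h
  split at h
  · simp at h
    obtain ⟨⟨rfl, rfl⟩, h⟩ := h
    exact ⟨_, _, _, _, h, rfl, rfl⟩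
  · simp at h

/-- The largest cost of an elementary step while all registers have bit length at most `L`, and
the product of two of them at most `2 * L`. -/
def stepCost (n L : ℕ) : ℕ := (1 + 2 * L) * (1 + 2 * L) + 3 * n + 3 * L

theorem ArithOp.size_eval_le {o : ArithOp} (ho : o ≠ .mul) {a b S : ℕ} (ha : a.size ≤ S)
    (hb : b.size ≤ S) : (o.eval a b).size ≤ S + 1 := by
  rw [Nat.size_le] at *
  rw [pow_succ]
  cases o <;> simp only [ArithOp.eval]
  · omega
  · omega
  · exact absurd rfl ho
  · exact (Nat.div_le_self a b).trans_lt (by omega)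
  · exact (Nat.mod_le a b).trans_lt (by omega)

theorem ArithOp.size_mul_le {a b S : ℕ} (ha : a.size ≤ S)
    (hb : b.size ≤ S) : (a * b).size ≤ 2 * S := by
  rw [Nat.size_le] at *
  rw [two_mul, pow_add]
  exact Nat.mul_lt_mul'' ha hb

/-- A run of a tame program has its time, the bit lengths of its registers and its number of
queries bounded by the syntactic step counts. -/
theorem Prog.tame_bounds {F : List ℕ} {β : ℕ → ℕ} {b L : ℕ} (hβ : ∀ x ∈ F, x ≠ 0 → β x ≤ b)
    (c : Prog) (hc : c.tame F)
    (s : Config) (hF : ∀ x ∈ F, s.reg x ≤ β x) (S : ℕ) (hS : ∀ x, (s.reg x).size ≤ S)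
    (hL : S + c.steps β ≤ L) (s' : Config) (hs' : s' ∈ c.run f s) :
    (∀ x ∈ F, s'.reg x = s.reg x) ∧ (∀ x, (s'.reg x).size ≤ S + c.steps β) ∧
      s'.time ≤ s.time + c.steps β * stepCost n L ∧
      s'.queries ≤ s.queries + c.queryBound b := by
  have upd : ∀ {x v S S' : ℕ} {ρ : ℕ → ℕ}, (∀ x, (ρ x).size ≤ S) → S ≤ S' → v.size ≤ S' →
      ∀ y, (Function.update ρ x v y).size ≤ S' := by
    intro x v S S' ρ hρ hS' hv y
    rcases eq_or_ne y x with rfl | h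
    · simpa using hv
    · rw [Function.update_of_ne h]; exact (hρ y).trans hS'
  have updF : ∀ {x v : ℕ} {ρ : ℕ → ℕ}, x ∉ F → ∀ y ∈ F, Function.update ρ x v y = ρ y := by
    intro x v ρ hx y hy
    exact Function.update_of_ne (by rintro rfl; exact hx hy) _ _
  induction c generalizing s S s' with
  | skip =>
    simp only [Prog.run, List.mem_singleton] at hs'
    subst hs'
    refine ⟨fun _ _ => rfl, fun x => (hS x).trans (by omega), ?_, by simp [Config.tick]⟩
    simp only [Config.tick, Prog.steps, stepCost]; nlinarith
  | const x k =>
    simp only [Prog.run, List.mem_singleton] at hs'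
    simp only [Prog.tame, Bool.not_eq_true', List.contains_eq_mem, decide_eq_false_iff_not] at hc
    subst hs'
    refine ⟨updF hc, upd hS (by omega) (by simp only [Prog.steps]; omega), ?_,
      by simp [Config.tick, Config.set]⟩
    have h1 : 1 ≤ stepCost n L := by simp only [stepCost]; nlinarith
    simp only [Config.tick, Config.set, Prog.steps]; nlinarith
  | size x y =>
    simp only [Prog.run, List.mem_singleton] at hs'
    simp only [Prog.tame, Bool.not_eq_true', List.contains_eq_mem, decide_eq_false_iff_not] at hc
    subst hs'
    have := hS y
    refine ⟨updF hc, upd hS (by omega) ?_, ?_, by simp [Config.tick, Config.set]⟩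
    · refine le_trans ?_ (this.trans (Nat.le_add_right _ _))
      exact Nat.size_le.2 Nat.lt_two_pow_self
    · simp only [Config.tick, Config.set, Prog.steps, stepCost]; nlinarith
  | measure x y =>
    simp only [Prog.run] at hs'
    simp only [Prog.tame, Bool.not_eq_true', List.contains_eq_mem, decide_eq_false_iff_not] at hc
    have := hS y
    obtain ⟨t, -, rfl⟩ := List.mem_map.1 hs'
    refine ⟨updF hc, upd hS (by omega) ?_, ?_, by simp [Config.tick, Config.set]⟩
    · simp only [Prog.steps]
      cases t <;> simp
    · simp only [Config.tick, Config.set, Prog.steps, stepCost]; nlinarith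
  | gate G =>
    simp only [Prog.run, List.mem_singleton] at hs'
    subst hs'
    refine ⟨fun _ _ => rfl, fun x => (hS x).trans (by omega), ?_,
      by simp [Config.tick, Config.apply]⟩
    have : G.addressLength s.reg ≤ 3 * L := by
      have hS' : ∀ x, (s.reg x).size ≤ L := fun x => (hS x).trans (by omega)
      cases G with
      | toffoli i j t =>
        have := hS' i; have := hS' j; have := hS' t
        simp only [Gate.addressLength]; omega
      | cnot i t =>
        have := hS' i; have := hS' t
        simp only [Gate.addressLength]; omega
      | _ i =>
        have := hS' i
        simp only [Gate.addressLength]; omega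
    simp only [Config.tick, Config.apply, Prog.steps, stepCost]; nlinarith
  | query x y z =>
    simp only [Prog.run, List.mem_singleton] at hs'
    subst hs'
    refine ⟨fun _ _ => rfl, fun x => (hS x).trans (by omega), ?_,
      by simp [Prog.queryBound]⟩
    have := hS x; have := hS y; have := hS z
    simp only [Config.tick, Config.apply, Prog.steps, stepCost]; nlinarith
  | arith o x y z =>
    simp only [Prog.run, List.mem_singleton] at hs'
    have ho : o ≠ .mul := by rintro rfl; simp [Prog.tame] at hc
    have hx : x ∉ F := by
      cases o <;> simp_all [Prog.tame]
    subst hs'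
    refine ⟨updF hx, upd hS (by omega) (ArithOp.size_eval_le ho (hS y) (hS z)), ?_,
      by simp [Config.tick, Config.set]⟩
    have h1 : 1 + (s.reg y).size ≤ 1 + 2 * L := by have := hS y; omega
    have h2 : 1 + (s.reg z).size ≤ 1 + 2 * L := by have := hS z; omega
    have := Nat.mul_le_mul h1 h2
    simp only [Config.tick, Config.set, Prog.steps, stepCost]; omega
  | ifLe x y c d ihc ihd =>
    simp only [Prog.tame, Bool.and_eq_true] at hc
    simp only [Prog.run] at hs'
    simp only [Prog.steps] at hL ⊢
    have h1 : 1 + (s.reg x).size + (s.reg y).size ≤ stepCost n L := by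
      have := hS x; have := hS y
      simp only [stepCost]; nlinarith
    simp only [Prog.queryBound]
    split_ifs at hs' with h
    · obtain ⟨e1, e2, e3, e4⟩ := ihc hc.1 (s.tick _) hF S hS (by omega) s' hs'
      refine ⟨e1, fun x => (e2 x).trans (by omega), e3.trans ?_, e4.trans ?_⟩
      · simp only [Config.tick]; nlinarith
      · simp only [Config.tick]; omega
    · obtain ⟨e1, e2, e3, e4⟩ := ihd hc.2 (s.tick _) hF S hS (by omega) s' hs'
      refine ⟨e1, fun x => (e2 x).trans (by omega), e3.trans ?_, e4.trans ?_⟩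
      · simp only [Config.tick]; nlinarith
      · simp only [Config.tick]; omega
  | seq c d ihc ihd =>
    simp only [Prog.steps] at hL ⊢
    simp only [Prog.tame, Bool.or_eq_true, Bool.and_eq_true] at hc
    rcases hc with ⟨hm, hx⟩ | hc
    · obtain ⟨x, y, z, w, hxw, rfl, rfl⟩ := Prog.isClampedMul_spec hm
      have hx : x ∉ F := by simpa [Prog.writes] using hx
      have hw := hS w
      have hmul := ArithOp.size_mul_le (hS y) (hS z)
      have h1 : 1 + (s.reg y).size ≤ 1 + 2 * L := by have := hS y; omega
      have h2 : 1 + (s.reg z).size ≤ 1 + 2 * L := by have := hS z; omega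
      have h3 := Nat.mul_le_mul h1 h2
      simp only [Prog.run, List.flatMap_cons, List.flatMap_nil, List.append_nil, Config.set,
        Config.tick, Function.update_self, Function.update_of_ne hxw.symm, ArithOp.eval] at hs'
      have h4 : 2 * (1 + 2 * L) * (1 + 2 * L) + 6 * n + 6 * L = 2 * stepCost n L := by
        simp only [stepCost]; ring
      have h5 : 3 * L ≤ 3 * L * L + n ∨ L = 0 := by
        rcases Nat.eq_zero_or_pos L with h | h
        · exact .inr h
        · left; nlinarith
      simp only [Prog.steps, Prog.queryBound, Nat.size_zero] at *
      split_ifs at hs' with h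
      · simp only [List.mem_singleton] at hs'
        subst hs'
        refine ⟨updF hx, upd hS (by omega) ((Nat.size_le_size h).trans (by omega)), ?_, by simp⟩
        simp only; nlinarith
      · simp only [List.mem_singleton, Function.update_idem] at hs'
        subst hs'
        refine ⟨updF hx, upd hS (by omega) (by simp), ?_, by simp⟩
        simp only; nlinarith
    · simp only [Prog.run, List.mem_flatMap] at hs'
      obtain ⟨s₁, h₁, h₂⟩ := hs'
      obtain ⟨e1, e2, e3, e4⟩ := ihc hc.1 s hF S hS (by omega) s₁ h₁
      obtain ⟨g1, g2, g3, g4⟩ := ihd hc.2 s₁ (fun x hx => (e1 x hx).trans_le (hF x hx)) _ e2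
        (by omega) s' h₂
      refine ⟨fun x hx => (g1 x hx).trans (e1 x hx), fun x => (g2 x).trans (by omega), ?_, ?_⟩
      · refine g3.trans ((Nat.add_le_add_right e3 _).trans ?_)
        rw [Nat.add_mul, Nat.add_mul]; omega
      · simp only [Prog.queryBound]; omega
  | loop x c ihc =>
    simp only [Prog.tame, Bool.and_eq_true, List.contains_eq_mem, decide_eq_true_eq,
      Bool.or_eq_true, bne_iff_ne] at hc
    obtain ⟨⟨hxF, hq⟩, hc⟩ := hc
    simp only [Prog.run] at hs'
    simp only [Prog.steps] at hL ⊢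
    have hxβ := hF x hxF
    have hk1 : 1 + (s.reg x).size ≤ stepCost n L := by
      have := hS x
      simp only [stepCost]; nlinarith
    set t := 1 + (s.reg x).size with ht
    have key : ∀ k, k ≤ β x → ∀ s' ∈ (fun l : List Config => l.flatMap fun s' =>
        c.run f (s'.tick t))^[k] [s.tick t], (∀ x ∈ F, s'.reg x = s.reg x) ∧
        (∀ x, (s'.reg x).size ≤ S + k * (1 + c.steps β)) ∧
        s'.time ≤ s.time + (1 + k * (1 + c.steps β)) * stepCost n L ∧
        s'.queries ≤ s.queries + k * c.queryBound b := by
      intro k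
      induction k with
      | zero =>
        intro _ s' hs'
        simp only [Function.iterate_zero, id, List.mem_singleton] at hs'
        subst hs'
        refine ⟨fun _ _ => rfl, by simpa [Config.tick] using hS, ?_, by simp [Config.tick]⟩
        simp only [Config.tick]; nlinarith
      | succ k ih =>
        intro hk s' hs'
        rw [Function.iterate_succ_apply', List.mem_flatMap] at hs'
        obtain ⟨s₁, h₁, h₂⟩ := hs'
        obtain ⟨e1, e2, e3, e4⟩ := ih (by omega) s₁ h₁
        have hle : (k + 1) * (1 + c.steps β) ≤ β x * (1 + c.steps β) :=
          Nat.mul_le_mul_right _ hk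
        have hsplit : (k + 1) * (1 + c.steps β) = k * (1 + c.steps β) + (1 + c.steps β) := by ring
        obtain ⟨g1, g2, g3, g4⟩ := ihc hc (s₁.tick t)
          (fun x hx => (e1 x hx).trans_le (hF x hx)) _ e2 (by omega) s' h₂
        refine ⟨fun x hx => (g1 x hx).trans (e1 x hx), fun x => (g2 x).trans (by omega), ?_, ?_⟩
        · refine g3.trans ?_
          simp only [Config.tick]
          rw [hsplit]
          nlinarith
        · refine g4.trans ?_
          simp only [Config.tick]
          rw [Nat.add_mul]; omega
    obtain ⟨e1, e2, e3, e4⟩ := key _ hxβ s' hs'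
    have hle : s.reg x * (1 + c.steps β) ≤ β x * (1 + c.steps β) := Nat.mul_le_mul_right _ hxβ
    refine ⟨e1, fun x => (e2 x).trans (by omega), e3.trans ?_, e4.trans ?_⟩
    · gcongr
    · simp only [Prog.queryBound]
      rcases hq with hx0 | hqf
      · have := hxβ.trans (hβ x hxF hx0)
        gcongr
      · simp [Prog.queryBound_of_queryFree hqf]

end

/-! ### The program -/

infixr:50 " ;; " => Prog.seq

/-- Copy register `y` to register `x`; register `6` always holds `0`. -/
def mov (x y : ℕ) : Prog := .arith .add x y 6

/-- Add register `y` to register `x`. -/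
def inc (x y : ℕ) : Prog := .arith .add x x y

/-- Subtract register `y` from register `x`. -/
def dec (x y : ℕ) : Prog := .arith .sub x x y

/-- Set up the constants and the parameters `J = 2 * size N + 3`, `K = 256 * J`, the number
`4 * J` of samples, the number `2 * J + 1` of Euclidean steps and the threshold `2 * N`. -/
def setupProg : Prog :=
  .const 7 1 ;; .const 8 2 ;; .const 41 3 ;; .const 42 4 ;;
  .size 2 1 ;; .arith .add 2 2 2 ;; .arith .add 2 2 41 ;;
  .arith .add 3 2 2 ;; .arith .add 4 3 3 ;; .arith .add 5 3 7 ;;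
  .arith .add 3 4 4 ;; .arith .add 3 3 3 ;; .arith .add 3 3 3 ;; .arith .add 3 3 3 ;;
  .arith .add 3 3 3 ;; .arith .add 3 3 3 ;; .arith .add 31 1 1

/-- Compute the encodings of `g ^ (2 ^ j)` for `j ≤ J` by repeated squaring, in consecutive blocks
from qubit `0` on. Register `9` then points to the first unused qubit. -/
def powersProg : Prog :=
  mov 9 0 ;; mov 12 6 ;; .loop 2 (.query 12 12 9 ;; mov 12 9 ;; inc 9 0)

/-- Apply Hadamard gates to `J * K` fresh control qubits, and fill the first block of the chain. -/
def hadamardProg : Prog :=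
  mov 11 9 ;; .loop 2 (.loop 3 (.gate (.had 11) ;; inc 11 7))

/-- One step of `selectProg`, which treats a single bit. -/
def selectBitProg : Prog :=
  .gate (.cnot 17 19) ;; .gate (.toffoli 11 17 19) ;; .gate (.toffoli 11 18 19) ;;
  inc 17 7 ;; inc 18 7 ;; inc 19 7

/-- Add to the block at register `14` the block at register `13` if the control qubit at register
`11` is `1`, and the block at register `12` otherwise. -/
def selectProg : Prog :=
  mov 17 12 ;; mov 18 13 ;; mov 19 14 ;; .loop 0 selectBitProg

/-- Pointers to the first operand block, the first block of the chain and the control qubits, and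
the first block of the chain. -/
def chainInitProg : Prog :=
  mov 14 11 ;; mov 15 11 ;; .loop 2 (.loop 3 (inc 15 0)) ;;
  .query 6 6 15 ;; .arith .add 16 15 0 ;; mov 11 9 ;; mov 12 6 ;; mov 13 0

/-- Move the pointers of the chain one step forward. -/
def forwardProg : Prog := inc 11 7 ;; inc 14 0 ;; inc 15 0 ;; inc 16 0

/-- Move the pointers of the chain one step back. -/
def backProg : Prog := dec 11 7 ;; dec 14 0 ;; dec 15 0 ;; dec 16 0

/-- Multiply the current block of the chain by the operand that each control qubit selects. -/
def chainProg : Prog :=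
  .loop 2 (.loop 3 (selectProg ;; .query 15 14 16 ;; forwardProg) ;; inc 12 0 ;; inc 13 0)

/-- Undo `chainProg`. -/
def unchainProg : Prog :=
  .loop 2 (dec 12 0 ;; dec 13 0 ;; .loop 3 (backProg ;; .query 15 14 16 ;; selectProg))

/-- Write a power of `g`, whose exponent is an affine function of the control qubits, to a fresh
block, and clean up. -/
def exponentiateProg : Prog :=
  chainInitProg ;; chainProg ;; mov 33 16 ;; .query 15 6 33 ;; unchainProg

/-- Turn the next control qubit by `k` eighths of a full turn, where `k ≤ 4` is in register `22`,
measure it in the Hadamard basis, and count the outcome in register `23`. -/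
def voteProg : Prog :=
  dec 11 7 ;; .ifLe 7 22 (.gate (.phaseT 11)) .skip ;; .ifLe 8 22 (.gate (.phaseT 11)) .skip ;;
  .ifLe 41 22 (.gate (.phaseT 11)) .skip ;; .ifLe 42 22 (.gate (.phaseT 11)) .skip ;;
  .gate (.had 11) ;; .measure 24 11 ;; inc 23 24

/-- Round the phase found so far, `A / (2 * P)`, to `k / 8`. -/
def roundProg : Prog :=
  .arith .add 22 20 20 ;; .arith .add 22 22 22 ;; .arith .add 22 22 22 ;; inc 22 21 ;;
  .arith .add 25 21 21 ;; .arith .div 22 22 25 ;; mov 23 6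

/-- Find one more binary digit of the phase by a majority vote. -/
def digitProg : Prog :=
  roundProg ;; .loop 3 voteProg ;; .arith .add 25 23 23 ;; .ifLe 3 25 (inc 20 21) .skip ;;
  .arith .add 21 21 21

/-- Find the binary digits of the phase, the last one first. -/
def phaseProg : Prog :=
  mov 11 14 ;; .arith .add 9 33 0 ;; mov 20 6 ;; mov 21 7 ;; .loop 2 digitProg

/-- Measure the block at register `33`. -/
def measureBlockProg : Prog :=
  mov 17 33 ;; .loop 0 (.measure 24 17 ;; inc 17 7)

/-- One step of the Euclidean algorithm, with the cofactors in the registers `28` and `29`. -/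
def euclidStepProg : Prog :=
  .ifLe 27 31 .skip
    (.arith .div 30 26 27 ;; .arith .mod 25 26 27 ;; mov 26 27 ;; mov 27 25 ;;
      (clampedMul 30 30 29 21) ;; .arith .add 30 28 30 ;; mov 28 29 ;; mov 29 30)

/-- Find the denominator of a fraction close to `A / P`, and keep the largest one found. -/
def euclidProg : Prog :=
  mov 26 21 ;; mov 27 20 ;; mov 28 6 ;; mov 29 7 ;; .loop 5 euclidStepProg ;;
  .ifLe 29 10 .skip (mov 10 29)

/-- Sample an eigenvalue of the multiplication by `g`, and find its order. -/
def sampleProg : Prog :=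
  hadamardProg ;; exponentiateProg ;; phaseProg ;; measureBlockProg ;; euclidProg

/-- Compute the encoding of the power of `g` whose exponent is in register `36`, and store it as a
number in register `39`. -/
def powerProg : Prog :=
  (.arith .sub 37 36 7 ;; mov 38 6 ;; mov 12 6 ;;
    .loop 2 (.arith .mod 24 37 8 ;; .ifLe 7 24 (.query 38 12 9 ;; mov 38 9 ;; inc 9 0) .skip ;;
      .arith .div 37 37 8 ;; inc 12 0)) ;;
  (mov 17 38 ;; mov 39 6 ;;
    .loop 0 (.measure 24 17 ;; .arith .add 39 39 39 ;; inc 39 24 ;; inc 17 7))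

/-- Find by binary search the largest exponent (or `0`) at which the powers of `g` are not yet
periodic, where register `10` holds the period. -/
def searchProg : Prog :=
  (mov 34 6 ;; mov 35 7 ;; .loop 2 (.arith .add 35 35 35) ;; .arith .div 35 35 8) ;;
  .loop 2 (.arith .div 35 35 8 ;; .arith .add 36 34 35 ;; powerProg ;; mov 40 39 ;;
    inc 36 10 ;; powerProg ;;
    .ifLe 39 40 (.ifLe 40 39 .skip (inc 34 35)) (inc 34 35))

/-- The part of the algorithm between the set-up and the output. -/
def mainProg : Prog := powersProg ;; .loop 4 sampleProg ;; searchProg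

/-- Write the result to the output registers. -/
def outputProg : Prog := .arith .add 0 34 7 ;; mov 1 10

/-- The algorithm. -/
def indexPeriodProg : Prog := setupProg ;; mainProg ;; outputProg

section

variable {n : ℕ} {f : Bits n → Bits n → Bits n}

/-! ### The algorithm runs in polynomial time -/

/-- The number of binary digits of the phase that the algorithm determines. -/
def digits (N : ℕ) : ℕ := 2 * N.size + 3

theorem setupProg_run (s : Config) (s' : Config) (hs' : s' ∈ setupProg.run f s) :
    s'.reg 0 = s.reg 0 ∧ s'.reg 2 = digits (s.reg 1) ∧ s'.reg 3 = 256 * digits (s.reg 1) ∧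
      s'.reg 4 = 4 * digits (s.reg 1) ∧ s'.reg 5 = 2 * digits (s.reg 1) + 1 := by
  simp [setupProg, Prog.run, Config.set, Config.tick, ArithOp.eval] at hs'
  subst hs'
  simp [digits]
  omega

/-- A function that is bounded by a polynomial with natural coefficients. -/
def PolyBounded (F : ℕ → ℕ) : Prop := ∃ p : Polynomial ℕ, ∀ x, F x ≤ p.eval x

namespace PolyBounded

theorem const (c : ℕ) : PolyBounded fun _ => c := ⟨Polynomial.C c, fun x => by simp⟩

theorem id : PolyBounded fun x => x := ⟨Polynomial.X, fun x => by simp⟩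

theorem add {F G : ℕ → ℕ} : PolyBounded F → PolyBounded G → PolyBounded fun x => F x + G x := by
  rintro ⟨p, hp⟩ ⟨q, hq⟩
  exact ⟨p + q, fun x => by simpa using add_le_add (hp x) (hq x)⟩

theorem mul {F G : ℕ → ℕ} : PolyBounded F → PolyBounded G → PolyBounded fun x => F x * G x := by
  rintro ⟨p, hp⟩ ⟨q, hq⟩
  exact ⟨p * q, fun x => by simpa using Nat.mul_le_mul (hp x) (hq x)⟩

theorem steps (c : Prog) {b : ℕ → ℕ} (hb : PolyBounded b) :
    PolyBounded fun x => c.steps fun _ => b x := by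
  induction c with
  | seq c d hc hd => exact ((const 1).add hc).add hd
  | ifLe x y c d hc hd => exact ((const 1).add hc).add hd
  | loop x c hc => exact (const 1).add (hb.mul ((const 1).add hc))
  | _ => exact const _

theorem queryBound (c : Prog) {b : ℕ → ℕ} (hb : PolyBounded b) :
    PolyBounded fun x => c.queryBound (b x) := by
  induction c with
  | seq c d hc hd => exact hc.add hd
  | ifLe x y c d hc hd => exact hc.add hd
  | loop x c hc => exact hb.mul hc
  | _ => exact const _

theorem stepCost {n L : ℕ → ℕ} (hn : PolyBounded n) (hL : PolyBounded L) :
    PolyBounded fun x => stepCost (n x) (L x) :=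
  ((((const 1).add ((const 2).mul hL)).mul ((const 1).add ((const 2).mul hL))).add
    ((const 3).mul hn)).add ((const 3).mul hL)

end PolyBounded

/-- A bound on the loop counters of the algorithm. -/
def loopBound (x : ℕ) : ℕ := 512 * x + 2000

/-- A bound on the bit lengths of the registers of the algorithm. -/
def sizeBound (x : ℕ) : ℕ :=
  x + 1 + setupProg.steps (fun _ => loopBound x) + mainProg.steps (fun _ => loopBound x) +
    outputProg.steps (fun _ => loopBound x)

/-- A bound on the running time of the algorithm. -/
def timeBound (x : ℕ) : ℕ :=
  setupProg.steps (fun _ => loopBound x) * stepCost x (sizeBound x) +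
    mainProg.steps (fun _ => loopBound x) * stepCost x (sizeBound x) +
    outputProg.steps (fun _ => loopBound x) * stepCost x (sizeBound x)

theorem size_le_log_add_one (N : ℕ) : N.size ≤ Nat.log 2 N + 1 :=
  Nat.size_le.2 (Nat.lt_pow_succ_log_self one_lt_two N)

theorem stepCost_mono {n n' L : ℕ} (h : n ≤ n') : stepCost n L ≤ stepCost n' L := by
  simp only [stepCost]; omega

theorem timeBound_polyBounded : PolyBounded timeBound := by
  have hb : PolyBounded loopBound := ((PolyBounded.const _).mul .id).add (.const _)
  have hS : PolyBounded sizeBound :=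
    (((PolyBounded.id.add (.const 1)).add (.steps _ hb)).add (.steps _ hb)).add (.steps _ hb)
  have hc := PolyBounded.stepCost .id hS
  exact (((PolyBounded.steps _ hb).mul hc).add ((PolyBounded.steps _ hb).mul hc)).add
    ((PolyBounded.steps _ hb).mul hc)

theorem indexPeriodProg_bounds (N : ℕ) (w : Bits n) (s : Config)
    (hs : s ∈ indexPeriodProg.run f (initConfig n N w)) :
    s.time ≤ timeBound (n + Nat.log 2 N) ∧
      s.queries ≤ mainProg.queryBound (loopBound (Nat.log 2 N)) := by
  set x := n + Nat.log 2 N with hx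
  have hNs := size_le_log_add_one N
  simp only [indexPeriodProg, Prog.run, List.mem_flatMap] at hs
  obtain ⟨s₁, h₁, s₂, h₂, h₃⟩ := hs
  obtain ⟨k0, k2, k3, k4, k5⟩ := setupProg_run _ _ h₁
  have hdig : digits N ≤ 2 * Nat.log 2 N + 5 := by simp only [digits]; omega
  simp only [initConfig, if_true, one_ne_zero, if_false] at k0 k2 k3 k4 k5
  have hsz : ∀ y, ((initConfig n N w).reg y).size ≤ x + 1 := by
    intro y
    have : n.size ≤ n := Nat.size_le.2 Nat.lt_two_pow_self
    simp only [initConfig]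
    split_ifs
    · omega
    · omega
    · simp
  obtain ⟨-, a2, a3, a4⟩ := Prog.tame_bounds (F := []) (β := fun _ => loopBound x) (b := 0)
    (L := sizeBound x) (by simp) setupProg (by decide) _ (by simp) _ hsz
    (by simp only [sizeBound]; omega) _ h₁
  have hsteps : ∀ c : Prog, ∀ {β β' : ℕ → ℕ}, (∀ y, β y ≤ β' y) → c.steps β ≤ c.steps β' := by
    intro c β β' h
    induction c with
    | seq c d hc hd => simp only [Prog.steps]; omega
    | ifLe x y c d hc hd => simp only [Prog.steps]; omega
    | loop x c hc =>
      simp only [Prog.steps]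
      exact Nat.add_le_add_left (Nat.mul_le_mul (h x) (Nat.add_le_add_left hc 1)) 1
    | _ => simp [Prog.steps]
  let β : ℕ → ℕ := fun y => if y = 0 then n else loopBound (Nat.log 2 N)
  have hβ : ∀ y, β y ≤ loopBound x := by
    intro y
    simp only [β, loopBound]
    split_ifs <;> omega
  have hm := hsteps mainProg hβ
  obtain ⟨-, b2, b3, b4⟩ := Prog.tame_bounds (F := [0, 2, 3, 4, 5]) (β := β)
    (b := loopBound (Nat.log 2 N)) (L := sizeBound x) (by intro y _ hy; simp [β, hy]) mainProg
    (by decide) s₁ (by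
      simp only [List.mem_cons, List.not_mem_nil, or_false, forall_eq_or_imp, forall_eq, β,
        loopBound, k0, k2, k3, k4, k5]
      simp
      omega) _ a2
    (by simp only [sizeBound]; omega) _ h₂
  obtain ⟨-, c2, c3, c4⟩ := Prog.tame_bounds (F := []) (β := fun _ => loopBound x) (b := 0)
    (L := sizeBound x) (by simp) outputProg (by decide) _ (by simp) _ b2
    (by simp only [sizeBound]; omega) _ h₃
  have hq1 : setupProg.queryBound 0 = 0 := by decide
  have hq2 : outputProg.queryBound 0 = 0 := by decide
  have hcost : stepCost n (sizeBound x) ≤ stepCost x (sizeBound x) := stepCost_mono (by omega)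
  have i1 : (initConfig n N w).time = 0 := rfl
  have i2 : (initConfig n N w).queries = 0 := rfl
  constructor
  · have e1 := Nat.mul_le_mul_left (setupProg.steps fun _ => loopBound x) hcost
    have e2 := Nat.mul_le_mul hm hcost
    have e3 := Nat.mul_le_mul_left (outputProg.steps fun _ => loopBound x) hcost
    simp only [timeBound]
    omega
  · omega

theorem queryBound_polyBounded :
    PolyBounded fun x => mainProg.queryBound (loopBound x) :=
  .queryBound _ (((PolyBounded.const _).mul .id).add (.const _))

end

section

/-! ### Powers in a finite semigroup -/

section Semigroup

variable {S : Type*} [Semigroup S] (g : S)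

theorem spow_succ {j : ℕ} (hj : 1 ≤ j) : spow g (j + 1) = spow g j * g := by
  obtain ⟨j, rfl⟩ := Nat.exists_eq_add_of_le' hj
  rfl

theorem spow_add {a b : ℕ} (ha : 1 ≤ a) (hb : 1 ≤ b) :
    spow g (a + b) = spow g a * spow g b := by
  induction b, hb using Nat.le_induction with
  | base => exact spow_succ g ha
  | succ b hb ih => rw [← add_assoc, spow_succ g (by omega), ih, spow_succ g hb, mul_assoc]

theorem spow_congr_add {i j : ℕ} (hi : 1 ≤ i) (hj : 1 ≤ j) (h : spow g i = spow g j) (k : ℕ) :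
    spow g (i + k) = spow g (j + k) := by
  rcases Nat.eq_zero_or_pos k with rfl | hk
  · exact h
  · rw [spow_add g hi hk, spow_add g hj hk, h]

theorem sgIndex_le {j k : ℕ} (hj : 1 ≤ j) (hjk : j < k) (h : spow g j = spow g k) :
    sgIndex g ≤ j := Nat.sInf_le ⟨hj, k, hjk, h⟩

theorem sgPeriod_le {j : ℕ} (hj : 1 ≤ j) (h : spow g (sgIndex g) = spow g (sgIndex g + j)) :
    sgPeriod g ≤ j := Nat.sInf_le ⟨hj, h⟩

variable [Finite S]

theorem sgIndex_mem : 1 ≤ sgIndex g ∧ ∃ k, sgIndex g < k ∧ spow g (sgIndex g) = spow g k := by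
  apply Nat.sInf_mem (s := {j : ℕ | 1 ≤ j ∧ ∃ k : ℕ, j < k ∧ spow g j = spow g k})
  obtain ⟨i, j, hij, h⟩ := Finite.exists_ne_map_eq_of_infinite fun i : ℕ => spow g (i + 1)
  rcases Nat.lt_or_gt_of_ne hij with hlt | hlt
  · exact ⟨i + 1, by omega, j + 1, by omega, h⟩
  · exact ⟨j + 1, by omega, i + 1, by omega, h.symm⟩

theorem sgPeriod_mem :
    1 ≤ sgPeriod g ∧ spow g (sgIndex g) = spow g (sgIndex g + sgPeriod g) := by
  apply Nat.sInf_mem (s := {j : ℕ | 1 ≤ j ∧ spow g (sgIndex g) = spow g (sgIndex g + j)})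
  obtain ⟨-, k, hk, h⟩ := sgIndex_mem g
  exact ⟨k - sgIndex g, by omega, by rw [Nat.add_sub_cancel' hk.le]; exact h⟩

theorem spow_add_period_mul {j : ℕ} (hj : sgIndex g ≤ j) (k : ℕ) :
    spow g (j + sgPeriod g * k) = spow g j := by
  have ht := (sgIndex_mem g).1
  induction k with
  | zero => rfl
  | succ k ih =>
    have := spow_congr_add g ht (by omega) (sgPeriod_mem g).2 (j - sgIndex g + sgPeriod g * k)
    rw [show sgIndex g + (j - sgIndex g + sgPeriod g * k) = j + sgPeriod g * k by omega,
      show sgIndex g + sgPeriod g + (j - sgIndex g + sgPeriod g * k) =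
        j + sgPeriod g * (k + 1) by rw [mul_add]; omega] at this
    rw [← this, ih]

theorem spow_eq_spow_add_period_iff {j : ℕ} (hj : 1 ≤ j) :
    spow g j = spow g (j + sgPeriod g) ↔ sgIndex g ≤ j := by
  have := (sgPeriod_mem g).1
  refine ⟨fun h => sgIndex_le g hj (by omega) h, fun h => ?_⟩
  simpa using (spow_add_period_mul g h 1).symm

/-- On the cycle, powers coincide only if the exponents differ by a multiple of the period. -/
theorem period_dvd_of_spow_eq {i d : ℕ} (hi : sgIndex g ≤ i) (h : spow g i = spow g (i + d)) :
    sgPeriod g ∣ d := by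
  have ht := (sgIndex_mem g).1
  have hr := (sgPeriod_mem g).1
  -- Shift both exponents so that the smaller one becomes congruent to the index.
  have hle : i ≤ sgPeriod g * i := Nat.le_mul_of_pos_left _ hr
  have h1 := spow_congr_add g (by omega) (by omega) h (sgIndex g + sgPeriod g * i - i)
  rw [show i + (sgIndex g + sgPeriod g * i - i) = sgIndex g + sgPeriod g * i by omega,
    show i + d + (sgIndex g + sgPeriod g * i - i) = sgIndex g + d + sgPeriod g * i by omega,
    spow_add_period_mul g le_rfl, spow_add_period_mul g (by omega),
    ← Nat.mod_add_div d (sgPeriod g), ← add_assoc, spow_add_period_mul g (by omega)] at h1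
  by_contra hd
  have hpos : 0 < d % sgPeriod g := Nat.pos_of_ne_zero fun h0 => hd (Nat.dvd_of_mod_eq_zero h0)
  have := sgPeriod_le g hpos h1
  have := Nat.mod_lt d hr
  omega

/-- Beyond the index, the powers repeat with the period. -/
theorem spow_index_add (g : S) {T : ℕ} (hT : sgIndex g ≤ T) (e : ℕ) :
    spow g (T + e % sgPeriod g) = spow g (T + e) := by
  conv_rhs => rw [← Nat.mod_add_div e (sgPeriod g), ← add_assoc]
  exact (spow_add_period_mul g (by omega) _).symm

theorem spow_index_injOn (g : S) {T : ℕ} (hT : sgIndex g ≤ T) {a b : ℕ} (ha : a < sgPeriod g)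
    (hb : b < sgPeriod g) (h : spow g (T + a) = spow g (T + b)) : a = b := by
  wlog hab : a ≤ b generalizing a b
  · exact (this hb ha h.symm (by omega)).symm
  have := period_dvd_of_spow_eq g (i := T + a) (d := b - a) (by omega)
    (by rw [h]; congr 1; omega)
  have := Nat.eq_zero_of_dvd_of_lt this (by omega)
  omega

end Semigroup

/-! ### A lower bound for the totient function -/

/-- The product is smallest for the first integers from `2` on, and then it telescopes. -/
theorem Finset.one_le_card_succ_mul_prod_one_sub_inv (s : Finset ℕ) (hs : ∀ p ∈ s, 2 ≤ p) :
    (1 : ℝ) ≤ (s.card + 1) * ∏ p ∈ s, (1 - (p : ℝ)⁻¹) := by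
  induction s using Finset.induction_on_max with
  | empty => simp
  | insert a s hmax ih =>
    have has : a ∉ s := fun h => lt_irrefl _ (hmax a h)
    rw [Finset.prod_insert has, Finset.card_insert_of_notMem has]
    have hcard : s.card + 2 ≤ a := by
      have : s ⊆ Finset.Ico 2 a := fun x hx =>
        Finset.mem_Ico.2 ⟨hs x (Finset.mem_insert_of_mem hx), hmax x hx⟩
      have h1 := Finset.card_le_card this
      have h2 := hs a (Finset.mem_insert_self _ _)
      rw [Nat.card_Ico] at h1
      omega
    have hcard' : (s.card : ℝ) + 2 ≤ a := by exact_mod_cast hcard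
    have ih := ih fun p hp => hs p (Finset.mem_insert_of_mem hp)
    set X := ∏ p ∈ s, (1 - (p : ℝ)⁻¹)
    have hc : (0 : ℝ) ≤ s.card := Nat.cast_nonneg _
    have hX : 0 ≤ X := by
      by_contra h
      nlinarith
    have hinv : (s.card + 1 : ℝ) ≤ (s.card + 1 + 1) * (1 - (a : ℝ)⁻¹) := by
      have : (a : ℝ)⁻¹ ≤ (s.card + 2 : ℝ)⁻¹ := by gcongr
      have h3 : (s.card + 2 : ℝ) * (s.card + 2 : ℝ)⁻¹ = 1 := mul_inv_cancel₀ (by positivity)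
      nlinarith
    push_cast
    nlinarith [mul_le_mul_of_nonneg_right hinv hX]

/-- A random `s < r` is coprime to `r` with probability at least `1 / (log₂ r + 1)`, since `r` has
at most `log₂ r` prime factors. -/
theorem le_totient_mul_log_add_one {r : ℕ} (hr : 1 ≤ r) :
    (r : ℝ) ≤ r.totient * (Nat.log 2 r + 1) := by
  have h1 := Finset.one_le_card_succ_mul_prod_one_sub_inv r.primeFactors
    fun p hp => (Nat.prime_of_mem_primeFactors hp).two_le
  have h2 : (r.totient : ℝ) = r * ∏ p ∈ r.primeFactors, (1 - (p : ℝ)⁻¹) := by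
    have := congrArg (fun x : ℚ => (x : ℝ)) (Nat.totient_eq_mul_prod_factors r)
    push_cast at this
    exact this
  have h3 : r.primeFactors.card ≤ Nat.log 2 r := by
    apply Nat.le_log_of_pow_le one_lt_two
    calc 2 ^ r.primeFactors.card ≤ ∏ p ∈ r.primeFactors, p :=
          Finset.pow_card_le_prod _ _ _ fun p hp => (Nat.prime_of_mem_primeFactors hp).two_le
      _ ≤ r := Nat.le_of_dvd hr (Nat.prod_primeFactors_dvd r)
  have h3' : (r.primeFactors.card : ℝ) ≤ Nat.log 2 r := by exact_mod_cast h3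
  have h4 : (0 : ℝ) ≤ r.totient := Nat.cast_nonneg _
  calc (r : ℝ) = r * 1 := (mul_one _).symm
    _ ≤ r * ((r.primeFactors.card + 1) * ∏ p ∈ r.primeFactors, (1 - (p : ℝ)⁻¹)) := by gcongr
    _ = r.totient * (r.primeFactors.card + 1) := by rw [h2]; ring
    _ ≤ _ := by gcongr

/-! ### Majority votes -/

/-- The expected value of `v` at the final count, when `c` more votes are cast, each of which is
`0` with probability `p` and raises the count by one otherwise. -/
def voteVal (p : ℝ) (v : ℕ → ℝ) : ℕ → ℕ → ℝ
  | 0, k => v k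
  | c + 1, k => p * voteVal p v c k + (1 - p) * voteVal p v c (k + 1)

theorem voteVal_ge {p m : ℝ} {v : ℕ → ℝ} (hp0 : 0 ≤ p) (hp1 : p ≤ 1) (hv : ∀ k, m ≤ v k)
    (c k : ℕ) : m ≤ voteVal p v c k := by
  induction c generalizing k with
  | zero => exact hv k
  | succ c ih =>
    simp only [voteVal]
    nlinarith [ih k, ih (k + 1)]

/-- A Chernoff bound, for the supermartingale `(6/5) ^ wrong * (5/6) ^ right * (71/72) ^ rest`. -/
theorem voteVal_ge_of_zero {p m : ℝ} {v : ℕ → ℝ} {K : ℕ} (hp : 7 / 12 ≤ p) (hp1 : p ≤ 1)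
    (hm : 0 ≤ m) (hv0 : ∀ k, 0 ≤ v k) (hv : ∀ k, 2 * k < K → m ≤ v k) :
    m * (1 - (71 / 72) ^ K) ≤ voteVal p v K 0 := by
  suffices H : ∀ c k a, k + a + c = K →
      m * (1 - (6 / 5) ^ k * (5 / 6) ^ a * (71 / 72) ^ c) ≤ voteVal p v c k by
    simpa using H K 0 0 (by simp)
  intro c
  induction c with
  | zero =>
    intro k a h
    simp only [voteVal, pow_zero, mul_one]
    by_cases hk : 2 * k < K
    · have : (0 : ℝ) ≤ (6 / 5) ^ k * (5 / 6) ^ a := by positivity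
      nlinarith [hv k hk]
    · obtain ⟨b, rfl⟩ : ∃ b, k = a + b := Nat.exists_eq_add_of_le (by omega)
      have h1 : (6 / 5 : ℝ) ^ (a + b) * (5 / 6) ^ a = (6 / 5) ^ b := by
        rw [pow_add, mul_right_comm, ← mul_pow]; norm_num
      have h2 : (1 : ℝ) ≤ (6 / 5) ^ b := one_le_pow₀ (by norm_num)
      rw [h1]
      nlinarith [hv0 (a + b)]
  | succ c ih =>
    intro k a h
    have i1 := ih k (a + 1) (by omega)
    have i2 := ih (k + 1) a (by omega)
    simp only [voteVal]
    have hF : (0 : ℝ) ≤ (6 / 5) ^ k * (5 / 6) ^ a * (71 / 72) ^ c := by positivity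
    set F : ℝ := (6 / 5) ^ k * (5 / 6) ^ a * (71 / 72) ^ c with hFdef
    have e1 : (6 / 5 : ℝ) ^ k * (5 / 6) ^ (a + 1) * (71 / 72) ^ c = 5 / 6 * F := by
      rw [hFdef]; ring
    have e2 : (6 / 5 : ℝ) ^ (k + 1) * (5 / 6) ^ a * (71 / 72) ^ c = 6 / 5 * F := by
      rw [hFdef]; ring
    have e3 : (6 / 5 : ℝ) ^ k * (5 / 6) ^ a * (71 / 72) ^ (c + 1) = 71 / 72 * F := by
      rw [hFdef]; ring
    rw [e1] at i1
    rw [e2] at i2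
    rw [e3]
    have hmF : 0 ≤ m * F := mul_nonneg hm hF
    nlinarith [mul_le_mul_of_nonneg_left i1 (show 0 ≤ p by linarith),
      mul_le_mul_of_nonneg_left i2 (show 0 ≤ 1 - p by linarith),
      mul_le_mul_of_nonneg_left hp hmF]

/-- The Chernoff bound for the opposite outcome. -/
theorem voteVal_ge_of_one {p m : ℝ} {v : ℕ → ℝ} {K : ℕ} (hp : p ≤ 5 / 12) (hp0 : 0 ≤ p)
    (hm : 0 ≤ m) (hv0 : ∀ k, 0 ≤ v k) (hv : ∀ k, K ≤ 2 * k → m ≤ v k) :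
    m * (1 - (71 / 72) ^ K) ≤ voteVal p v K 0 := by
  suffices H : ∀ c k a, k + a + c = K →
      m * (1 - (6 / 5) ^ a * (5 / 6) ^ k * (71 / 72) ^ c) ≤ voteVal p v c k by
    simpa using H K 0 0 (by simp)
  intro c
  induction c with
  | zero =>
    intro k a h
    simp only [voteVal, pow_zero, mul_one]
    by_cases hk : K ≤ 2 * k
    · have : (0 : ℝ) ≤ (6 / 5) ^ a * (5 / 6) ^ k := by positivity
      nlinarith [hv k hk]
    · obtain ⟨b, rfl⟩ : ∃ b, a = k + b := Nat.exists_eq_add_of_le (by omega)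
      have h1 : (6 / 5 : ℝ) ^ (k + b) * (5 / 6) ^ k = (6 / 5) ^ b := by
        rw [pow_add, mul_right_comm, ← mul_pow]; norm_num
      have h2 : (1 : ℝ) ≤ (6 / 5) ^ b := one_le_pow₀ (by norm_num)
      rw [h1]
      nlinarith [hv0 k]
  | succ c ih =>
    intro k a h
    have i1 := ih k (a + 1) (by omega)
    have i2 := ih (k + 1) a (by omega)
    simp only [voteVal]
    have hF : (0 : ℝ) ≤ (6 / 5) ^ a * (5 / 6) ^ k * (71 / 72) ^ c := by positivity
    set F : ℝ := (6 / 5) ^ a * (5 / 6) ^ k * (71 / 72) ^ c with hFdef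
    have e1 : (6 / 5 : ℝ) ^ (a + 1) * (5 / 6) ^ k * (71 / 72) ^ c = 6 / 5 * F := by
      rw [hFdef]; ring
    have e2 : (6 / 5 : ℝ) ^ a * (5 / 6) ^ (k + 1) * (71 / 72) ^ c = 5 / 6 * F := by
      rw [hFdef]; ring
    have e3 : (6 / 5 : ℝ) ^ a * (5 / 6) ^ k * (71 / 72) ^ (c + 1) = 71 / 72 * F := by
      rw [hFdef]; ring
    rw [e1] at i1
    rw [e2] at i2
    rw [e3]
    have hmF : 0 ≤ m * F := mul_nonneg hm hF
    nlinarith [mul_le_mul_of_nonneg_left i1 hp0,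
      mul_le_mul_of_nonneg_left i2 (show 0 ≤ 1 - p by linarith),
      mul_le_mul_of_nonneg_left hp hmF]

/-! ### Digits of a phase -/

/-- The probability that a control qubit with the phase `2 ^ g * θ`, turned back by the estimate
`A / (2 * P)` rounded to a multiple of `1 / 8`, is measured as `0`. -/
noncomputable def voteProb (θ : ℝ) (g A P : ℕ) : ℝ :=
  (1 + Real.cos (2 * Real.pi * (2 ^ g * θ - ((8 * A + P) / (2 * P) : ℕ) / 8))) / 2

/-- The expected value of `V` at the final estimate, when `g` digits of the phase `θ` remain to be
found, each by a majority of `K` votes, and the digits found so far are those of `A / P`. -/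
noncomputable def digitVal (K : ℕ) (θ : ℝ) (V : ℕ → ℝ) : ℕ → ℕ → ℕ → ℝ
  | 0, A, _ => V A
  | g + 1, A, P => voteVal (voteProb θ g A P)
      (fun k => digitVal K θ V g (if K ≤ 2 * k then A + P else A) (P + P)) K 0

theorem voteProb_nonneg (θ : ℝ) (g A P : ℕ) : 0 ≤ voteProb θ g A P := by
  have := Real.neg_one_le_cos (2 * Real.pi * (2 ^ g * θ - ((8 * A + P) / (2 * P) : ℕ) / 8))
  simp only [voteProb]; linarith

theorem voteProb_le_one (θ : ℝ) (g A P : ℕ) : voteProb θ g A P ≤ 1 := by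
  have := Real.cos_le_one (2 * Real.pi * (2 ^ g * θ - ((8 * A + P) / (2 * P) : ℕ) / 8))
  simp only [voteProb]; linarith

theorem digitVal_nonneg {K : ℕ} {θ : ℝ} {V : ℕ → ℝ} (hV : ∀ A, 0 ≤ V A) (g A P : ℕ) :
    0 ≤ digitVal K θ V g A P := by
  induction g generalizing A P with
  | zero => exact hV A
  | succ g ih => exact voteVal_ge (voteProb_nonneg ..) (voteProb_le_one ..) (fun k => ih _ _) _ _

/-- The bound on the phase error that makes a vote right with probability at least `7 / 12`. -/
theorem one_sixth_le_cos {η : ℝ} (h : |η| ≤ 5 / 24) : 1 / 6 ≤ Real.cos (2 * Real.pi * η) := by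
  rw [← Real.cos_abs, abs_mul, abs_of_pos Real.two_pi_pos]
  have hpi := Real.pi_pos
  have h0 := abs_nonneg η
  have := Real.one_sub_mul_le_cos (x := 2 * Real.pi * |η|) (by positivity) (by nlinarith)
  have e : 2 / Real.pi * (2 * Real.pi * |η|) = 4 * |η| := by field_simp; ring
  rw [e] at this
  linarith

theorem abs_rounding_le {A P : ℕ} (hP : 0 < P) :
    |(A : ℝ) / (2 * P) - ((8 * A + P) / (2 * P) : ℕ) / 8| ≤ 1 / 16 := by
  have hP' : (0 : ℝ) < P := by exact_mod_cast hP
  set k := (8 * A + P) / (2 * P) with hk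
  have h1 : 2 * P * k ≤ 8 * A + P := Nat.mul_div_le _ _
  have h2 : 8 * A + P < 2 * P * (k + 1) := Nat.lt_mul_div_succ _ (by omega)
  have h1' : 2 * (P : ℝ) * k ≤ 8 * A + P := by exact_mod_cast h1
  have h2' : 8 * (A : ℝ) + P ≤ 2 * P * (k + 1) := by exact_mod_cast h2.le
  have e : (A : ℝ) / (2 * P) - k / 8 = (4 * A - P * k) / (8 * P) := by field_simp; ring
  rw [e, abs_div, abs_of_pos (show (0 : ℝ) < 8 * P by positivity), div_le_iff₀ (by positivity),
    abs_le]
  constructor <;> nlinarith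

/-- If the estimate `A / 2 ^ i` of the phase `2 ^ g * θ` is good, then, with high probability, so is
the final estimate of `θ`. An error of `7 / 12` units is halved by the next digit, and with the
rounding error `1 / 16` of the rotation it stays below `5 / 24` from the second digit on. -/
theorem digitVal_ge {K : ℕ} {θ m : ℝ} {V : ℕ → ℝ} (hV : ∀ A, 0 ≤ V A) (hm : 0 ≤ m)
    {J : ℕ} (hVm : ∀ A : ℕ, A < 2 ^ J → ∀ z : ℤ, |θ - A / 2 ^ J - z| ≤ 7 / 12 / 2 ^ J → m ≤ V A)
    (g i A : ℕ) (hgi : g + i = J) (hA : A < 2 ^ i) (z : ℤ)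
    (hz : |2 ^ g * θ - A / 2 ^ i - z| ≤ 7 / 12 / 2 ^ i) :
    m * (1 - (71 / 72) ^ K) ^ g ≤ digitVal K θ V g A (2 ^ i) := by
  induction g generalizing i A z with
  | zero =>
    obtain rfl : i = J := by omega
    simpa [digitVal] using hVm A hA z (by simpa using hz)
  | succ g ih =>
    have hε : (0 : ℝ) ≤ 1 - (71 / 72) ^ K := sub_nonneg.2 (pow_le_one₀ (by norm_num) (by norm_num))
    have hm' : 0 ≤ m * (1 - (71 / 72) ^ K) ^ g := by positivity
    have hP : (0 : ℝ) < 2 ^ i := by positivity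
    -- A good new digit gives a good new estimate.
    have next : ∀ (b : ℕ) (z' : ℤ), b ≤ 1 →
        |2 ^ g * θ - (A + b * 2 ^ i) / (2 * 2 ^ i) - z'| ≤ 7 / 24 / 2 ^ i →
        m * (1 - (71 / 72) ^ K) ^ g ≤ digitVal K θ V g (A + b * 2 ^ i) (2 ^ i + 2 ^ i) := by
      intro b z' hb h
      have := ih (i + 1) (A + b * 2 ^ i) (by omega) (by rw [pow_succ]; nlinarith) z' (by
        push_cast
        rw [pow_succ]
        calc _ = |2 ^ g * θ - (A + b * 2 ^ i) / (2 * 2 ^ i) - z'| := by rw [mul_comm (2 ^ i) 2]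
          _ ≤ _ := h
          _ = _ := by field_simp; norm_num)
      rwa [pow_succ, mul_two] at this
    have next0 := next 0
    have next1 := next 1
    simp only [Nat.cast_zero, Nat.cast_one, zero_mul, one_mul, add_zero, zero_le, le_refl,
      forall_true_left] at next0 next1
    have hv0 := fun k => digitVal_nonneg (K := K) (θ := θ) hV g
      (if K ≤ 2 * k then A + 2 ^ i else A) (2 ^ i + 2 ^ i)
    simp only [digitVal]
    rw [pow_succ, ← mul_assoc]
    -- At the first digit, `z` can be chosen as a nearest integer, with an error of at most `1 / 2`.
    obtain ⟨z, hz, hz'⟩ : ∃ z : ℤ, |2 ^ (g + 1) * θ - A / 2 ^ i - z| ≤ 7 / 12 / 2 ^ i ∧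
        (i = 0 → |2 ^ (g + 1) * θ - A / 2 ^ i - z| ≤ 1 / 2) := by
      rcases Nat.eq_zero_or_pos i with rfl | hi
      · have := abs_sub_round (2 ^ (g + 1) * θ - A / 2 ^ 0)
        refine ⟨round (2 ^ (g + 1) * θ - A / 2 ^ 0), this.trans (by norm_num), fun _ => this⟩
      · exact ⟨z, hz, fun h => by omega⟩
    set δ : ℝ := 2 ^ g * θ - A / (2 * 2 ^ i) - z / 2 with hδdef
    have hδ2 : 2 ^ (g + 1) * θ - A / 2 ^ i - z = 2 * δ := by
      rw [hδdef, pow_succ]; field_simp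
    rw [hδ2, abs_mul, abs_two] at hz hz'
    have hδ : |δ| ≤ 7 / 24 / 2 ^ i := by
      have : (7 / 12 / 2 ^ i : ℝ) = 2 * (7 / 24 / 2 ^ i) := by ring
      linarith
    set k : ℕ := (8 * A + 2 ^ i) / (2 * 2 ^ i) with hkdef
    have hround : |(A : ℝ) / (2 * 2 ^ i) - k / 8| ≤ 1 / 16 := by
      have := abs_rounding_le (A := A) (P := 2 ^ i) (by positivity)
      push_cast at this
      exact this
    set η : ℝ := δ + (A / (2 * 2 ^ i) - k / 8) with hηdef
    have hx : 2 ^ g * θ - k / 8 = z / 2 + η := by rw [hηdef, hδdef]; ring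
    have hprob : voteProb θ g A (2 ^ i) = (1 + Real.cos (2 * Real.pi * (z / 2 + η))) / 2 := by
      rw [voteProb, ← hkdef, hx]
    have parity := Int.even_or_odd' z
    obtain ⟨z', hzz⟩ := parity
    have hgood : |η| ≤ 5 / 24 ∨ (i = 0 ∧ 5 / 24 ≤ |δ| ∧ |δ| ≤ 1 / 4) := by
      rcases Nat.eq_zero_or_pos i with rfl | hi
      · obtain rfl : A = 0 := by simpa using hA
        have hk0 : k = 0 := by simp [hkdef]
        have hη : η = δ := by rw [hηdef, hk0]; simp
        have h4 := hz' rfl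
        rw [hη]
        rcases le_total |δ| (5 / 24) with h | h
        · exact .inl h
        · exact .inr ⟨rfl, h, by linarith⟩
      · left
        have h2 : (2 : ℝ) ≤ 2 ^ i := by
          calc (2 : ℝ) = 2 ^ 1 := by norm_num
            _ ≤ 2 ^ i := pow_le_pow_right₀ (by norm_num) hi
        have h3 : (7 / 24 / 2 ^ i : ℝ) ≤ 7 / 24 / 2 := by gcongr
        calc |η| ≤ |δ| + |(A : ℝ) / (2 * 2 ^ i) - k / 8| := abs_add_le _ _
          _ ≤ 5 / 24 := by linarith
    rcases hgood with hη | ⟨rfl, hlo, hhi⟩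
    · have hcos := one_sixth_le_cos hη
      rcases hzz with rfl | rfl
      · apply voteVal_ge_of_zero _ (voteProb_le_one ..) hm' hv0
        · intro j hj
          rw [if_neg (by omega)]
          refine next0 z' (le_of_eq_of_le ?_ hδ)
          rw [hδdef]; push_cast; ring_nf
        · rw [hprob]
          have : 2 * Real.pi * (((2 * z' : ℤ) : ℝ) / 2 + η) =
              2 * Real.pi * η + z' * (2 * Real.pi) := by
            push_cast; ring
          rw [this, Real.cos_add_int_mul_two_pi]
          linarith
      · apply voteVal_ge_of_one _ (voteProb_nonneg ..) hm' hv0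
        · intro j hj
          rw [if_pos hj]
          refine next1 z' (le_of_eq_of_le ?_ hδ)
          rw [hδdef]; push_cast; congr 1; field_simp; ring
        · rw [hprob]
          have : 2 * Real.pi * (((2 * z' + 1 : ℤ) : ℝ) / 2 + η) =
              2 * Real.pi * η + Real.pi + z' * (2 * Real.pi) := by
            push_cast; ring
          rw [this, Real.cos_add_int_mul_two_pi, Real.cos_add_pi]
          linarith
    -- The first digit may take either value if the phase is far from `0` and from `1 / 2`.
    · have hall : ∀ j, m * (1 - (71 / 72) ^ K) ^ g ≤
          digitVal K θ V g (if K ≤ 2 * j then A + 2 ^ 0 else A) (2 ^ 0 + 2 ^ 0) := by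
        obtain rfl : A = 0 := by simpa using hA
        have near : ∀ a : ℝ, a = 0 ∨ a = 1 / 2 → ∃ w : ℤ, |a - w + δ| ≤ 7 / 24 := by
          rintro a (rfl | rfl)
          · exact ⟨0, by simpa using hhi.trans (by norm_num)⟩
          · rcases le_total 0 δ with h0 | h0
            · rw [abs_of_nonneg h0] at hlo hhi
              exact ⟨1, by rw [abs_le]; constructor <;> push_cast <;> linarith⟩
            · rw [abs_of_nonpos h0] at hlo hhi
              exact ⟨0, by rw [abs_le]; constructor <;> push_cast <;> linarith⟩
        have e : 2 ^ g * θ = δ + z / 2 := by rw [hδdef]; simp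
        have k0 : m * (1 - (71 / 72) ^ K) ^ g ≤ digitVal K θ V g 0 (2 ^ 0 + 2 ^ 0) := by
          obtain ⟨w, hw⟩ : ∃ w : ℤ, (z : ℝ) / 2 - w = 0 ∨ (z : ℝ) / 2 - w = 1 / 2 := by
            rcases hzz with rfl | rfl
            · exact ⟨z', .inl (by push_cast; ring)⟩
            · exact ⟨z', .inr (by push_cast; ring)⟩
          obtain ⟨w', hw'⟩ := near _ hw
          refine next0 (w + w') ?_
          have h1 : 2 ^ g * θ - ((0 : ℕ) : ℝ) / (2 * 2 ^ 0) - ((w + w' : ℤ) : ℝ) =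
              z / 2 - w - w' + δ := by rw [e]; push_cast; ring
          rw [h1]
          simpa using hw'
        have k1 : m * (1 - (71 / 72) ^ K) ^ g ≤ digitVal K θ V g (0 + 2 ^ 0) (2 ^ 0 + 2 ^ 0) := by
          obtain ⟨w, hw⟩ : ∃ w : ℤ, (z : ℝ) / 2 - (w + 1 / 2) = 0 ∨
              (z : ℝ) / 2 - (w + 1 / 2) = 1 / 2 := by
            rcases hzz with rfl | rfl
            · exact ⟨z' - 1, .inr (by push_cast; ring)⟩
            · exact ⟨z', .inl (by push_cast; ring)⟩
          obtain ⟨w', hw'⟩ := near _ hw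
          refine next1 (w + w') ?_
          have h1 : 2 ^ g * θ - (((0 : ℕ) : ℝ) + 2 ^ 0) / (2 * 2 ^ 0) - ((w + w' : ℤ) : ℝ) =
              z / 2 - (w + 1 / 2) - w' + δ := by rw [e]; push_cast; ring
          rw [h1]
          simpa using hw'
        intro j
        split_ifs
        · exact k1
        · exact k0
      refine le_trans ?_ (voteVal_ge (voteProb_nonneg ..) (voteProb_le_one ..) hall _ _)
      exact mul_le_of_le_one_right hm' (by simp only [sub_le_self_iff]; positivity)

end

section

variable {n : ℕ} {f : Bits n → Bits n → Bits n}

/-! ### Operators on the quantum memory -/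

namespace QState

theorem apply_single (F : Finset ℕ → QState) (s : Finset ℕ) (α : ℂ) :
    QState.apply F (Finsupp.single s α) = α • F s := by
  simp [QState.apply]

theorem apply_add (F : Finset ℕ → QState) (φ ψ : QState) :
    QState.apply F (φ + ψ) = QState.apply F φ + QState.apply F ψ :=
  map_add (Finsupp.linearCombination ℂ F) φ ψ

theorem apply_sum {ι : Type*} (F : Finset ℕ → QState) (t : Finset ι) (φ : ι → QState) :
    QState.apply F (∑ i ∈ t, φ i) = ∑ i ∈ t, QState.apply F (φ i) :=
  map_sum (Finsupp.linearCombination ℂ F) φ t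

theorem apply_basis (τ : Finset ℕ → Finset ℕ) (ψ : QState) :
    QState.apply (fun s => Finsupp.single (τ s) 1) ψ = Finsupp.mapDomain τ ψ := by
  simp [QState.apply, Finsupp.linearCombination_apply, Finsupp.mapDomain]

theorem project_add (i : ℕ) (b : Bool) (φ ψ : QState) :
    QState.project i b (φ + ψ) = QState.project i b φ + QState.project i b ψ :=
  Finsupp.filter_add

theorem project_sum {ι : Type*} (i : ℕ) (b : Bool) (t : Finset ι) (φ : ι → QState) :
    QState.project i b (∑ j ∈ t, φ j) = ∑ j ∈ t, QState.project i b (φ j) :=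
  map_sum (Finsupp.filterAddHom fun s : Finset ℕ => decide (i ∈ s) = b) φ t

theorem project_single (i : ℕ) (b : Bool) (s : Finset ℕ) (α : ℂ) :
    QState.project i b (Finsupp.single s α) =
      if decide (i ∈ s) = b then Finsupp.single s α else 0 := by
  split_ifs with h
  · exact Finsupp.filter_single_of_pos _ h
  · exact Finsupp.filter_single_of_neg _ h

theorem weight_single (s : Finset ℕ) (α : ℂ) : QState.weight (Finsupp.single s α) = ‖α‖ ^ 2 := by
  simp [QState.weight]

theorem weight_nonneg (ψ : QState) : 0 ≤ ψ.weight :=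
  Finset.sum_nonneg fun _ _ => by positivity

theorem weight_project_add (i : ℕ) (ψ : QState) :
    (ψ.project i false).weight + (ψ.project i true).weight = ψ.weight := by
  have e : ∀ b, (ψ.project i b).weight =
      ∑ s ∈ ψ.support, if decide (i ∈ s) = b then ‖ψ s‖ ^ 2 else 0 := by
    intro b
    rw [QState.weight, QState.project, Finsupp.sum, Finsupp.support_filter, Finset.sum_filter]
    refine Finset.sum_congr rfl fun s _ => ?_
    split_ifs with h
    · rw [Finsupp.filter_apply_pos (fun s : Finset ℕ => decide (i ∈ s) = b) _ h]
    · rfl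
  rw [e, e, ← Finset.sum_add_distrib, QState.weight, Finsupp.sum]
  refine Finset.sum_congr rfl fun s _ => ?_
  by_cases h : i ∈ s <;> simp [h]

end QState

/-- The action of CNOT on basis states. -/
def cnotMap (a t : ℕ) (s : Finset ℕ) : Finset ℕ := if a ∈ s ∧ t ≠ a then symmDiff s {t} else s

/-- The action of the Toffoli gate on basis states. -/
def toffoliMap (a b t : ℕ) (s : Finset ℕ) : Finset ℕ :=
  if a ∈ s ∧ b ∈ s ∧ t ≠ a ∧ t ≠ b then symmDiff s {t} else s

theorem apply_cnot (ρ : ℕ → ℕ) (i t : ℕ) (ψ : QState) :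
    ψ.apply ((Gate.cnot i t).onBasis ρ) = Finsupp.mapDomain (cnotMap (ρ i) (ρ t)) ψ :=
  QState.apply_basis _ _

theorem apply_toffoli (ρ : ℕ → ℕ) (i j t : ℕ) (ψ : QState) :
    ψ.apply ((Gate.toffoli i j t).onBasis ρ) =
      Finsupp.mapDomain (toffoliMap (ρ i) (ρ j) (ρ t)) ψ :=
  QState.apply_basis _ _

/-! ### Blocks of qubits -/

theorem mem_xorBits {c : ℕ} {w : Bits n} {s : Finset ℕ} {q : ℕ} :
    q ∈ xorBits c w s ↔ ¬ (q ∈ s ↔ ∃ i : Fin n, w i = true ∧ c + i = q) := by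
  simp only [xorBits, Finset.mem_symmDiff, Finset.mem_image, Finset.mem_filter,
    Finset.mem_univ, true_and]
  grind

theorem mem_xorBits_of_outside {c : ℕ} {w : Bits n} {s : Finset ℕ} {q : ℕ}
    (h : q < c ∨ c + n ≤ q) : q ∈ xorBits c w s ↔ q ∈ s := by
  have : ¬ ∃ i : Fin n, w i = true ∧ c + i = q := by
    rintro ⟨i, -, rfl⟩
    have := i.2
    omega
  rw [mem_xorBits]; simp [this]

theorem mem_xorBits_of_inside {c : ℕ} {w : Bits n} {s : Finset ℕ} (i : Fin n) :
    c + i ∈ xorBits c w s ↔ ¬ (c + i ∈ s ↔ w i = true) := by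
  have : (∃ j : Fin n, w j = true ∧ c + j = c + i) ↔ w i = true := by
    constructor
    · rintro ⟨j, hj, e⟩
      rwa [← Fin.ext (by omega : (j : ℕ) = i)]
    · exact fun h => ⟨i, h, rfl⟩
  rw [mem_xorBits, this]

theorem readBits_congr {a : ℕ} {s s' : Finset ℕ} (h : ∀ q, a ≤ q → q < a + n → (q ∈ s ↔ q ∈ s')) :
    readBits n a s = readBits n a s' := by
  funext i
  simp only [readBits]
  exact decide_eq_decide.2 (h _ (by omega) (by omega))

theorem readBits_xorBits_of_disjoint {a c : ℕ} {w : Bits n} {s : Finset ℕ}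
    (h : a + n ≤ c ∨ c + n ≤ a) : readBits n a (xorBits c w s) = readBits n a s :=
  readBits_congr fun _ _ _ => mem_xorBits_of_outside (by omega)

theorem readBits_xorBits_self {c : ℕ} {w : Bits n} {s : Finset ℕ}
    (h : ∀ q, c ≤ q → q < c + n → q ∉ s) : readBits n c (xorBits c w s) = w := by
  funext i
  have := h (c + i) (by omega) (by omega)
  simp [readBits, mem_xorBits_of_inside, this]

theorem xorBits_xorBits_self {c : ℕ} {w : Bits n} {s : Finset ℕ} :
    xorBits c w (xorBits c w s) = s := by
  simp [xorBits]

theorem xorBits_comm {n' c c' : ℕ} {w : Bits n} {w' : Bits n'} {s : Finset ℕ} :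
    xorBits c w (xorBits c' w' s) = xorBits c' w' (xorBits c w s) := by
  simp only [xorBits]
  rw [symmDiff_right_comm]

/-- The action of a query to `f` on basis states. -/
def queryMap (f : Bits n → Bits n → Bits n) (a b c : ℕ) (s : Finset ℕ) : Finset ℕ :=
  xorBits c (f (readBits n a s) (readBits n b s)) s

/-- Add to the block at `v` the block at `z'` if qubit `x` is `1`, and the block at `z`
otherwise. -/
def selMap (n x z z' v : ℕ) (s : Finset ℕ) : Finset ℕ :=
  xorBits v (if x ∈ s then readBits n z' s else readBits n z s) s

theorem Det.query_mapDomain {x y z : ℕ} {ρ : ℕ → ℕ} {ψ : QState}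
    {Q : (ℕ → ℕ) → QState → Prop} (hx : ρ x + n ≤ ρ z ∨ ρ z + n ≤ ρ x)
    (hy : ρ y + n ≤ ρ z ∨ ρ z + n ≤ ρ y)
    (h : Q ρ (Finsupp.mapDomain (queryMap f (ρ x) (ρ y) (ρ z)) ψ)) :
    Det f (.query x y z) ρ ψ Q := by
  refine Det.query ?_
  have : oracleOnBasis f (ρ x) (ρ y) (ρ z) =
      fun s => Finsupp.single (queryMap f (ρ x) (ρ y) (ρ z) s) 1 := by
    funext s
    rw [oracleOnBasis, if_pos ⟨hx, hy⟩]
    rfl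
  rwa [this, QState.apply_basis]

theorem queryMap_involutive {a b c : ℕ} (ha : a + n ≤ c ∨ c + n ≤ a)
    (hb : b + n ≤ c ∨ c + n ≤ b) (s : Finset ℕ) :
    queryMap f a b c (queryMap f a b c s) = s := by
  simp only [queryMap]
  rw [readBits_xorBits_of_disjoint ha, readBits_xorBits_of_disjoint hb, xorBits_xorBits_self]

theorem queryMap_xorBits {a b c o : ℕ} {w : Bits n} (ha : a + n ≤ o) (hb : b + n ≤ o)
    (s : Finset ℕ) :
    queryMap f a b c (xorBits o w s) = xorBits o w (queryMap f a b c s) := by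
  simp only [queryMap]
  rw [readBits_xorBits_of_disjoint (.inl ha), readBits_xorBits_of_disjoint (.inl hb),
    xorBits_comm]

theorem selMap_xorBits {x z z' v o : ℕ} {w : Bits n} (hx : x < o) (hz : z + n ≤ o)
    (hz' : z' + n ≤ o) (s : Finset ℕ) :
    selMap n x z z' v (xorBits o w s) = xorBits o w (selMap n x z z' v s) := by
  simp only [selMap]
  rw [readBits_xorBits_of_disjoint (.inl hz), readBits_xorBits_of_disjoint (.inl hz'),
    xorBits_comm]
  simp only [mem_xorBits_of_outside (.inl hx)]

theorem selMap_involutive {x z z' v : ℕ} (hx : x < v) (hz : z + n ≤ v)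
    (hz' : z' + n ≤ v) (s : Finset ℕ) :
    selMap n x z z' v (selMap n x z z' v s) = s := by
  conv_lhs => rw [selMap.eq_def n x z z' v s, selMap_xorBits hx hz hz', selMap]
  exact xorBits_xorBits_self

/-- The effect of the first `k` bits of `selMap`. -/
def selPart (x z z' v k : ℕ) (s : Finset ℕ) : Finset ℕ :=
  symmDiff s (((Finset.range k).filter fun b => if x ∈ s then z' + b ∈ s else z + b ∈ s).image
    (v + ·))

theorem selPart_zero (x z z' v : ℕ) : selPart x z z' v 0 = id := by
  funext s
  simp [selPart]

theorem selPart_eq_selMap (x z z' v : ℕ) : selPart x z z' v n = selMap n x z z' v := by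
  funext s
  simp only [selPart, selMap, xorBits]
  congr 1
  ext q
  simp only [Finset.mem_image, Finset.mem_filter, Finset.mem_range, Finset.mem_univ, true_and]
  constructor
  · rintro ⟨b, ⟨hb, h⟩, rfl⟩
    refine ⟨⟨b, hb⟩, ?_, rfl⟩
    split_ifs at h ⊢ <;> simpa [readBits] using h
  · rintro ⟨b, h, rfl⟩
    refine ⟨b, ⟨b.2, ?_⟩, rfl⟩
    split_ifs at h ⊢ <;> simpa [readBits] using h

/-- One bit of the selection: CNOT adds the bit of the block at `z`, and the two Toffoli gates
replace it by the bit of the block at `z'` if the control qubit `x` is `1`. -/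
theorem selPart_succ {x z z' v : ℕ} (hx : x < v) (hz : z + n ≤ v) (hz' : z' + n ≤ v) {k : ℕ}
    (hk : k < n) (s : Finset ℕ) :
    toffoliMap x (z' + k) (v + k) (toffoliMap x (z + k) (v + k) (cnotMap (z + k) (v + k)
      (selPart x z z' v k s))) = selPart x z z' v (k + 1) s := by
  have low : ∀ q < v, (q ∈ selPart x z z' v k s ↔ q ∈ s) := by
    intro q hq
    have : ¬ ∃ a, (a < k ∧ if x ∈ s then z' + a ∈ s else z + a ∈ s) ∧ v + a = q := by
      rintro ⟨a, -, rfl⟩; omega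
    simp only [selPart, Finset.mem_symmDiff, Finset.mem_image, Finset.mem_filter,
      Finset.mem_range]
    grind
  have hs : selPart x z z' v (k + 1) s =
      if (if x ∈ s then z' + k ∈ s else z + k ∈ s) then
        symmDiff (selPart x z z' v k s) {v + k} else selPart x z z' v k s := by
    simp only [selPart, Finset.range_add_one, Finset.filter_insert]
    split_ifs
    all_goals try rfl
    all_goals
      rw [Finset.image_insert, symmDiff_assoc]
      congr 1
      ext q
      simp only [Finset.mem_insert, Finset.mem_symmDiff, Finset.mem_image, Finset.mem_filter,
        Finset.mem_range, Finset.mem_singleton]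
      constructor
      · rintro (rfl | ⟨a, h, rfl⟩)
        · exact .inr ⟨rfl, fun ⟨a, ha, e⟩ => by omega⟩
        · exact .inl ⟨⟨a, h, rfl⟩, by omega⟩
      · rintro (⟨h, -⟩ | ⟨h, -⟩)
        · exact .inr h
        · exact .inl h
  rw [hs]
  have hx' := low x hx
  have hz1 := low (z + k) (by omega)
  have hz2 := low (z' + k) (by omega)
  set u := selPart x z z' v k s
  have flip : ∀ q < v, (q ∈ symmDiff u {v + k} ↔ q ∈ u) := by
    intro q hq
    have : q ≠ v + k := by omega
    simp [Finset.mem_symmDiff, this]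
  have fx := flip x hx
  have f1 := flip (z + k) (by omega)
  have f2 := flip (z' + k) (by omega)
  have n0 : v + k ≠ x := by omega
  have n1 : v + k ≠ z + k := by omega
  have n2 : v + k ≠ z' + k := by omega
  by_cases c0 : x ∈ s <;> by_cases c1 : z + k ∈ s <;> by_cases c2 : z' + k ∈ s <;>
    simp only [cnotMap, toffoliMap, c0, c1, c2, fx, f1, f2, hx', hz1, hz2, n0, n1, n2, ne_eq,
      not_false_eq_true, and_true, and_false, if_true, if_false,
      symmDiff_symmDiff_cancel_right]

namespace Det

variable {d : Prog} {ρ : ℕ → ℕ} {ψ : QState} {Q : (ℕ → ℕ) → QState → Prop}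

theorem seq_arith {o : ArithOp} {x y z : ℕ} : Det f (.seq (.arith o x y z) d) ρ ψ Q ↔
    Det f d (Function.update ρ x (o.eval (ρ y) (ρ z))) ψ Q := Iff.rfl

theorem seq_gate {G : Gate} : Det f (.seq (.gate G) d) ρ ψ Q ↔
    Det f d ρ (ψ.apply (G.onBasis ρ)) Q := Iff.rfl

theorem seq_query_mapDomain {x y z : ℕ} (hx : ρ x + n ≤ ρ z ∨ ρ z + n ≤ ρ x)
    (hy : ρ y + n ≤ ρ z ∨ ρ z + n ≤ ρ y)
    (h : Det f d ρ (Finsupp.mapDomain (queryMap f (ρ x) (ρ y) (ρ z)) ψ) Q) :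
    Det f (.seq (.query x y z) d) ρ ψ Q :=
  seq (query_mapDomain (Q := fun ρ' ψ' => ρ' = ρ ∧
    ψ' = Finsupp.mapDomain (queryMap f (ρ x) (ρ y) (ρ z)) ψ) hx hy ⟨rfl, rfl⟩)
    (by rintro _ _ ⟨rfl, rfl⟩; exact h)

theorem seq_assoc {c c' : Prog} : Det f (.seq c (.seq c' d)) ρ ψ Q ↔
    Det f (.seq (.seq c c') d) ρ ψ Q := Iff.rfl

theorem arith_iff {o : ArithOp} {x y z : ℕ} : Det f (.arith o x y z) ρ ψ Q ↔
    Q (Function.update ρ x (o.eval (ρ y) (ρ z))) ψ := by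
  classical
  refine ⟨fun h => ?_, .arith⟩
  by_contra hQ
  have := h (fun ρ ψ => if Q ρ ψ then 1 else 0) 1 (fun _ _ => by positivity)
    fun _ _ h => by simp [h]
  simp [Prog.wp, hQ] at this
  linarith

end Det

theorem selectProg_det {ρ : ℕ → ℕ} {ψ : QState} (h0 : ρ 0 = n) (h6 : ρ 6 = 0) (h7 : ρ 7 = 1)
    (hx : ρ 11 < ρ 14) (hz : ρ 12 + n ≤ ρ 14) (hz' : ρ 13 + n ≤ ρ 14) :
    Det f selectProg ρ ψ fun _ ψ' =>
      ψ' = Finsupp.mapDomain (selMap n (ρ 11) (ρ 12) (ρ 13) (ρ 14)) ψ := by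
  simp only [selectProg, mov, Det.seq_arith, ArithOp.eval]
  refine .loop (fun i ρ' ψ' => ρ' 17 = ρ 12 + i ∧ ρ' 18 = ρ 13 + i ∧ ρ' 19 = ρ 14 + i ∧
    ψ' = Finsupp.mapDomain (selPart (ρ 11) (ρ 12) (ρ 13) (ρ 14) i) ψ) ?_ ?_ ?_
  · simp [h6, selPart_zero]
  · rintro i hi ρ' _ hf ⟨e1, e2, e3, rfl⟩
    have f11 := hf 11 (by decide)
    have f7 := hf 7 (by decide)
    simp [h7, h0] at f11 f7 hi
    simp [selectBitProg, inc, Det.seq_gate, Det.seq_arith, Det.arith_iff, apply_cnot,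
      apply_toffoli, ArithOp.eval, e1, e2, e3, f11, f7, add_assoc, ← Finsupp.mapDomain_comp]
    congr 1
    funext s
    exact selPart_succ hx hz hz' hi s
  · rintro ρ' _ hf ⟨e1, e2, e3, rfl⟩
    simp [h0, selPart_eq_selMap]

end

section

variable {n : ℕ} {f : Bits n → Bits n → Bits n}

/-! ### The exponentiation circuit -/

/-- The first `i` steps of the chain of multiplications, on basis states. The control qubits start
at `X`, the operand blocks at `V` and the blocks of the chain at `Y`; `K` consecutive control
qubits select the same operands. -/
def chainMap (f : Bits n → Bits n → Bits n) (K X V Y : ℕ) : ℕ → Finset ℕ → Finset ℕ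
  | 0, s => s
  | i + 1, s => queryMap f (Y + i * n) (V + i * n) (Y + (i + 1) * n)
      (selMap n (X + i) (i / K * n) ((i / K + 1) * n) (V + i * n) (chainMap f K X V Y i s))

/-- The pointers before step `i` of the chain, where `j` is the exponent of the current power. -/
structure ChainPointers (n X V Y j i : ℕ) (ρ : ℕ → ℕ) : Prop where
  r0 : ρ 0 = n
  r6 : ρ 6 = 0
  r7 : ρ 7 = 1
  r11 : ρ 11 = X + i
  r12 : ρ 12 = j * n
  r13 : ρ 13 = (j + 1) * n
  r14 : ρ 14 = V + i * n
  r15 : ρ 15 = Y + i * n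
  r16 : ρ 16 = Y + (i + 1) * n

theorem index_div {K j k : ℕ} (hk : k < K) : (j * K + k) / K = j := by
  rw [add_comm, Nat.add_mul_div_right _ _ (by omega), Nat.div_eq_of_lt hk, zero_add]

theorem index_lt {J K j k : ℕ} (hj : j < J) (hk : k < K) : j * K + k < J * K := by
  have := Nat.mul_le_mul_right K (show j + 1 ≤ J from hj)
  rw [Nat.succ_mul] at this
  omega

theorem chainStep_det {ρ : ℕ → ℕ} {ψ : QState} {J K X V Y j k : ℕ} (hj : j < J) (hk : k < K)
    (hX : (J + 1) * n ≤ X) (hV : X + J * K ≤ V) (hY : V + J * K * n ≤ Y)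
    (h : ChainPointers n X V Y j (j * K + k) ρ) :
    Det f (selectProg ;; .query 15 14 16 ;; forwardProg) ρ
      (ψ.mapDomain (chainMap f K X V Y (j * K + k))) fun ρ' ψ' =>
        ChainPointers n X V Y j (j * K + (k + 1)) ρ' ∧
          ψ' = ψ.mapDomain (chainMap f K X V Y (j * K + (k + 1))) := by
  obtain ⟨h0, h6, h7, h11, h12, h13, h14, h15, h16⟩ := h
  have hi := index_lt hj hk
  set i := j * K + k with hidef
  have hjn := Nat.mul_le_mul_right n (show j + 2 ≤ J + 1 by omega)
  have hin := Nat.mul_le_mul_right n (show i + 1 ≤ J * K from hi)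
  simp only [Nat.add_mul, Nat.one_mul] at hjn hin h13 h16 hX
  refine .seq (selectProg_det h0 h6 h7 (by omega) (by omega) (by omega)).frame ?_
  rintro ρ' _ ⟨rfl, hf⟩
  have e : ∀ x, x ∉ selectProg.writes → ρ' x = ρ x := hf
  have f0 := e 0 (by decide)
  have f6 := e 6 (by decide)
  have f7 := e 7 (by decide)
  have f11 := e 11 (by decide)
  have f12 := e 12 (by decide)
  have f13 := e 13 (by decide)
  have f14 := e 14 (by decide)
  have f15 := e 15 (by decide)
  have f16 := e 16 (by decide)
  refine Det.seq_query_mapDomain (.inl (by omega)) (.inl (by omega)) ?_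
  have hstep : ψ.mapDomain (chainMap f K X V Y (j * K + (k + 1))) =
      Finsupp.mapDomain (queryMap f (ρ' 15) (ρ' 14) (ρ' 16)) (Finsupp.mapDomain
        (selMap n (ρ 11) (ρ 12) (ρ 13) (ρ 14)) (ψ.mapDomain (chainMap f K X V Y i))) := by
    rw [← Finsupp.mapDomain_comp, ← Finsupp.mapDomain_comp]
    congr 1
    funext s
    rw [← add_assoc, ← hidef]
    simp only [chainMap, Function.comp, f14, f15, f16, h11, h12, h13, h14, h15, h16, hidef,
      index_div hk, Nat.add_mul, Nat.one_mul]
  rw [← hstep]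
  simp [forwardProg, inc, Det.seq_arith, Det.arith_iff, ArithOp.eval]
  rw [← add_assoc, ← hidef]
  constructor <;> simp [Nat.add_mul, f0, f6, f7, f11, f12, f13, f14, f15, f16, h0, h6, h7, h11,
    h12, h13, h14, h15, h16] <;> omega

theorem chainProg_det {ρ : ℕ → ℕ} {ψ : QState} {J K X V Y : ℕ}
    (hX : (J + 1) * n ≤ X) (hV : X + J * K ≤ V) (hY : V + J * K * n ≤ Y)
    (h2 : ρ 2 = J) (h3 : ρ 3 = K) (h : ChainPointers n X V Y 0 0 ρ) :
    Det f chainProg ρ ψ fun ρ' ψ' =>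
        ChainPointers n X V Y J (J * K) ρ' ∧ ψ' = ψ.mapDomain (chainMap f K X V Y (J * K)) := by
  refine .loop (fun j ρ' ψ' => ChainPointers n X V Y j (j * K) ρ' ∧
    ψ' = ψ.mapDomain (chainMap f K X V Y (j * K))) ?_ ?_ ?_
  · refine ⟨by simpa using h, ?_⟩
    rw [Nat.zero_mul]
    exact (Finsupp.mapDomain_id (v := ψ)).symm
  · rintro j hj ρ₁ _ hf ⟨hp, rfl⟩
    rw [h2] at hj
    have hf3 := (hf 3 (by decide)).trans h3
    refine .seq (.loop (fun k ρ' ψ' => ChainPointers n X V Y j (j * K + k) ρ' ∧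
      ψ' = ψ.mapDomain (chainMap f K X V Y (j * K + k))) ⟨hp, rfl⟩ ?_
      (Q := fun ρ' ψ' => ChainPointers n X V Y j (j * K + K) ρ' ∧
        ψ' = ψ.mapDomain (chainMap f K X V Y (j * K + K))) ?_) ?_
    · rintro k hk ρ₂ _ - ⟨hp, rfl⟩
      exact chainStep_det hj (hf3 ▸ hk) hX hV hY hp
    · rintro ρ₂ _ - h
      rwa [hf3] at h
    · rintro ρ₂ _ ⟨⟨h0, h6, h7, h11, h12, h13, h14, h15, h16⟩, rfl⟩
      simp [inc, Det.seq_arith, Det.arith_iff, ArithOp.eval, Nat.succ_mul]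
      constructor <;> simp [Nat.add_mul, h0, h6, h7, h11, h12, h13, h14, h15, h16]
  · rintro ρ' _ - h
    rwa [h2] at h

theorem unchainStep_det {ρ : ℕ → ℕ} {ψ : QState} {J K X V Y j k o : ℕ} (hj : j < J) (hk : k < K)
    (hX : (J + 1) * n ≤ X) (hV : X + J * K ≤ V) (hY : V + J * K * n ≤ Y)
    (ho : Y + (J * K + 1) * n ≤ o) (w : Finset ℕ → Bits n)
    (h : ChainPointers n X V Y j (j * K + (k + 1)) ρ) :
    Det f (backProg ;; .query 15 14 16 ;; selectProg) ρ
      (ψ.mapDomain fun s => xorBits o (w s) (chainMap f K X V Y (j * K + (k + 1)) s)) fun ρ' ψ' =>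
        ChainPointers n X V Y j (j * K + k) ρ' ∧
          ψ' = ψ.mapDomain fun s => xorBits o (w s) (chainMap f K X V Y (j * K + k) s) := by
  obtain ⟨h0, h6, h7, h11, h12, h13, h14, h15, h16⟩ := h
  have hi := index_lt hj hk
  have hdiv := index_div (j := j) hk
  rw [← add_assoc] at *
  set i := j * K + k with hidef
  refine .seq (R := fun ρ' ψ' => ChainPointers n X V Y j i ρ' ∧
    ψ' = ψ.mapDomain fun s => xorBits o (w s) (chainMap f K X V Y (i + 1) s)) ?_ ?_
  · simp [backProg, dec, Det.seq_arith, Det.arith_iff, ArithOp.eval]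
    constructor <;> simp [Nat.add_mul, h0, h6, h7, h11, h12, h13, h14, h15, h16] <;> omega
  rintro ρ _ ⟨⟨h0, h6, h7, h11, h12, h13, h14, h15, h16⟩, rfl⟩
  have hjn := Nat.mul_le_mul_right n (show j + 2 ≤ J + 1 by omega)
  have hin := Nat.mul_le_mul_right n (show i + 1 ≤ J * K from hi)
  have h13' := h13
  have h16' := h16
  simp only [Nat.add_mul, Nat.one_mul] at hjn hin h13 h16 hX ho
  refine Det.seq_query_mapDomain (.inl (by omega)) (.inl (by omega)) ?_
  refine (selectProg_det h0 h6 h7 (by omega) (by omega) (by omega)).frame.mono ?_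
  rintro ρ' _ ⟨rfl, hf⟩
  have e : ∀ x, x ∉ selectProg.writes → ρ' x = ρ x := hf
  refine ⟨?_, ?_⟩
  · constructor <;> rw [e _ (by decide)] <;> assumption
  · rw [← Finsupp.mapDomain_comp, ← Finsupp.mapDomain_comp]
    congr 1
    funext s
    simp only [Function.comp, chainMap, hdiv, ← h11, ← h12, ← h13', ← h14, ← h15, ← h16']
    rw [queryMap_xorBits (by omega) (by omega), queryMap_involutive (.inl (by omega))
      (.inl (by omega)), selMap_xorBits (by omega) (by omega) (by omega),
      selMap_involutive (by omega) (by omega) (by omega)]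

/-- Every step of the chain is an involution that leaves the output block at `o` alone, so running
the steps backwards erases the chain. -/
theorem unchainProg_det {ρ : ℕ → ℕ} {ψ : QState} {J K X V Y o : ℕ}
    (hX : (J + 1) * n ≤ X) (hV : X + J * K ≤ V) (hY : V + J * K * n ≤ Y)
    (ho : Y + (J * K + 1) * n ≤ o) (w : Finset ℕ → Bits n)
    (h2 : ρ 2 = J) (h3 : ρ 3 = K) (h : ChainPointers n X V Y J (J * K) ρ) :
    Det f unchainProg ρ
      (ψ.mapDomain fun s => xorBits o (w s) (chainMap f K X V Y (J * K) s)) fun ρ' ψ' =>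
        ChainPointers n X V Y 0 0 ρ' ∧ ψ' = ψ.mapDomain fun s => xorBits o (w s) s := by
  refine .loop (fun j ρ' ψ' => ChainPointers n X V Y (J - j) ((J - j) * K) ρ' ∧
    ψ' = ψ.mapDomain fun s => xorBits o (w s) (chainMap f K X V Y ((J - j) * K) s)) ?_ ?_ ?_
  · exact ⟨by simpa using h, by simp⟩
  · rintro j' hj ρ₁ _ hf ⟨hp, rfl⟩
    rw [h2] at hj
    have hf3 := (hf 3 (by decide)).trans h3
    obtain ⟨j, hj'⟩ : ∃ j, J - j' = j + 1 := ⟨J - j' - 1, by omega⟩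
    have hj'' : J - (j' + 1) = j := by omega
    rw [hj'] at hp
    rw [hj', hj'']
    obtain ⟨h0, h6, h7, h11, h12, h13, h14, h15, h16⟩ := hp
    refine Det.seq_assoc.2 (.seq (R := fun ρ' ψ' => ChainPointers n X V Y j ((j + 1) * K) ρ' ∧
      ρ' 3 = K ∧ ψ' = ψ.mapDomain fun s =>
        xorBits o (w s) (chainMap f K X V Y ((j + 1) * K) s)) ?_ ?_)
    · simp [dec, Det.seq_arith, Det.arith_iff, ArithOp.eval]
      refine ⟨?_, hf3⟩
      constructor <;> simp [Nat.add_mul, h0, h6, h7, h11, h12, h13, h14, h15, h16]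
    rintro ρ₂ _ ⟨hp, h3, rfl⟩
    refine .loop (fun k' ρ' ψ' => ChainPointers n X V Y j (j * K + (K - k')) ρ' ∧
      ψ' = ψ.mapDomain fun s => xorBits o (w s) (chainMap f K X V Y (j * K + (K - k')) s))
      ?_ ?_ ?_
    · simpa [Nat.add_mul] using hp
    · rintro k' hk ρ₃ _ - ⟨hp, rfl⟩
      rw [h3] at hk
      obtain ⟨k, hk'⟩ : ∃ k, K - k' = k + 1 := ⟨K - k' - 1, by omega⟩
      rw [hk'] at hp ⊢
      rw [show K - (k' + 1) = k by omega]
      exact unchainStep_det (by omega) (by omega) hX hV hY ho w hp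
    · rintro ρ₃ _ - h
      simpa [h3] using h
  · rintro ρ' _ - h
    rw [h2] at h
    simpa [chainMap] using h

/-- The result of the exponentiation circuit on a basis state. -/
def expMap (f : Bits n → Bits n → Bits n) (K Q X : ℕ) (s : Finset ℕ) : Finset ℕ :=
  let V := X + Q
  let Y := V + Q * n
  let s₁ := queryMap f 0 0 Y s
  let s₂ := chainMap f K X V Y Q s₁
  xorBits (Y + (Q + 1) * n) (f (readBits n (Y + Q * n) s₂) (readBits n 0 s₂)) s₁

theorem chainInitProg_det {ρ : ℕ → ℕ} {ψ : QState} {J K X : ℕ} (hX : (J + 1) * n ≤ X)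
    (h0 : ρ 0 = n) (h2 : ρ 2 = J) (h3 : ρ 3 = K) (h6 : ρ 6 = 0) (h7 : ρ 7 = 1) (h9 : ρ 9 = X)
    (h11 : ρ 11 = X + J * K) :
    Det f chainInitProg ρ ψ fun ρ' ψ' =>
      ChainPointers n X (X + J * K) (X + J * K + J * K * n) 0 0 ρ' ∧
        ψ' = ψ.mapDomain (queryMap f 0 0 (X + J * K + J * K * n)) := by
  simp only [chainInitProg, mov, Det.seq_arith, ArithOp.eval]
  set ρ₁ := Function.update (Function.update ρ 14 (ρ 11 + ρ 6)) 15
    (Function.update ρ 14 (ρ 11 + ρ 6) 11 + Function.update ρ 14 (ρ 11 + ρ 6) 6) with hρ₁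
  have g15 : ρ₁ 15 = X + J * K := by simp [hρ₁, h11, h6]
  have g14 : ρ₁ 14 = X + J * K := by simp [hρ₁, h11, h6]
  have g : ∀ x, x ≠ 14 → x ≠ 15 → ρ₁ x = ρ x := by
    intro x h h'
    simp [hρ₁, h, h']
  clear_value ρ₁
  have hloop : Det f (.loop 2 (.loop 3 (inc 15 0))) ρ₁ ψ fun ρ' ψ' =>
      ρ' 15 = X + J * K + J * K * n ∧ ψ' = ψ := by
    refine .loop (fun j ρ' ψ' => ρ' 15 = X + J * K + j * K * n ∧ ψ' = ψ) (by simpa using g15) ?_ ?_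
    · rintro j hj ρ₂ ψ₁ hf ⟨e, hψ⟩
      refine .loop (fun k ρ' ψ' => ρ' 15 = X + J * K + j * K * n + k * n ∧ ψ' = ψ)
        ⟨by simpa using e, hψ⟩
        ?_ ?_
      · rintro k - ρ₃ _ hf' ⟨e', rfl⟩
        have q0 : ρ₃ 0 = n := by
          rw [hf' 0 (by decide), hf 0 (by decide), g 0 (by decide) (by decide), h0]
        simp [inc, Det.arith_iff, ArithOp.eval, e', q0, Nat.add_mul, add_assoc]
      · rintro ρ₃ _ - ⟨e', rfl⟩
        have q3 : ρ₂ 3 = K := by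
          rw [hf 3 (by decide), g 3 (by decide) (by decide), h3]
        refine ⟨?_, rfl⟩
        rw [e', q3]
        ring
    · rintro ρ' ψ' - ⟨e, rfl⟩
      rw [g 2 (by decide) (by decide), h2] at e
      exact ⟨e, rfl⟩
  refine .seq hloop.frame ?_
  rintro ρ' _ ⟨⟨e15, rfl⟩, hf⟩
  have q : ∀ x, x ≠ 14 → x ≠ 15 → ρ' x = ρ x := fun x h h' =>
    (hf x (by simp [Prog.writes, inc, h'])).trans (g x h h')
  have q14 : ρ' 14 = X + J * K := (hf 14 (by decide)).trans g14
  have q0 := (q 0 (by decide) (by decide)).trans h0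
  have q6 := (q 6 (by decide) (by decide)).trans h6
  have q7 := (q 7 (by decide) (by decide)).trans h7
  have q9 := (q 9 (by decide) (by decide)).trans h9
  have hXn : n ≤ X := le_trans (Nat.le_mul_of_pos_left n (Nat.succ_pos J)) hX
  refine Det.seq_query_mapDomain (.inl (by omega)) (.inl (by omega)) ?_
  simp [Det.seq_arith, Det.arith_iff, ArithOp.eval, e15, q6]
  constructor <;> simp [q0, q6, q7, q9, q14, e15]

theorem exponentiateProg_det {ρ : ℕ → ℕ} {ψ : QState} {J K X : ℕ} (hX : (J + 1) * n ≤ X)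
    (h0 : ρ 0 = n) (h2 : ρ 2 = J) (h3 : ρ 3 = K) (h6 : ρ 6 = 0) (h7 : ρ 7 = 1) (h9 : ρ 9 = X)
    (h11 : ρ 11 = X + J * K) :
    Det f exponentiateProg ρ ψ fun ρ' ψ' =>
      ρ' 14 = X + J * K ∧ ρ' 33 = X + J * K + J * K * n + (J * K + 1) * n ∧
        ψ' = ψ.mapDomain (expMap f K (J * K) X) := by
  set V := X + J * K with hV
  set Y := V + J * K * n with hY
  have hXn : n ≤ X := le_trans (Nat.le_mul_of_pos_left n (Nat.succ_pos J)) hX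
  have hO : Y + J * K * n + n ≤ Y + (J * K + 1) * n := by rw [Nat.add_mul]; omega
  refine .seq (chainInitProg_det hX h0 h2 h3 h6 h7 h9 h11).frame ?_
  rintro ρ₁ _ ⟨⟨hp, rfl⟩, hf⟩
  refine .seq (chainProg_det hX hV.ge hY.ge ((hf 2 (by decide)).trans h2)
    ((hf 3 (by decide)).trans h3) hp).frame ?_
  rintro ρ₂ _ ⟨⟨hp, rfl⟩, hf'⟩
  have g2 := ((hf' 2 (by decide)).trans (hf 2 (by decide))).trans h2
  have g3 := ((hf' 3 (by decide)).trans (hf 3 (by decide))).trans h3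
  obtain ⟨p0, p6, p7, p11, p12, p13, p14, p15, p16⟩ := hp
  simp only [mov, Det.seq_arith, ArithOp.eval, p16, p6, add_zero]
  refine Det.seq_query_mapDomain (by simp [p15]; omega) (by simp [p6]; omega) ?_
  simp only [Function.update_self, Function.update_of_ne (show (15 : ℕ) ≠ 33 by decide),
    Function.update_of_ne (show (6 : ℕ) ≠ 33 by decide), p15, p6]
  rw [← Finsupp.mapDomain_comp (f := chainMap f K X V Y (J * K))]
  refine (unchainProg_det hX hV.ge hY.ge (o := Y + (J * K + 1) * n) le_rfl
    (fun s => f (readBits n (Y + J * K * n) (chainMap f K X V Y (J * K) s))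
      (readBits n 0 (chainMap f K X V Y (J * K) s))) (by simpa using g2) (by simpa using g3)
      (by constructor <;> simp [p0, p6, p7, p11, p12, p13, p14, p15, p16])).frame.mono ?_
  rintro ρ' _ ⟨⟨hp, rfl⟩, hf''⟩
  refine ⟨by simpa using hp.r14, ?_, ?_⟩
  · rw [hf'' 33 (by decide)]
    simp
  · rw [← Finsupp.mapDomain_comp]
    rfl

end

section

variable {n : ℕ} {f : Bits n → Bits n → Bits n}

/-! ### Exponentiation of an element of a black-box semigroup -/

/-- The exponent that the control qubits in `c` stand for. -/
def controlSum (K X : ℕ) (c : Finset ℕ) : ℕ := ∑ q ∈ c, 2 ^ ((q - X) / K)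

/-- The exponent after `i` steps of the chain. -/
def chainExponent (K X i : ℕ) (s : Finset ℕ) : ℕ :=
  2 + ∑ k ∈ Finset.range i, 2 ^ (k / K) * (if X + k ∈ s then 2 else 1)

/-- The exponent of the circuit when all control qubits are `0`. -/
def baseExponent (K Q : ℕ) : ℕ := 3 + ∑ k ∈ Finset.range Q, 2 ^ (k / K)

section BlackBox

variable {S : Type*} [Semigroup S] (B : BlackBox S n) (g : S)

/-- The basis state `s` holds the encodings of `g ^ (2 ^ j)` for `j ≤ J` from qubit `0` on. -/
def HoldsPowers (J : ℕ) (s : Finset ℕ) : Prop :=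
  ∀ j ≤ J, readBits n (j * n) s = B.enc (spow g (2 ^ j))

variable {B g}

theorem HoldsPowers.congr {J X : ℕ} {s s' : Finset ℕ} (h : HoldsPowers B g J s)
    (hX : (J + 1) * n ≤ X) (hs : ∀ q < X, (q ∈ s' ↔ q ∈ s)) : HoldsPowers B g J s' := by
  intro j hj
  rw [← h j hj]
  have := Nat.mul_le_mul_right n (show j + 1 ≤ J + 1 by omega)
  rw [Nat.succ_mul] at this
  exact readBits_congr fun q _ hq => hs q (by omega)

/-- After `i` steps, block `i` of the chain holds the power with exponent `chainExponent`; only the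
operand and chain blocks used so far have changed. -/
theorem chainMap_spec {J K X : ℕ} (hX : (J + 1) * n ≤ X) {s : Finset ℕ}
    (hs : HoldsPowers B g J s)
    (hY : readBits n (X + J * K + J * K * n) s = B.enc (spow g 2))
    (hfresh : ∀ q ∈ s, q < X + J * K ∨ (X + J * K + J * K * n ≤ q ∧
      q < X + J * K + J * K * n + n)) (i : ℕ) (hi : i ≤ J * K) :
    (∀ q, (q < X + J * K ∨ X + J * K + i * n ≤ q) →
      (q < X + J * K + J * K * n + n ∨ X + J * K + J * K * n + (i + 1) * n ≤ q) →
      (q ∈ chainMap B.mul K X (X + J * K) (X + J * K + J * K * n) i s ↔ q ∈ s)) ∧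
    readBits n (X + J * K + J * K * n + i * n)
      (chainMap B.mul K X (X + J * K) (X + J * K + J * K * n) i s) =
      B.enc (spow g (chainExponent K X i s)) := by
  set V := X + J * K with hV
  set Y := V + J * K * n with hYdef
  induction i with
  | zero => simpa [chainMap, chainExponent] using hY
  | succ i ih =>
    obtain ⟨ih1, ih2⟩ := ih (by omega)
    have hK : 0 < K := Nat.pos_of_ne_zero (by rintro rfl; simp at hi)
    have hj : i / K < J := (Nat.div_lt_iff_lt_mul hK).2 hi
    simp only [chainMap]
    set u := chainMap B.mul K X V Y i s
    have hin := Nat.mul_le_mul_right n hi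
    have hjn := Nat.mul_le_mul_right n (show i / K + 2 ≤ J + 1 by omega)
    have ej : (i / K + 1) * n = i / K * n + n := Nat.succ_mul _ _
    have ei : (i + 1) * n = i * n + n := Nat.succ_mul _ _
    have ei' : (i + 1 + 1) * n = i * n + n + n := by ring
    have ej' : (i / K + 2) * n = i / K * n + n + n := by ring
    rw [ej'] at hjn
    rw [ei] at hin
    rw [ei', ei]
    have hu : ∀ q < V, (q ∈ u ↔ q ∈ s) := fun q hq => ih1 q (.inl hq) (.inl (by omega))
    have hr : ∀ a, a + n ≤ V → readBits n a u = readBits n a s :=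
      fun a ha => readBits_congr fun q _ _ => hu q (by omega)
    have hw : (if X + i ∈ u then readBits n ((i / K + 1) * n) u else readBits n (i / K * n) u) =
        B.enc (spow g (2 ^ (i / K) * (if X + i ∈ s then 2 else 1))) := by
      rw [hr _ (by rw [ej]; omega), hr _ (by omega), hs _ hj, hs _ hj.le]
      simp only [hu (X + i) (by omega)]
      split_ifs
      · rw [pow_succ]
      · rw [mul_one]
    have hsel : selMap n (X + i) (i / K * n) ((i / K + 1) * n) (V + i * n) u =
        xorBits (V + i * n) (B.enc (spow g (2 ^ (i / K) * (if X + i ∈ s then 2 else 1)))) u := by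
      rw [selMap, hw]
    rw [hsel]
    set w := B.enc (spow g (2 ^ (i / K) * (if X + i ∈ s then 2 else 1)))
    have hVempty : ∀ q, V + i * n ≤ q → q < V + i * n + n → q ∉ u := by
      intro q h1 h2 hq
      have := hfresh q ((ih1 q (.inr h1) (.inl (by omega))).1 hq)
      omega
    have hread1 : readBits n (V + i * n) (xorBits (V + i * n) w u) = w :=
      readBits_xorBits_self hVempty
    have hread2 : readBits n (Y + i * n) (xorBits (V + i * n) w u) =
        B.enc (spow g (chainExponent K X i s)) := by
      rw [readBits_xorBits_of_disjoint (.inr (by omega)), ih2]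
    have hprod : B.mul (B.enc (spow g (chainExponent K X i s))) w =
        B.enc (spow g (chainExponent K X (i + 1) s)) := by
      have e : chainExponent K X (i + 1) s =
          chainExponent K X i s + 2 ^ (i / K) * (if X + i ∈ s then 2 else 1) := by
        simp only [chainExponent, Finset.sum_range_succ, add_assoc]
      rw [B.mul_enc, e, spow_add]
      · simp only [chainExponent]; omega
      · split_ifs <;> exact Nat.mul_pos (by positivity) (by norm_num)
    rw [queryMap, hread1, hread2, hprod]
    constructor
    · intro q h1 h2
      rw [mem_xorBits_of_outside (by omega), mem_xorBits_of_outside (by omega)]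
      exact ih1 q (by omega) (by omega)
    · apply readBits_xorBits_self
      intro q h1 h2
      rw [mem_xorBits_of_outside (by omega), ih1 q (by omega) (by omega)]
      intro hq
      have := hfresh q hq
      omega

/-- The final factor `g` of the circuit accounts for the `1`. -/
theorem chainExponent_eq {K X Q : ℕ} {s c : Finset ℕ} (hc : c ⊆ Finset.Ico X (X + Q))
    (hs : ∀ k < Q, (X + k ∈ s ↔ X + k ∈ c)) :
    chainExponent K X Q s + 1 = baseExponent K Q + controlSum K X c := by
  have h1 : ∑ k ∈ Finset.range Q, 2 ^ (k / K) * (if X + k ∈ s then 2 else 1) =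
      ∑ k ∈ Finset.range Q, 2 ^ (k / K) +
        ∑ k ∈ Finset.range Q, if X + k ∈ c then 2 ^ (k / K) else 0 := by
    rw [← Finset.sum_add_distrib]
    refine Finset.sum_congr rfl fun k hk => ?_
    simp only [hs k (Finset.mem_range.1 hk)]
    split_ifs <;> ring
  have h2 : controlSum K X c = ∑ k ∈ Finset.range Q, if X + k ∈ c then 2 ^ (k / K) else 0 := by
    rw [controlSum, ← Finset.sum_filter]
    symm
    refine Finset.sum_bij (fun k _ => X + k) ?_ ?_ ?_ ?_
    · intro k hk
      exact (Finset.mem_filter.1 hk).2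
    · intro a _ b _ h
      omega
    · intro q hq
      have := Finset.mem_Ico.1 (hc hq)
      exact ⟨q - X, Finset.mem_filter.2 ⟨Finset.mem_range.2 (by omega),
        by rwa [Nat.add_sub_cancel' this.1]⟩, by omega⟩
    · intro k _
      rw [Nat.add_sub_cancel_left]
  simp only [chainExponent, baseExponent, h1, h2]
  omega

/-- The exponentiation circuit writes `g ^ (T + e)` to the output block, where `e` is the exponent
that the control qubits stand for and `T` is fixed; besides it only writes a constant to the first
block of the chain. -/
theorem expMap_spec {J K X : ℕ} (hX : (J + 1) * n ≤ X) {σ c : Finset ℕ}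
    (hσ : HoldsPowers B g J σ) (hfresh : ∀ q ∈ σ, q < X)
    (hc : c ⊆ Finset.Ico X (X + J * K)) :
    expMap B.mul K (J * K) X (σ ∪ c) =
      xorBits (X + J * K + J * K * n + (J * K + 1) * n)
        (B.enc (spow g (baseExponent K (J * K) + controlSum K X c)))
        (xorBits (X + J * K + J * K * n) (B.enc (spow g 2)) σ ∪ c) := by
  have hXn : n ≤ X := le_trans (Nat.le_mul_of_pos_left n (Nat.succ_pos J)) hX
  have hcc : ∀ q ∈ c, X ≤ q ∧ q < X + J * K := fun q hq => Finset.mem_Ico.1 (hc hq)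
  have hlow : ∀ q < X, (q ∈ σ ∪ c ↔ q ∈ σ) := by
    intro q hq
    have : q ∉ c := fun h => by have := hcc q h; omega
    simp [this]
  have hP : HoldsPowers B g J (σ ∪ c) := hσ.congr hX hlow
  have h0 : readBits n 0 (σ ∪ c) = B.enc g := by
    simpa [spow] using hP 0 (Nat.zero_le _)
  have hY : ∀ q, X + J * K + J * K * n ≤ q → q ∉ σ ∪ c := by
    intro q h hq
    rcases Finset.mem_union.1 hq with hq | hq
    · have := hfresh q hq; omega
    · have := hcc q hq; omega
  have hs₁ : queryMap B.mul 0 0 (X + J * K + J * K * n) (σ ∪ c) =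
      xorBits (X + J * K + J * K * n) (B.enc (spow g 2)) (σ ∪ c) := by
    rw [queryMap, h0, B.mul_enc]; rfl
  have hs₁' : xorBits (X + J * K + J * K * n) (B.enc (spow g 2)) (σ ∪ c) =
      xorBits (X + J * K + J * K * n) (B.enc (spow g 2)) σ ∪ c := by
    ext q
    by_cases hq : q ∈ c
    · have := hcc q hq
      rw [mem_xorBits_of_outside (by omega)]
      simp [hq]
    · rw [Finset.mem_union, mem_xorBits, mem_xorBits]
      simp [hq]
  simp only [expMap]
  rw [hs₁]
  set s₁ := xorBits (X + J * K + J * K * n) (B.enc (spow g 2)) (σ ∪ c) with hs₁def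
  have hs₁low : ∀ q < X + J * K, (q ∈ s₁ ↔ q ∈ σ ∪ c) := fun q hq =>
    mem_xorBits_of_outside (by omega)
  have hP₁ : HoldsPowers B g J s₁ := hP.congr hX fun q hq => hs₁low q (by omega)
  obtain ⟨c1, c2⟩ := chainMap_spec (K := K) hX hP₁
    (readBits_xorBits_self fun q h _ => hY q h) (by
      intro q hq
      by_contra hcon
      rw [hs₁def, mem_xorBits_of_outside (by omega)] at hq
      rcases Finset.mem_union.1 hq with hq | hq
      · have := hfresh q hq; omega
      · have := hcc q hq; omega) (J * K) le_rfl
  have hr0 : readBits n 0 (chainMap B.mul K X (X + J * K) (X + J * K + J * K * n) (J * K) s₁) =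
      B.enc (spow g 1) := by
    rw [readBits_congr (s' := s₁) fun q _ hq => c1 q (by omega) (by omega)]
    simpa using hP₁ 0 (Nat.zero_le _)
  rw [c2, hr0, B.mul_enc, ← spow_add g (by simp only [chainExponent]; omega) le_rfl,
    chainExponent_eq hc, hs₁']
  intro k hk
  rw [hs₁low _ (by omega)]
  have : X + k ∉ σ := fun h => by have := hfresh _ h; omega
  simp [this]

end BlackBox

/-! ### Hadamard gates -/

/-- `1 / √2`. -/
noncomputable def hadCoeff : ℂ := 1 / (Real.sqrt 2 : ℂ)

theorem hadCoeff_mul_self : hadCoeff * hadCoeff = 1 / 2 := by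
  have : (Real.sqrt 2 : ℂ) * Real.sqrt 2 = 2 := by
    rw [← Complex.ofReal_mul, Real.mul_self_sqrt (by norm_num)]; norm_num
  rw [hadCoeff, div_mul_div_comm, this, one_mul]

theorem apply_had_of_notMem {ρ : ℕ → ℕ} {x : ℕ} {s : Finset ℕ} (h : ρ x ∉ s) (α : ℂ) :
    QState.apply ((Gate.had x).onBasis ρ) (Finsupp.single s α) =
      Finsupp.single s (α * hadCoeff) + Finsupp.single (insert (ρ x) s) (α * hadCoeff) := by
  simp [QState.apply_single, Gate.onBasis, h, hadCoeff, smul_add, Finset.erase_eq_of_notMem]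

theorem apply_had_insert {ρ : ℕ → ℕ} {x : ℕ} {s : Finset ℕ} (h : ρ x ∉ s) (α : ℂ) :
    QState.apply ((Gate.had x).onBasis ρ) (Finsupp.single (insert (ρ x) s) α) =
      Finsupp.single s (α * hadCoeff) + Finsupp.single (insert (ρ x) s) (-(α * hadCoeff)) := by
  simp [QState.apply_single, Gate.onBasis, h, hadCoeff, smul_add, div_eq_mul_inv]

theorem Ico_succ_eq_insert (X i : ℕ) :
    Finset.Ico X (X + (i + 1)) = insert (X + i) (Finset.Ico X (X + i)) := by
  ext q
  simp only [Finset.mem_Ico, Finset.mem_insert]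
  omega

theorem sum_powerset_Ico_succ {M : Type*} [AddCommMonoid M] (X i : ℕ) (F : Finset ℕ → M) :
    ∑ c ∈ (Finset.Ico X (X + (i + 1))).powerset, F c =
      ∑ c ∈ (Finset.Ico X (X + i)).powerset, (F c + F (insert (X + i) c)) := by
  rw [Ico_succ_eq_insert, Finset.sum_powerset_insert (by simp), Finset.sum_add_distrib]

theorem notMem_of_mem_powerset_Ico {X i : ℕ} {c : Finset ℕ}
    (hc : c ∈ (Finset.Ico X (X + i)).powerset) : X + i ∉ c := fun h => by
  have := Finset.mem_powerset.1 hc h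
  simp at this

/-- The uniform superposition over the first `i` control qubits. -/
noncomputable def uniformState (X i : ℕ) (σ : Finset ℕ) (α : ℂ) : QState :=
  ∑ c ∈ (Finset.Ico X (X + i)).powerset, Finsupp.single (σ ∪ c) (α * hadCoeff ^ i)

theorem apply_had_uniformState {ρ : ℕ → ℕ} {x X i : ℕ} {σ : Finset ℕ} (α : ℂ)
    (hx : ρ x = X + i) (hσ : X + i ∉ σ) :
    QState.apply ((Gate.had x).onBasis ρ) (uniformState X i σ α) = uniformState X (i + 1) σ α := by
  simp only [uniformState]
  rw [QState.apply_sum, sum_powerset_Ico_succ]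
  refine Finset.sum_congr rfl fun c hc => ?_
  have hc' := notMem_of_mem_powerset_Ico hc
  rw [apply_had_of_notMem (by rw [hx]; simp [hσ, hc']), hx, Finset.union_insert, pow_succ,
    mul_assoc]

theorem hadamardProg_det {ρ : ℕ → ℕ} {J K X : ℕ} {σ : Finset ℕ} {α : ℂ}
    (h2 : ρ 2 = J) (h3 : ρ 3 = K) (h6 : ρ 6 = 0) (h7 : ρ 7 = 1) (h9 : ρ 9 = X)
    (hσ : ∀ q ∈ σ, q < X) :
    Det f hadamardProg ρ (Finsupp.single σ α) fun ρ' ψ' =>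
      ρ' 11 = X + J * K ∧ ψ' = uniformState X (J * K) σ α := by
  simp only [hadamardProg, mov, Det.seq_arith, ArithOp.eval, h9, h6, add_zero]
  refine .loop (fun j ρ' ψ' => ρ' 11 = X + j * K ∧ ψ' = uniformState X (j * K) σ α)
    (by simp [uniformState]) ?_ ?_
  · rintro j - ρ₁ ψ₁ hf ⟨e, hψ⟩
    refine .loop (fun k ρ' ψ' => ρ' 11 = X + (j * K + k) ∧ ψ' = uniformState X (j * K + k) σ α)
      ⟨e, hψ⟩ ?_ ?_
    · rintro k - ρ₂ _ hf' ⟨e', rfl⟩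
      have q7 : ρ₂ 7 = 1 := by
        rw [hf' 7 (by decide), hf 7 (by decide)]
        simpa using h7
      rw [Det.seq_gate, apply_had_uniformState α e' fun h => by have := hσ _ h; omega]
      simp [inc, Det.arith_iff, ArithOp.eval, e', q7, add_assoc]
    · rintro ρ₂ _ - ⟨e', rfl⟩
      have q3 : ρ₁ 3 = K := by
        rw [hf 3 (by decide)]
        simpa using h3
      rw [q3] at e' ⊢
      rw [Nat.succ_mul]
      exact ⟨e', rfl⟩
  · rintro ρ' _ - ⟨e, rfl⟩
    simp [h2] at e ⊢
    exact e

end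

section

variable {n : ℕ} {f : Bits n → Bits n → Bits n}

/-! ### Fourier expansion over the cycle -/

/-- The primitive root of unity `exp (-2 * π * i / r)`. -/
noncomputable def rootExp (r : ℕ) : ℂ := (Complex.exp (2 * Real.pi * Complex.I / r))⁻¹

theorem isPrimitiveRoot_rootExp {r : ℕ} (hr : r ≠ 0) : IsPrimitiveRoot (rootExp r) r :=
  (Complex.isPrimitiveRoot_exp r hr).inv

theorem rootExp_ne_zero (r : ℕ) : rootExp r ≠ 0 := inv_ne_zero (Complex.exp_ne_zero _)

theorem norm_rootExp (r : ℕ) : ‖rootExp r‖ = 1 := by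
  have : (2 * Real.pi * Complex.I / r : ℂ) = ((2 * Real.pi / r : ℝ) : ℂ) * Complex.I := by
    push_cast; ring
  rw [rootExp, norm_inv, this, Complex.norm_exp_ofReal_mul_I, inv_one]

theorem sum_rootExp {r : ℕ} (hr : r ≠ 0) (e h : ℕ) (hh : h < r) :
    ∑ s ∈ Finset.range r, rootExp r ^ (s * e) * (rootExp r ^ (s * h))⁻¹ =
      if h = e % r then (r : ℂ) else 0 := by
  have hω := isPrimitiveRoot_rootExp hr
  have hne := rootExp_ne_zero r
  set ω := rootExp r
  have e1 : ∀ s, ω ^ (s * e) * (ω ^ (s * h))⁻¹ = (ω ^ e * (ω ^ h)⁻¹) ^ s := by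
    intro s
    rw [mul_pow, inv_pow, ← pow_mul, ← pow_mul, mul_comm e, mul_comm h]
  have hmod : ω ^ e = ω ^ (e % r) := by
    conv_lhs => rw [← Nat.mod_add_div e r, pow_add, pow_mul, hω.pow_eq_one, one_pow, mul_one]
  simp only [e1]
  split_ifs with heq
  · rw [hmod, ← heq, mul_inv_cancel₀ (pow_ne_zero _ hne)]
    simp
  · have hζ : ω ^ e * (ω ^ h)⁻¹ ≠ 1 := by
      rw [hmod]
      intro h1
      apply heq
      apply hω.pow_inj hh (Nat.mod_lt _ (Nat.pos_of_ne_zero hr))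
      rw [mul_inv_eq_one₀ (pow_ne_zero _ hne)] at h1
      exact h1.symm
    rw [geom_sum_eq hζ, mul_pow, inv_pow, ← pow_mul, ← pow_mul, mul_comm e, mul_comm h, pow_mul,
      pow_mul, hω.pow_eq_one]
    simp

/-- The Fourier expansion of the basis state that holds the element number `e % r` of the cycle. -/
theorem sum_single_rootExp {r : ℕ} (hr : r ≠ 0) (F : ℕ → Finset ℕ) (e : ℕ) (γ : ℂ) :
    ∑ s ∈ Finset.range r, ∑ h ∈ Finset.range r,
      (Finsupp.single (F h) (γ * rootExp r ^ (s * e) * (rootExp r ^ (s * h))⁻¹ / r) : QState) =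
      Finsupp.single (F (e % r)) γ := by
  rw [Finset.sum_comm]
  have hr' : (r : ℂ) ≠ 0 := by exact_mod_cast hr
  have inner : ∀ h ∈ Finset.range r, ∑ s ∈ Finset.range r,
      (Finsupp.single (F h) (γ * rootExp r ^ (s * e) * (rootExp r ^ (s * h))⁻¹ / r) : QState) =
      if h = e % r then Finsupp.single (F h) γ else 0 := by
    intro h hh
    rw [← Finsupp.single_finsetSum]
    have : ∑ s ∈ Finset.range r, γ * rootExp r ^ (s * e) * (rootExp r ^ (s * h))⁻¹ / r =
        γ / r * ∑ s ∈ Finset.range r, rootExp r ^ (s * e) * (rootExp r ^ (s * h))⁻¹ := by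
      rw [Finset.mul_sum]
      exact Finset.sum_congr rfl fun s _ => by ring
    rw [this, sum_rootExp hr e h (Finset.mem_range.1 hh)]
    split_ifs
    · rw [div_mul_cancel₀ _ hr']
    · simp
  rw [Finset.sum_congr rfl inner, Finset.sum_ite_eq' (Finset.range r) (e % r),
    if_pos (Finset.mem_range.2 (Nat.mod_lt _ (Nat.pos_of_ne_zero hr)))]

/-- Parseval's identity: the eigenstates are orthogonal. -/
theorem parseval_rootExp {r : ℕ} (hr : r ≠ 0) (β : ℕ → ℂ) :
    ∑ h ∈ Finset.range r, ‖∑ s ∈ Finset.range r, β s * (rootExp r ^ (s * h))⁻¹ / r‖ ^ 2 =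
      (∑ s ∈ Finset.range r, ‖β s‖ ^ 2) / r := by
  have hr' : (r : ℂ) ≠ 0 := by exact_mod_cast hr
  have hconj : ∀ k, (starRingEnd ℂ) ((rootExp r ^ k)⁻¹) = rootExp r ^ k := by
    intro k
    rw [map_inv₀, map_pow, ← Complex.inv_eq_conj (norm_rootExp r), inv_pow, inv_inv]
  apply Complex.ofReal_injective
  push_cast
  have sq : ∀ z : ℂ, (‖z‖ : ℂ) ^ 2 = z * (starRingEnd ℂ) z := fun z => (Complex.mul_conj' z).symm
  simp only [sq, map_sum, map_div₀, map_mul, hconj, Finset.sum_mul_sum, Complex.conj_natCast]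
  rw [Finset.sum_comm, Finset.sum_div]
  refine Finset.sum_congr rfl fun s hs => ?_
  rw [Finset.sum_comm]
  have inner : ∀ s' ∈ Finset.range r, ∑ h ∈ Finset.range r, β s * (rootExp r ^ (s * h))⁻¹ / r *
      ((starRingEnd ℂ) (β s') * rootExp r ^ (s' * h) / r) =
      if s' = s then β s * (starRingEnd ℂ) (β s) / r else 0 := by
    intro s' hs'
    have : ∀ h, β s * (rootExp r ^ (s * h))⁻¹ / r *
        ((starRingEnd ℂ) (β s') * rootExp r ^ (s' * h) / r) = β s * (starRingEnd ℂ) (β s') / r / r *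
          (rootExp r ^ (h * s') * (rootExp r ^ (h * s))⁻¹) := by
      intro h
      rw [mul_comm s h, mul_comm s' h]
      ring
    simp only [this]
    rw [← Finset.mul_sum, sum_rootExp hr s' s (Finset.mem_range.1 hs),
      Nat.mod_eq_of_lt (Finset.mem_range.1 hs')]
    by_cases h : s' = s
    · subst h
      simp only [if_true]
      field_simp
    · simp [h, Ne.symm h]
  rw [Finset.sum_congr rfl inner, Finset.sum_ite_eq' (Finset.range r) s, if_pos hs]

theorem QState.weight_sum_single {ι : Type*} (t : Finset ι) (F : ι → Finset ℕ)
    (hF : Set.InjOn F t) (γ : ι → ℂ) :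
    QState.weight (∑ h ∈ t, Finsupp.single (F h) (γ h)) = ∑ h ∈ t, ‖γ h‖ ^ 2 := by
  classical
  induction t using Finset.induction_on with
  | empty => simp [QState.weight]
  | insert a t ha ih =>
    rw [Finset.sum_insert ha, Finset.sum_insert ha, ← ih (hF.mono (by simp)),
      ← QState.weight_single (F a) (γ a), QState.weight,
      Finsupp.sum_add_index_of_disjoint]
    · rfl
    · rw [Finset.disjoint_left]
      intro s hs hs'
      have h1 := Finset.mem_singleton.1 (Finsupp.support_single_subset hs)
      obtain ⟨b, hb, hsb⟩ := Finset.mem_biUnion.1 (Finsupp.support_finsetSum hs')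
      have h2 := Finset.mem_singleton.1 (Finsupp.support_single_subset hsb)
      have := hF (Finset.mem_insert_self a t) (Finset.mem_insert_of_mem hb) (h1.symm.trans h2)
      exact ha (this ▸ hb)

/-- The state in which `i` control qubits remain to be measured. It is a superposition of `r`
eigenstates with the amplitudes `β`; the eigenstate number `s` is the product of the superpositions
of `0` and of `1` with the phase `ω ^ (s * w)` for each control qubit, where `w` is the weight of
the qubit in `e`, and of a Fourier state of the output block. Here `E h u` is the basis state in
which the output block holds the element number `h` of the cycle and all else is as in `u`. -/
noncomputable def eigenState (r : ℕ) (E : ℕ → Finset ℕ → Finset ℕ) (e : Finset ℕ → ℕ) (X i : ℕ)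
    (β : ℕ → ℂ) (σ : Finset ℕ) : QState :=
  ∑ c ∈ (Finset.Ico X (X + i)).powerset, ∑ s ∈ Finset.range r, ∑ h ∈ Finset.range r,
    Finsupp.single (E h (σ ∪ c))
      (hadCoeff ^ i * β s * rootExp r ^ (s * e c) * (rootExp r ^ (s * h))⁻¹ / r)

/-- With equal amplitudes, `eigenState` is the state after the exponentiation circuit. -/
theorem eigenState_const {r : ℕ} (hr : r ≠ 0) (E : ℕ → Finset ℕ → Finset ℕ) (e : Finset ℕ → ℕ)
    (X i : ℕ) (α : ℂ) (σ : Finset ℕ) :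
    eigenState r E e X i (fun _ => α) σ = ∑ c ∈ (Finset.Ico X (X + i)).powerset,
      Finsupp.single (E (e c % r) (σ ∪ c)) (α * hadCoeff ^ i) := by
  refine Finset.sum_congr rfl fun c _ => ?_
  rw [sum_single_rootExp hr (fun h => E h (σ ∪ c)) (e c), mul_comm]

theorem eigenState_zero (r : ℕ) (E : ℕ → Finset ℕ → Finset ℕ) {e : Finset ℕ → ℕ} (he : e ∅ = 0)
    (X : ℕ) (β : ℕ → ℂ) (σ : Finset ℕ) :
    eigenState r E e X 0 β σ = ∑ h ∈ Finset.range r, Finsupp.single (E h σ)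
      (∑ s ∈ Finset.range r, β s * (rootExp r ^ (s * h))⁻¹ / r) := by
  simp only [eigenState, add_zero, Finset.Ico_self, Finset.powerset_empty, Finset.sum_singleton,
    Finset.union_empty, he, mul_zero, pow_zero, one_mul, mul_one]
  rw [Finset.sum_comm]
  exact Finset.sum_congr rfl fun h _ => (Finsupp.single_finsetSum _ _ _).symm

theorem weight_eigenState_zero {r : ℕ} (hr : r ≠ 0) {E : ℕ → Finset ℕ → Finset ℕ}
    {e : Finset ℕ → ℕ} (he : e ∅ = 0) (X : ℕ) (β : ℕ → ℂ) (σ : Finset ℕ)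
    (hE : ∀ h < r, ∀ h' < r, E h σ = E h' σ → h = h') :
    (eigenState r E e X 0 β σ).weight = (∑ s ∈ Finset.range r, ‖β s‖ ^ 2) / r := by
  rw [eigenState_zero r E he, QState.weight_sum_single, parseval_rootExp hr]
  intro h hh h' hh'
  exact hE h (by simpa using hh) h' (by simpa using hh')

/-! ### Measurement of a control qubit -/

/-- The phase gate with the phase `z` at qubit `q`. -/
noncomputable def phaseOp (q : ℕ) (z : ℂ) (s : Finset ℕ) : QState :=
  Finsupp.single s (if q ∈ s then z else 1)

theorem apply_phaseOp_phaseOp (q : ℕ) (z w : ℂ) (ψ : QState) :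
    QState.apply (phaseOp q z) (QState.apply (phaseOp q w) ψ) =
      QState.apply (phaseOp q (w * z)) ψ := by
  induction ψ using Finsupp.induction_linear with
  | zero => simp [QState.apply]
  | add φ ψ hφ hψ => simp only [QState.apply_add, hφ, hψ]
  | single s α =>
    simp only [QState.apply_single, phaseOp, Finsupp.smul_single, smul_eq_mul]
    split_ifs <;> simp only [mul_assoc, mul_one]

theorem apply_phaseOp_one (q : ℕ) (ψ : QState) : QState.apply (phaseOp q 1) ψ = ψ := by
  simp [QState.apply, phaseOp, Finsupp.linearCombination_apply]

/-- The outcome `b` of the measurement of qubit `q` in the Hadamard basis, after the phase `z`. -/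
noncomputable def voteMap (q : ℕ) (b : Bool) (z : ℂ) (ψ : QState) : QState :=
  QState.project q b (QState.apply ((Gate.had 0).onBasis fun _ => q) (QState.apply (phaseOp q z) ψ))

theorem voteMap_sum {ι : Type*} (q : ℕ) (b : Bool) (z : ℂ) (t : Finset ι) (φ : ι → QState) :
    voteMap q b z (∑ j ∈ t, φ j) = ∑ j ∈ t, voteMap q b z (φ j) := by
  simp only [voteMap, QState.apply_sum, QState.project_sum]

theorem voteMap_single {q : ℕ} {s : Finset ℕ} (h : q ∉ s) (b : Bool) (z α : ℂ) :
    voteMap q b z (Finsupp.single s α) =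
      Finsupp.single (if b then insert q s else s) (α * hadCoeff) := by
  rw [voteMap, QState.apply_single, phaseOp, if_neg h, Finsupp.smul_single, smul_eq_mul, mul_one,
    apply_had_of_notMem (ρ := fun _ => q) (x := 0) h, QState.project_add, QState.project_single,
    QState.project_single]
  cases b <;> simp [h]

theorem voteMap_insert {q : ℕ} {s : Finset ℕ} (h : q ∉ s) (b : Bool) (z α : ℂ) :
    voteMap q b z (Finsupp.single (insert q s) α) =
      Finsupp.single (if b then insert q s else s)
        (if b then -(α * z * hadCoeff) else α * z * hadCoeff) := by
  rw [voteMap, QState.apply_single, phaseOp, if_pos (Finset.mem_insert_self q s),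
    Finsupp.smul_single, smul_eq_mul,
    apply_had_insert (ρ := fun _ => q) (x := 0) h, QState.project_add, QState.project_single,
    QState.project_single]
  cases b <;> simp [h]

/-- The amplitudes after the outcome `b`, if the eigenstate number `s` has the phase `ζ s`. -/
noncomputable def voteAmp (b : Bool) (ζ β : ℕ → ℂ) (s : ℕ) : ℂ :=
  β s * (1 + (if b then -1 else 1) * ζ s) / 2

/-- The measurement of a control qubit acts separately on the eigenstates: it multiplies their
amplitudes, since the qubit is not entangled with anything else in any of them. -/
theorem voteMap_eigenState {r : ℕ} {E : ℕ → Finset ℕ → Finset ℕ} {e : Finset ℕ → ℕ} {X i w : ℕ}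
    {β : ℕ → ℂ} {σ : Finset ℕ} (b : Bool) (z : ℂ) (hσ : X + i ∉ σ)
    (hE : ∀ h u, X + i ∉ u → X + i ∉ E h u)
    (hE' : ∀ h u, X + i ∉ u → E h (insert (X + i) u) = insert (X + i) (E h u))
    (he : ∀ c, X + i ∉ c → e (insert (X + i) c) = e c + w) :
    voteMap (X + i) b z (eigenState r E e X (i + 1) β σ) =
      eigenState r E e X i (voteAmp b (fun s => rootExp r ^ (s * w) * z) β)
        (if b then insert (X + i) σ else σ) := by
  simp only [eigenState]
  rw [voteMap_sum, sum_powerset_Ico_succ]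
  refine Finset.sum_congr rfl fun c hc => ?_
  have hc' := notMem_of_mem_powerset_Ico hc
  have hu : X + i ∉ σ ∪ c := by simp [hσ, hc']
  simp only [voteMap_sum]
  rw [← Finset.sum_add_distrib]
  refine Finset.sum_congr rfl fun s _ => ?_
  rw [← Finset.sum_add_distrib]
  refine Finset.sum_congr rfl fun h _ => ?_
  rw [Finset.union_insert, hE' h _ hu, voteMap_single (hE h _ hu), voteMap_insert (hE h _ hu),
    ← Finsupp.single_add, he c hc']
  congr 1
  · cases b
    · rfl
    · simp only [if_true]
      rw [← hE' h _ hu, Finset.insert_union]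
  · have h2 := hadCoeff_mul_self
    have e1 : hadCoeff ^ (i + 1) * hadCoeff = hadCoeff ^ i / 2 := by
      rw [pow_succ, mul_assoc, h2]; ring
    have e2 : rootExp r ^ (s * (e c + w)) = rootExp r ^ (s * e c) * rootExp r ^ (s * w) := by
      rw [mul_add, pow_add]
    rw [e2]
    cases b <;> simp only [voteAmp, if_true, Bool.false_eq_true, if_false]
    · linear_combination (β s * rootExp r ^ (s * e c) * (rootExp r ^ (s * h))⁻¹ / r *
        (1 + rootExp r ^ (s * w) * z)) * e1
    · linear_combination (β s * rootExp r ^ (s * e c) * (rootExp r ^ (s * h))⁻¹ / r *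
        (1 - rootExp r ^ (s * w) * z)) * e1

theorem norm_one_add_exp_sq (x : ℝ) :
    ‖(1 + Complex.exp (-(2 * Real.pi * x * Complex.I)) : ℂ)‖ ^ 2 / 4 =
      (1 + Real.cos (2 * Real.pi * x)) / 2 ∧
    ‖(1 - Complex.exp (-(2 * Real.pi * x * Complex.I)) : ℂ)‖ ^ 2 / 4 =
      (1 - Real.cos (2 * Real.pi * x)) / 2 := by
  have e : Complex.exp (-(2 * Real.pi * x * Complex.I)) =
      ⟨Real.cos (2 * Real.pi * x), -Real.sin (2 * Real.pi * x)⟩ := by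
    have : (-(2 * Real.pi * x * Complex.I) : ℂ) = ((-(2 * Real.pi * x) : ℝ) : ℂ) * Complex.I := by
      push_cast; ring
    rw [this]
    apply Complex.ext
    · rw [Complex.exp_ofReal_mul_I_re, Real.cos_neg]
    · rw [Complex.exp_ofReal_mul_I_im, Real.sin_neg]
  have h := Real.sin_sq_add_cos_sq (2 * Real.pi * x)
  rw [e, ← Complex.normSq_eq_norm_sq, ← Complex.normSq_eq_norm_sq, Complex.normSq_apply,
    Complex.normSq_apply]
  simp
  constructor <;> nlinarith

/-- The phase of the T gate. -/
noncomputable def eighth : ℂ := Complex.exp (Real.pi * Complex.I / 4)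

/-- The registers after a vote with the outcome `b`. -/
def voteReg (b : ℕ) (ρ : ℕ → ℕ) : ℕ → ℕ :=
  Function.update (Function.update (Function.update ρ 11 (ρ 11 - 1)) 24 b) 23 (ρ 23 + b)

theorem wp_turn (Φ : (ℕ → ℕ) → QState → ℝ) (ρ : ℕ → ℕ) (ψ : QState) (x : ℕ) :
    (Prog.ifLe x 22 (.gate (.phaseT 11)) .skip).wp f Φ ρ ψ =
      Φ ρ (QState.apply (phaseOp (ρ 11) (if ρ x ≤ ρ 22 then eighth else 1)) ψ) := by
  simp only [Prog.wp]
  split_ifs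
  · rfl
  · rw [apply_phaseOp_one]

theorem wp_voteProg {Φ : (ℕ → ℕ) → QState → ℝ} {ρ : ℕ → ℕ} {ψ : QState} (h7 : ρ 7 = 1)
    (h8 : ρ 8 = 2) (h41 : ρ 41 = 3) (h42 : ρ 42 = 4) (h22 : ρ 22 ≤ 4) :
    voteProg.wp f Φ ρ ψ =
      Φ (voteReg 0 ρ) (voteMap (ρ 11 - 1) false (eighth ^ ρ 22) ψ) +
        Φ (voteReg 1 ρ) (voteMap (ρ 11 - 1) true (eighth ^ ρ 22) ψ) := by
  have e : ∀ (c d : Prog) (Φ : (ℕ → ℕ) → QState → ℝ) (ρ : ℕ → ℕ) (ψ : QState),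
      (c ;; d).wp f Φ ρ ψ = c.wp f (d.wp f Φ) ρ ψ := fun _ _ _ _ _ => rfl
  have e' : ∀ (o : ArithOp) (x y z : ℕ) (Φ : (ℕ → ℕ) → QState → ℝ) (ρ : ℕ → ℕ) (ψ : QState),
      (Prog.arith o x y z).wp f Φ ρ ψ = Φ (Function.update ρ x (o.eval (ρ y) (ρ z))) ψ :=
    fun _ _ _ _ _ _ _ => rfl
  simp only [voteProg, e, dec, inc, e', wp_turn, apply_phaseOp_phaseOp, ArithOp.eval, h7]
  simp only [Function.update_self, ne_eq, not_false_eq_true,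
    Function.update_of_ne, Nat.reduceEqDiff, h7, h8, h41, h42]
  have hz : ((((if 1 ≤ ρ 22 then eighth else 1) * if 2 ≤ ρ 22 then eighth else 1) *
      if 3 ≤ ρ 22 then eighth else 1) * if 4 ≤ ρ 22 then eighth else 1) = eighth ^ ρ 22 := by
    generalize ρ 22 = k at h22
    interval_cases k <;> simp <;> ring
  rw [hz]
  rfl

end

section

variable {n : ℕ} {f : Bits n → Bits n → Bits n}

/-! ### Estimation of the phase -/

theorem Prog.wp_seq (c d : Prog) (Φ : (ℕ → ℕ) → QState → ℝ) (ρ : ℕ → ℕ) (ψ : QState) :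
    (c ;; d).wp f Φ ρ ψ = c.wp f (d.wp f Φ) ρ ψ := rfl

theorem Prog.wp_arith (o : ArithOp) (x y z : ℕ) (Φ : (ℕ → ℕ) → QState → ℝ) (ρ : ℕ → ℕ)
    (ψ : QState) : (Prog.arith o x y z).wp f Φ ρ ψ =
      Φ (Function.update ρ x (o.eval (ρ y) (ρ z))) ψ := rfl

theorem Prog.wp_ifLe (x y : ℕ) (c d : Prog) (Φ : (ℕ → ℕ) → QState → ℝ) (ρ : ℕ → ℕ)
    (ψ : QState) : (Prog.ifLe x y c d).wp f Φ ρ ψ =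
      if ρ x ≤ ρ y then c.wp f Φ ρ ψ else d.wp f Φ ρ ψ := rfl

theorem Prog.wp_skip (Φ : (ℕ → ℕ) → QState → ℝ) (ρ : ℕ → ℕ) (ψ : QState) :
    Prog.skip.wp f Φ ρ ψ = Φ ρ ψ := rfl

theorem Prog.wp_loop (x : ℕ) (c : Prog) (Φ : (ℕ → ℕ) → QState → ℝ) (ρ : ℕ → ℕ)
    (ψ : QState) : (Prog.loop x c).wp f Φ ρ ψ = (c.wp f)^[ρ x] Φ ρ ψ := rfl

/-- The registers hold the constants that the voting program uses. -/
structure VoteConstants (ρ : ℕ → ℕ) : Prop where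
  r6 : ρ 6 = 0
  r7 : ρ 7 = 1
  r8 : ρ 8 = 2
  r41 : ρ 41 = 3
  r42 : ρ 42 = 4

theorem VoteConstants.congr {ρ ρ' : ℕ → ℕ} (h : VoteConstants ρ)
    (e : ∀ x ∈ [6, 7, 8, 41, 42], ρ' x = ρ x) : VoteConstants ρ' where
  r6 := (e 6 (by decide)).trans h.r6
  r7 := (e 7 (by decide)).trans h.r7
  r8 := (e 8 (by decide)).trans h.r8
  r41 := (e 41 (by decide)).trans h.r41
  r42 := (e 42 (by decide)).trans h.r42

/-- The basis state `σ` agrees with `σ₀` except for the control qubits that have been measured; the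
first `i` of the `Q` control qubits are still `0` in it. -/
def Remaining (X Q i : ℕ) (σ₀ σ : Finset ℕ) : Prop :=
  (∀ q, (q < X ∨ X + Q ≤ q) → (q ∈ σ ↔ q ∈ σ₀)) ∧ ∀ q, X ≤ q → q < X + i → q ∉ σ

theorem Remaining.measured {X Q i : ℕ} {σ₀ σ : Finset ℕ} (h : Remaining X Q (i + 1) σ₀ σ)
    (hi : i < Q) (b : Bool) :
    Remaining X Q i σ₀ (if b then insert (X + i) σ else σ) := by
  cases b
  · exact ⟨h.1, fun q h1 h2 => h.2 q h1 (by omega)⟩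
  · refine ⟨fun q hq => ?_, fun q h1 h2 => ?_⟩
    · have : q ≠ X + i := by omega
      simp [this, h.1 q hq]
    · have : q ≠ X + i := by omega
      simp [this, h.2 q h1 (by omega)]

/-- The map `E` leaves the `Q` control qubits from `X` on alone. -/
def FixesControls (X Q : ℕ) (E : ℕ → Finset ℕ → Finset ℕ) : Prop :=
  ∀ i < Q, ∀ h u, X + i ∉ u → X + i ∉ E h u ∧ E h (insert (X + i) u) = insert (X + i) (E h u)

theorem controlSum_insert {K X i : ℕ} {c : Finset ℕ} (h : X + i ∉ c) :
    controlSum K X (insert (X + i) c) = controlSum K X c + 2 ^ (i / K) := by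
  rw [controlSum, Finset.sum_insert h, Nat.add_sub_cancel_left, add_comm]
  rfl

theorem rootExp_mul_eighth (r s w k : ℕ) :
    rootExp r ^ (s * w) * eighth ^ k =
      Complex.exp (-(2 * Real.pi * (w * (s / r) - k / 8 : ℝ) * Complex.I)) := by
  rw [rootExp, eighth, ← Complex.exp_neg, ← Complex.exp_nat_mul, ← Complex.exp_nat_mul,
    ← Complex.exp_add]
  congr 1
  push_cast
  ring

theorem norm_voteAmp_sq {r : ℕ} (β : ℕ → ℂ) (s g A P : ℕ) :
    ‖voteAmp false (fun s => rootExp r ^ (s * 2 ^ g) * eighth ^ ((8 * A + P) / (2 * P))) β s‖ ^ 2 =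
      ‖β s‖ ^ 2 * voteProb (s / r) g A P ∧
    ‖voteAmp true (fun s => rootExp r ^ (s * 2 ^ g) * eighth ^ ((8 * A + P) / (2 * P))) β s‖ ^ 2 =
      ‖β s‖ ^ 2 * (1 - voteProb (s / r) g A P) := by
  obtain ⟨h1, h2⟩ := norm_one_add_exp_sq (2 ^ g * (s / r) - ((8 * A + P) / (2 * P) : ℕ) / 8)
  have e := rootExp_mul_eighth r s (2 ^ g) ((8 * A + P) / (2 * P))
  push_cast at e h1 h2
  have n2 : ‖(2 : ℂ)‖ = 2 := by norm_num
  simp only [voteAmp, voteProb, e, Bool.false_eq_true, if_false, if_true, one_mul, neg_one_mul,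
    ← sub_eq_add_neg, norm_div, norm_mul, n2, div_pow, mul_pow]
  constructor
  · rw [← h1]; ring
  · rw [show ∀ x : ℝ, 1 - (1 + x) / 2 = (1 - x) / 2 by intro x; ring, ← h2]; ring

/-- The expected value after `c` votes with the same weight `2 ^ g` and the same rotation, when
`v s m` is the expected value that follows for the eigenvalue number `s` after `m` outcomes `1`. -/
theorem vote_iterate {r J K X g A P : ℕ} {E : ℕ → Finset ℕ → Finset ℕ} {σ₀ : Finset ℕ}
    (hE : FixesControls X (J * K) E) (hg : g < J) (hk : (8 * A + P) / (2 * P) ≤ 4)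
    (v : ℕ → ℕ → ℝ) {Φ : (ℕ → ℕ) → QState → ℝ} (c : ℕ) (hc : c ≤ K) {ρ : ℕ → ℕ} (m : ℕ)
    {β : ℕ → ℂ} {σ : Finset ℕ} (hρ : VoteConstants ρ) (h22 : ρ 22 = (8 * A + P) / (2 * P))
    (h11 : ρ 11 = X + (g * K + c)) (h23 : ρ 23 = m) (hσ : Remaining X (J * K) (g * K + c) σ₀ σ)
    (hΦ : ∀ ρ' m' β' σ', ρ' 11 = X + g * K → ρ' 23 = m' →
      (∀ x ∉ [11, 23, 24], ρ' x = ρ x) → Remaining X (J * K) (g * K) σ₀ σ' →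
      (∑ s ∈ Finset.range r, ‖β' s‖ ^ 2 * v s m') / r ≤
        Φ ρ' (eigenState r E (controlSum K X) X (g * K) β' σ')) :
    (∑ s ∈ Finset.range r, ‖β s‖ ^ 2 * voteVal (voteProb (s / r) g A P) (v s) c m) / r ≤
      (voteProg.wp f)^[c] Φ ρ (eigenState r E (controlSum K X) X (g * K + c) β σ) := by
  induction c generalizing ρ m β σ with
  | zero => exact hΦ _ _ _ _ h11 h23 (fun _ _ => rfl) hσ
  | succ c ih =>
    have hi := index_lt hg (show c < K from hc)
    have hq : X + (g * K + c) ∉ σ := hσ.2 _ (by omega) (by omega)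
    rw [Function.iterate_succ_apply', wp_voteProg hρ.r7 hρ.r8 hρ.r41 hρ.r42 (h22 ▸ hk), h11, h22]
    have hsub : X + (g * K + (c + 1)) - 1 = X + (g * K + c) := by omega
    have hst : ∀ b, voteMap (X + (g * K + c)) b (eighth ^ ((8 * A + P) / (2 * P)))
        (eigenState r E (controlSum K X) X (g * K + (c + 1)) β σ) = _ := fun b =>
      voteMap_eigenState (i := g * K + c) (w := 2 ^ g) b _ hq
        (fun h u hu => (hE _ hi h u hu).1) (fun h u hu => (hE _ hi h u hu).2)
        (fun c' hc' => by rw [controlSum_insert hc', index_div hc])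
    rw [hsub, hst, hst]
    have step : ∀ b : Bool, (∑ s ∈ Finset.range r,
        ‖voteAmp b (fun s => rootExp r ^ (s * 2 ^ g) * eighth ^ ((8 * A + P) / (2 * P))) β s‖ ^ 2 *
          voteVal (voteProb (s / r) g A P) (v s) c (m + b.toNat)) / r ≤
        (voteProg.wp f)^[c] Φ (voteReg b.toNat ρ) (eigenState r E (controlSum K X) X (g * K + c)
          (voteAmp b (fun s => rootExp r ^ (s * 2 ^ g) * eighth ^ ((8 * A + P) / (2 * P))) β)
          (if b then insert (X + (g * K + c)) σ else σ)) := by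
      intro b
      have fr : ∀ x ∉ [11, 23, 24], voteReg b.toNat ρ x = ρ x := by
        intro x hx
        simp only [List.mem_cons, List.not_mem_nil, or_false, not_or] at hx
        simp [voteReg, hx]
      refine ih (by omega) _ (hρ.congr fun x hx => fr x (by revert x; decide))
        ((fr 22 (by decide)).trans h22) (by simp [voteReg, h11]; omega) (by simp [voteReg, h23])
        (Remaining.measured hσ hi b) ?_
      intro ρ' m' β' σ' g1 g2 g3 g4
      exact hΦ ρ' m' β' σ' g1 g2 (fun x hx => (g3 x hx).trans (fr x hx)) g4
    refine le_trans (le_of_eq ?_) (add_le_add (step false) (step true))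
    rw [← add_div, ← Finset.sum_add_distrib]
    congr 1
    refine Finset.sum_congr rfl fun s _ => ?_
    obtain ⟨e1, e2⟩ := norm_voteAmp_sq (r := r) β s g A P
    rw [e1, e2]
    simp only [voteVal, Bool.toNat_false, Bool.toNat_true, add_zero]
    ring

theorem rounded_le_four {A P : ℕ} (h : A < P) : (8 * A + P) / (2 * P) ≤ 4 := by
  rw [← Nat.lt_succ_iff, Nat.div_lt_iff_lt_mul (by omega)]
  omega

/-- The expected value after the last `g` digits of the phase have been found. -/
theorem digit_iterate {r J K X : ℕ} {E : ℕ → Finset ℕ → Finset ℕ} {σ₀ : Finset ℕ}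
    (hE : FixesControls X (J * K) E) (V : ℕ → ℝ) {Φ : (ℕ → ℕ) → QState → ℝ} (g : ℕ) (hg : g ≤ J)
    {ρ : ℕ → ℕ} (A P : ℕ) {β : ℕ → ℂ} {σ : Finset ℕ} (hρ : VoteConstants ρ) (h3 : ρ 3 = K)
    (h11 : ρ 11 = X + g * K) (h20 : ρ 20 = A) (h21 : ρ 21 = P) (hAP : A < P)
    (hσ : Remaining X (J * K) (g * K) σ₀ σ)
    (hΦ : ∀ ρ' A' β' σ', ρ' 20 = A' → ρ' 21 = P * 2 ^ g → A' < P * 2 ^ g →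
      (∀ x ∉ digitProg.writes, ρ' x = ρ x) → Remaining X (J * K) 0 σ₀ σ' →
      (∑ s ∈ Finset.range r, ‖β' s‖ ^ 2 * V A') / r ≤
        Φ ρ' (eigenState r E (controlSum K X) X 0 β' σ')) :
    (∑ s ∈ Finset.range r, ‖β s‖ ^ 2 * digitVal K (s / r) V g A P) / r ≤
      (digitProg.wp f)^[g] Φ ρ (eigenState r E (controlSum K X) X (g * K) β σ) := by
  induction g generalizing ρ A P β σ with
  | zero =>
    rw [Nat.zero_mul] at *
    exact hΦ _ _ _ _ h20 (by simpa using h21) (by simpa using hAP) (fun _ _ => rfl) hσ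
  | succ g ih =>
    rw [Function.iterate_succ_apply']
    simp only [digitProg, roundProg, mov, inc, Prog.wp_seq, Prog.wp_arith, ArithOp.eval]
    set ρ₁ : ℕ → ℕ := Function.update _ 23 _ with hρ₁
    have f22 : ρ₁ 22 = (8 * A + P) / (2 * P) := by
      simp [hρ₁, h20, h21]
      congr 1 <;> ring
    have f23 : ρ₁ 23 = 0 := by simp [hρ₁, hρ.r6]
    have fr : ∀ x ∉ [22, 23, 25], ρ₁ x = ρ x := by
      intro x hx
      simp only [List.mem_cons, List.not_mem_nil, or_false, not_or] at hx
      simp [hρ₁, hx]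
    clear_value ρ₁
    have f3 := (fr 3 (by decide)).trans h3
    rw [Prog.wp_loop, f3]
    have := vote_iterate (f := f) (r := r) (σ₀ := σ₀) (σ := σ) (β := β) hE hg
      (rounded_le_four hAP)
      (fun s m => digitVal K (s / r) V g (if K ≤ 2 * m then A + P else A) (P + P))
      (Φ := Prog.wp f (Prog.arith ArithOp.add 25 23 23 ;;
        Prog.ifLe 3 25 (Prog.arith ArithOp.add 20 20 21) Prog.skip ;;
          Prog.arith ArithOp.add 21 21 21) ((digitProg.wp f)^[g] Φ))
      K le_rfl 0 (ρ := ρ₁) (hρ.congr fun x hx => fr x (by revert x; decide)) f22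
      ((fr 11 (by decide)).trans (by rw [h11]; ring)) f23
      (by rw [Nat.succ_mul] at hσ; exact hσ) ?_
    · rw [Nat.succ_mul]
      exact this
    intro ρ₂ m β' σ' e11 e23 e hσ'
    have q : ∀ x ∉ [11, 22, 23, 24, 25], ρ₂ x = ρ x := by
      intro x hx
      simp only [List.mem_cons, List.not_mem_nil, or_false, not_or] at hx
      exact (e x (by simp [hx])).trans (fr x (by simp [hx]))
    have q3 := (q 3 (by decide)).trans h3
    have q20 := (q 20 (by decide)).trans h20
    have q21 := (q 21 (by decide)).trans h21
    simp only [Prog.wp_seq, Prog.wp_arith, Prog.wp_ifLe, Prog.wp_skip, ArithOp.eval]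
    have next : ∀ (ρ₃ : ℕ → ℕ) (A' : ℕ), ρ₃ 20 = A' → ρ₃ 21 = P + P → A' < P + P →
        (∀ x ∉ [11, 20, 21, 22, 23, 24, 25], ρ₃ x = ρ x) → ρ₃ 11 = ρ₂ 11 →
        (∑ s ∈ Finset.range r, ‖β' s‖ ^ 2 * digitVal K (s / r) V g A' (P + P)) / r ≤
          (digitProg.wp f)^[g] Φ ρ₃ (eigenState r E (controlSum K X) X (g * K) β' σ') := by
      intro ρ₃ A' h20' h21' hA' fr' h11'
      refine ih (by omega) A' (P + P) (hρ.congr fun x hx => fr' x (by revert x; decide))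
        ((fr' 3 (by decide)).trans h3) (h11'.trans e11) h20' h21' hA' hσ' ?_
      intro ρ' A'' β'' σ'' k1 k2 k3 k4 k5
      have e2 : (P + P) * 2 ^ g = P * 2 ^ (g + 1) := by ring
      rw [e2] at k2 k3
      refine hΦ ρ' A'' β'' σ'' k1 k2 k3 (fun x hx => (k4 x hx).trans (fr' x ?_)) k5
      exact fun h => hx ((by decide : ∀ y ∈ [11, 20, 21, 22, 23, 24, 25], y ∈ digitProg.writes) x h)
    have hm : (Function.update ρ₂ 25 (ρ₂ 23 + ρ₂ 23) 3 ≤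
        Function.update ρ₂ 25 (ρ₂ 23 + ρ₂ 23) 25) = (K ≤ 2 * m) := by
      simp [q3, e23, two_mul]
    simp only [hm]
    split_ifs with hKm
    · refine next _ _ (by simp [q20, q21]) (by simp [q21]) (by omega) ?_ (by simp)
      intro x hx
      simp only [List.mem_cons, List.not_mem_nil, or_false, not_or] at hx
      simp [hx, q]
    · refine next _ _ (by simp [q20]) (by simp [q21]) (by omega) ?_ (by simp)
      intro x hx
      simp only [List.mem_cons, List.not_mem_nil, or_false, not_or] at hx
      simp [hx, q]

/-- The expected value after the estimation of the phase is the average over the eigenvalues of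
the expected values for each of them. -/
theorem phaseProg_wp {r J K X O : ℕ} {E : ℕ → Finset ℕ → Finset ℕ} {σ : Finset ℕ} {α : ℂ}
    (hE : FixesControls X (J * K) E) (V : ℕ → ℝ) {Φ : (ℕ → ℕ) → QState → ℝ}
    {ρ : ℕ → ℕ} (hρ : VoteConstants ρ) (h2 : ρ 2 = J) (h3 : ρ 3 = K)
    (h14 : ρ 14 = X + J * K) (h0 : ρ 33 + ρ 0 = O)
    (hσ : ∀ q ∈ σ, q < X ∨ X + J * K ≤ q)
    (hΦ : ∀ ρ' A β' σ', ρ' 20 = A → ρ' 21 = 2 ^ J → A < 2 ^ J → ρ' 9 = O →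
      (∀ x ∉ 9 :: digitProg.writes, ρ' x = ρ x) → Remaining X (J * K) 0 σ σ' →
      (∑ s ∈ Finset.range r, ‖β' s‖ ^ 2 * V A) / r ≤
        Φ ρ' (eigenState r E (controlSum K X) X 0 β' σ')) :
    (∑ s ∈ Finset.range r, ‖α‖ ^ 2 * digitVal K (s / r) V J 0 1) / r ≤
      phaseProg.wp f Φ ρ (eigenState r E (controlSum K X) X (J * K) (fun _ => α) σ) := by
  simp only [phaseProg, mov, Prog.wp_seq, Prog.wp_arith, Prog.wp_loop, ArithOp.eval]
  set ρ₁ : ℕ → ℕ := Function.update _ 21 _ with hρ₁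
  have fr : ∀ x ∉ 9 :: digitProg.writes, ρ₁ x = ρ x := by
    intro x hx
    have : x ≠ 9 ∧ x ≠ 11 ∧ x ≠ 20 ∧ x ≠ 21 := by
      refine ⟨?_, ?_, ?_, ?_⟩ <;> (rintro rfl; exact hx (by decide))
    simp [hρ₁, this]
  have f11 : ρ₁ 11 = X + J * K := by simp [hρ₁, hρ.r6, h14]
  have f20 : ρ₁ 20 = 0 := by simp [hρ₁, hρ.r6]
  have f21 : ρ₁ 21 = 1 := by simp [hρ₁, hρ.r6, hρ.r7]
  have f9 : ρ₁ 9 = O := by simp [hρ₁, h0]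
  clear_value ρ₁
  rw [(fr 2 (by decide)).trans h2]
  refine digit_iterate hE V J le_rfl 0 1 (hρ.congr fun x hx => fr x (by revert x; decide))
    ((fr 3 (by decide)).trans h3) f11 f20 f21 one_pos (σ₀ := σ)
    ⟨fun _ _ => Iff.rfl, fun q h1 h2 hq => by have := hσ q hq; omega⟩ ?_
  intro ρ' A β' σ' k1 k2 k3 k4 k5
  refine hΦ ρ' A β' σ' k1 (by simpa using k2) (by simpa using k3) ((k4 9 (by decide)).trans f9)
    (fun x hx => (k4 x fun h => hx (List.mem_cons_of_mem _ h)).trans (fr x hx)) k5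

end

section

variable {n : ℕ} {f : Bits n → Bits n → Bits n}

/-! ### Measurement of a block of qubits -/

/-- The measurement of a qubit in a computational basis state has a certain outcome. -/
theorem Det.measure_single {x y : ℕ} {ρ : ℕ → ℕ} {s : Finset ℕ} {α : ℂ}
    {Q : (ℕ → ℕ) → QState → Prop}
    (h : Q (Function.update ρ x (decide (ρ y ∈ s)).toNat) (Finsupp.single s α)) :
    Det f (.measure x y) ρ (Finsupp.single s α) Q := by
  intro Φ v h0 hΦ
  have := hΦ _ _ h
  simp only [Prog.wp, QState.project_single]
  by_cases hs : ρ y ∈ s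
  · simp only [hs, decide_true, Bool.toNat_true] at this ⊢
    simpa using this.trans (le_add_of_nonneg_left (h0 (Function.update ρ x 0) 0))
  · simp only [hs, decide_false, Bool.toNat_false] at this ⊢
    simpa using this.trans (le_add_of_nonneg_right (h0 (Function.update ρ x 1) 0))

theorem QState.mem_support_project {i : ℕ} {b : Bool} {ψ : QState} {s : Finset ℕ}
    (h : s ∈ (ψ.project i b).support) : s ∈ ψ.support ∧ decide (i ∈ s) = b := by
  classical
  simpa [QState.project, Finsupp.support_filter] using h

/-- While the block is measured, the basis states in the support agree on more and more qubits. -/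
theorem measureBlock_iterate {V : ℝ} {Φ : (ℕ → ℕ) → QState → ℝ}
    (h0 : ∀ ρ ψ, 0 ≤ Φ ρ ψ) {O : ℕ} {T : Set (Finset ℕ)} {ρ₀ : ℕ → ℕ} (h7 : ρ₀ 7 = 1)
    (hΦ : ∀ ρ' s α, (∀ x ∉ [17, 24], ρ' x = ρ₀ x) → s ∈ T →
      ‖α‖ ^ 2 * V ≤ Φ ρ' (Finsupp.single s α)) (k : ℕ)
    {i : ℕ} (hi : i + k = n) {ρ : ℕ → ℕ} {ψ : QState} (h17 : ρ 17 = O + i)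
    (hρ : ∀ x ∉ [17, 24], ρ x = ρ₀ x) (hT : ∀ s ∈ ψ.support, s ∈ T)
    (hψ : ∀ s ∈ ψ.support, ∀ s' ∈ ψ.support, ∀ q, (q < O + i ∨ O + n ≤ q) → (q ∈ s ↔ q ∈ s')) :
    ψ.weight * V ≤ ((Prog.measure 24 17 ;; inc 17 7).wp f)^[k] Φ ρ ψ := by
  induction k generalizing i ρ ψ with
  | zero =>
    by_cases hz : ψ = 0
    · simpa [hz, QState.weight] using h0 ρ 0
    · obtain ⟨s, hs⟩ := Finsupp.support_nonempty_iff.2 hz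
      have : ψ = Finsupp.single s (ψ s) := by
        rw [Finsupp.eq_single_iff]
        refine ⟨fun s' hs' => Finset.mem_singleton.2 ?_, rfl⟩
        ext q
        exact hψ s' hs' s hs q (by omega)
      rw [this, QState.weight_single]
      exact hΦ _ _ _ hρ (hT s hs)
  | succ k ih =>
    rw [Function.iterate_succ_apply', ← QState.weight_project_add (O + i) ψ, add_mul]
    simp only [inc, Prog.wp, ArithOp.eval, h17]
    refine add_le_add (ih (i := i + 1) (by omega) ?_ ?_ ?_ ?_)
      (ih (i := i + 1) (by omega) ?_ ?_ ?_ ?_)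
    any_goals
      intro s hs
      exact hT s (QState.mem_support_project hs).1
    any_goals
      intro x hx
      simp only [List.mem_cons, List.not_mem_nil, or_false, not_or] at hx
      simp [hx, hρ]
    any_goals
      intro s hs s' hs' q hq
      obtain ⟨hs, e⟩ := QState.mem_support_project hs
      obtain ⟨hs', e'⟩ := QState.mem_support_project hs'
      by_cases hqi : q = O + i
      · subst hqi
        rw [← e', decide_eq_decide] at e
        exact e
      · exact hψ s hs s' hs' q (by omega)
    all_goals
      have : ρ 7 = 1 := (hρ 7 (by decide)).trans h7
      simp [h17, this]
      omega

/-- The measurement of a block of qubits that carries all the entanglement leaves a computational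
basis state. -/
theorem measureBlockProg_wp {V : ℝ} {Φ : (ℕ → ℕ) → QState → ℝ}
    (h0 : ∀ ρ ψ, 0 ≤ Φ ρ ψ) {T : Set (Finset ℕ)} {ρ : ℕ → ℕ} {ψ : QState}
    (hn : ρ 0 = n) (h6 : ρ 6 = 0) (h7 : ρ 7 = 1)
    (hΦ : ∀ ρ' s α, (∀ x ∉ [17, 24], ρ' x = ρ x) → s ∈ T →
      ‖α‖ ^ 2 * V ≤ Φ ρ' (Finsupp.single s α)) (hT : ∀ s ∈ ψ.support, s ∈ T)
    (hψ : ∀ s ∈ ψ.support, ∀ s' ∈ ψ.support, ∀ q, (q < ρ 33 ∨ ρ 33 + n ≤ q) →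
      (q ∈ s ↔ q ∈ s')) :
    ψ.weight * V ≤ measureBlockProg.wp f Φ ρ ψ := by
  simp only [measureBlockProg, mov, Prog.wp_seq, Prog.wp_arith, Prog.wp_loop, ArithOp.eval]
  have : Function.update ρ 17 (ρ 33 + ρ 6) 0 = n := by simp [hn]
  rw [this]
  refine measureBlock_iterate (i := 0) (O := ρ 33) (ρ₀ := ρ) h0 h7 hΦ n (by omega) (by simp [h6])
    ?_ hT hψ
  intro x hx
  simp only [List.mem_cons, List.not_mem_nil, or_false, not_or] at hx
  simp [hx]

/-! ### Rational reconstruction -/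

/-- One step of the Euclidean algorithm on `(a, b, u, v)`, where `u` and `v` are the absolute values
of cofactors. It is skipped once `b` is at most `B`. -/
def euclidStep (B : ℕ) (x : ℕ × ℕ × ℕ × ℕ) : ℕ × ℕ × ℕ × ℕ :=
  if x.2.1 ≤ B then x
  else (x.2.1, x.1 % x.2.1, x.2.2.2, x.2.2.1 + x.1 / x.2.1 * x.2.2.2)

/-- The denominator of a fraction close to `A / M` that the Euclidean algorithm finds in `E`
steps. -/
def approxDenominator (B M E A : ℕ) : ℕ := ((euclidStep B)^[E] (M, A, 0, 1)).2.2.2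

/-- The invariant of the Euclidean algorithm after `k` steps. -/
structure EuclidInvariant (B M A k : ℕ) (x : ℕ × ℕ × ℕ × ℕ) : Prop where
  lt_fst : B < x.1
  snd_lt : x.2.1 < x.1
  total : x.2.2.2 * x.1 + x.2.2.1 * x.2.1 = M
  small : x.2.1 ≤ B ∨ x.1 * x.2.1 * 2 ^ k ≤ M * M
  cofactors : ∃ w w' ε δ : ℤ, ε ^ 2 = 1 ∧ δ ^ 2 = 1 ∧ ε * x.2.1 = x.2.2.2 * A - w * M ∧
    -(ε * x.1) = x.2.2.1 * A - w' * M ∧ x.2.2.2 * w' - x.2.2.1 * w = δ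

theorem EuclidInvariant.init {B M A : ℕ} (hB : B < M) (hA : A < M) :
    EuclidInvariant B M A 0 (M, A, 0, 1) where
  lt_fst := hB
  snd_lt := hA
  total := by simp
  small := Or.inr (by simpa using Nat.mul_le_mul_left M hA.le)
  cofactors := ⟨0, 1, 1, 1, by norm_num, by norm_num, by simp, by simp, by simp⟩

/-- The product of the two remainders at least halves in every step. -/
theorem EuclidInvariant.step {B M A k : ℕ} {x : ℕ × ℕ × ℕ × ℕ} (h : EuclidInvariant B M A k x) :
    EuclidInvariant B M A (k + 1) (euclidStep B x) := by
  obtain ⟨a, b, u, v⟩ := x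
  obtain ⟨h1, h2, h3, h4, w, w', ε, δ, hε, hδ, e1, e2, e3⟩ := h
  simp only at h1 h2 h3 h4 e1 e2 e3
  by_cases hb : b ≤ B
  · rw [euclidStep, if_pos hb]
    exact ⟨h1, h2, h3, Or.inl hb, w, w', ε, δ, hε, hδ, e1, e2, e3⟩
  · rw [euclidStep, if_neg hb]
    have hb0 : 0 < b := by omega
    have hm : b * (a / b) + a % b = a := Nat.div_add_mod a b
    have hlt := Nat.mod_lt a hb0
    have hq : 1 ≤ a / b := (Nat.one_le_div_iff hb0).2 h2.le
    have hmz : (b : ℤ) * (a / b : ℕ) + (a % b : ℕ) = a := by exact_mod_cast hm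
    refine ⟨not_le.1 hb, hlt, ?_, Or.inr ?_, w' + (a / b : ℕ) * w, w, -ε, -δ, by simpa using hε,
      by simpa using hδ, ?_, ?_, ?_⟩
    · simp only
      have : v * (b * (a / b)) + v * (a % b) = v * a := by rw [← mul_add, hm]
      rw [← h3, ← this]
      ring
    · have h5 := h4.resolve_left hb
      have : 2 * (a % b) ≤ a := by nlinarith
      calc b * (a % b) * 2 ^ (k + 1) = 2 * (a % b) * b * 2 ^ k := by ring
        _ ≤ a * b * 2 ^ k := by gcongr
        _ ≤ M * M := h5
    · simp only
      push_cast at hmz ⊢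
      linear_combination e2 + (a / b : ℤ) * e1 - ε * hmz
    · simp only
      linear_combination e1
    · simp only
      push_cast
      linear_combination -e3

theorem EuclidInvariant.iterate {B M A : ℕ} (hB : B < M) (hA : A < M) (k : ℕ) :
    EuclidInvariant B M A k ((euclidStep B)^[k] (M, A, 0, 1)) := by
  induction k with
  | zero => exact EuclidInvariant.init hB hA
  | succ k ih =>
    rw [Function.iterate_succ_apply']
    exact ih.step

/-- The products in the Euclidean algorithm do not exceed `M`. -/
theorem EuclidInvariant.mul_le {B M A k a b u v : ℕ} (h : EuclidInvariant B M A k (a, b, u, v))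
    (hb : B < b) : a / b * v ≤ M := by
  have h3 := h.total
  simp only at h3
  have := Nat.div_mul_le_self a b
  calc a / b * v ≤ a / b * v * b := Nat.le_mul_of_pos_right _ (by omega)
    _ = v * (a / b * b) := by ring
    _ ≤ v * a := by gcongr
    _ ≤ M := by omega

/-- A fraction `s / r` that is close to `A / M` modulo `1` and whose denominator is small compared
with `M` is found by the Euclidean algorithm. -/
theorem approxDenominator_eq {N M E A s r : ℕ} (hN : 1 ≤ N) (hM : 8 * N ^ 2 ≤ M)
    (hE : M * M < 2 ^ E) (hA : A < M) (hr : 1 ≤ r) (hrN : r ≤ N) {z : ℤ}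
    (hz : |(s / r - A / M - z : ℝ)| ≤ 7 / 12 / M) :
    approxDenominator (2 * N) M E A = r / s.gcd r := by
  have hNM : 2 * N < M := by nlinarith
  have inv := EuclidInvariant.iterate hNM hA E
  rw [approxDenominator]
  generalize (euclidStep (2 * N))^[E] (M, A, 0, 1) = x at inv
  obtain ⟨a, b, u, v⟩ := x
  obtain ⟨h1, h2, h3, h4, w, w', ε, δ, hε, hδ, e1, e2, e3⟩ := inv
  simp only at h1 h2 h3 h4 e1 e2 e3 ⊢
  have hb : b ≤ 2 * N := by
    by_contra hb
    have h := h4.resolve_left hb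
    have : 1 ≤ a * b := Nat.mul_pos (by omega) (by omega)
    nlinarith
  have hv : v * (2 * N) ≤ M := by nlinarith
  have hbound : |12 * (((s : ℤ) - z * r) * M - A * r)| ≤ 7 * r := by
    have hr0 : (0 : ℝ) < r := by exact_mod_cast hr
    have hM0 : (0 : ℝ) < M := by exact_mod_cast (by omega : 0 < M)
    have e : ((12 * (((s : ℤ) - z * r) * M - A * r) : ℤ) : ℝ) =
        12 * r * M * (s / r - A / M - z : ℝ) := by
      push_cast
      field_simp
      ring
    have : |((12 * (((s : ℤ) - z * r) * M - A * r) : ℤ) : ℝ)| ≤ 7 * r := by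
      rw [e, abs_mul, abs_of_pos (by positivity : 0 < 12 * (r : ℝ) * M)]
      calc _ ≤ 12 * (r : ℝ) * M * (7 / 12 / M) := by gcongr
        _ = 7 * r := by field_simp
    exact_mod_cast this
  have hb' : |(v : ℤ) * A - w * M| = b := by
    rcases eq_or_eq_neg_of_sq_eq_sq ε 1 (by simpa using hε) with rfl | rfl
    · rw [← e1]; simp
    · rw [← e1]; simp
  -- Both fractions are so close to `A / M` that their difference vanishes.
  have hlin : ((s : ℤ) - z * r) * v = w * r := by
    have e : 12 * (M * (((s : ℤ) - z * r) * v - w * r)) =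
        v * (12 * (((s : ℤ) - z * r) * M - A * r)) + 12 * r * (v * A - w * M) := by ring
    have h : |12 * (M * (((s : ℤ) - z * r) * v - w * r))| < 12 * M := by
      rw [e]
      calc _ ≤ |(v : ℤ) * (12 * (((s : ℤ) - z * r) * M - A * r))| +
            |12 * (r : ℤ) * (v * A - w * M)| := abs_add_le _ _
        _ = v * |12 * (((s : ℤ) - z * r) * M - A * r)| + 12 * r * |v * A - w * M| := by
            rw [abs_mul, abs_mul (12 * (r : ℤ)), Nat.abs_cast,
              abs_of_nonneg (by positivity : 0 ≤ 12 * (r : ℤ))]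
        _ ≤ v * (7 * r) + 12 * r * b := by rw [hb']; gcongr
        _ < 12 * M := by
            have k1 : v * r ≤ v * N := Nat.mul_le_mul_left v hrN
            have k2 : r * b ≤ N * (2 * N) := Nat.mul_le_mul hrN hb
            have : v * (7 * r) + 12 * r * b < 12 * M := by nlinarith
            exact_mod_cast this
    rw [← sub_eq_zero]
    by_contra h0
    have h1 : 1 ≤ |((s : ℤ) - z * r) * v - w * r| := Int.one_le_abs h0
    rw [abs_mul, abs_mul, Nat.abs_cast] at h
    norm_num at h
    have : (0 : ℤ) ≤ M := by positivity
    nlinarith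
  -- The cofactors are coprime, so the fraction `w / v` is in lowest terms.
  have hcop : IsCoprime (v : ℤ) w := ⟨δ * w', -(δ * u), by linear_combination δ * e3 + hδ⟩
  obtain ⟨s', r', hc, hs, hr'⟩ := Nat.exists_coprime s r
  have hg : 0 < s.gcd r := Nat.gcd_pos_of_pos_right s hr
  have hdiv : r / s.gcd r = r' := Nat.div_eq_of_eq_mul_left hg hr'
  rw [hdiv]
  have hc' : IsCoprime ((s' : ℤ) - z * r') r' := by
    have := (Nat.isCoprime_iff_coprime.2 hc).add_mul_right_left (-z)
    rwa [neg_mul, ← sub_eq_add_neg] at this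
  have hlin' : ((s' : ℤ) - z * r') * v = w * r' := by
    have hg' : ((s.gcd r : ℕ) : ℤ) ≠ 0 := by exact_mod_cast hg.ne'
    have hs2 : (s : ℤ) = s' * (s.gcd r : ℕ) := by exact_mod_cast hs
    have hr2 : (r : ℤ) = r' * (s.gcd r : ℕ) := by exact_mod_cast hr'
    apply mul_right_cancel₀ hg'
    linear_combination hlin - v * hs2 + (z * v + w) * hr2
  refine Nat.dvd_antisymm (Int.natCast_dvd_natCast.1 ?_) (Int.natCast_dvd_natCast.1 ?_)
  · exact hcop.dvd_of_dvd_mul_left ⟨(s' : ℤ) - z * r', by rw [← hlin']; ring⟩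
  · exact hc'.symm.dvd_of_dvd_mul_left ⟨w, by rw [hlin']; ring⟩

theorem euclidStepProg_det {B M A k : ℕ} {x : ℕ × ℕ × ℕ × ℕ} (hx : EuclidInvariant B M A k x)
    {ρ : ℕ → ℕ} {ψ : QState} (h6 : ρ 6 = 0) (h21 : ρ 21 = M) (h31 : ρ 31 = B)
    (h26 : ρ 26 = x.1) (h27 : ρ 27 = x.2.1) (h28 : ρ 28 = x.2.2.1) (h29 : ρ 29 = x.2.2.2) :
    Det f euclidStepProg ρ ψ fun ρ' ψ' => ψ' = ψ ∧ ρ' 26 = (euclidStep B x).1 ∧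
      ρ' 27 = (euclidStep B x).2.1 ∧ ρ' 28 = (euclidStep B x).2.2.1 ∧
      ρ' 29 = (euclidStep B x).2.2.2 := by
  obtain ⟨a, b, u, v⟩ := x
  simp only at h26 h27 h28 h29
  refine Det.ifLe (fun h => Det.skip ?_) fun h => ?_
  · have hb : b ≤ B := by omega
    simp [euclidStep, hb, h26, h27, h28, h29]
  · have hb : B < b := by omega
    have hq := hx.mul_le hb
    simp only [mov, Det.seq_arith, clampedMul, ArithOp.eval]
    refine Det.seq (R := fun ρ' ψ' => ψ' = ψ ∧ ρ' 30 = a / b * v ∧ ρ' 26 = b ∧ ρ' 27 = a % b ∧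
      ρ' 28 = u ∧ ρ' 29 = v ∧ ρ' 6 = 0) ?_ ?_
    · rw [Det.seq_arith]
      refine Det.ifLe (fun _ => Det.skip ?_) fun h' => ?_
      · simp [ArithOp.eval, h6, h26, h27, h28, h29]
      · simp [ArithOp.eval, h6, h26, h27, h29, h21] at h'
        omega
    · rintro ρ' ψ' ⟨rfl, k1, k2, k3, k4, k5, k6⟩
      simp only [Det.seq_arith, Det.arith_iff, ArithOp.eval]
      simp [euclidStep, not_le.2 hb, k1, k2, k3, k4, k5, k6]

theorem euclidProg_det {B M A E : ℕ} (hB : B < M) (hA : A < M) {ρ : ℕ → ℕ} {ψ : QState}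
    (h5 : ρ 5 = E) (h6 : ρ 6 = 0) (h7 : ρ 7 = 1) (h20 : ρ 20 = A) (h21 : ρ 21 = M)
    (h31 : ρ 31 = B) :
    Det f euclidProg ρ ψ fun ρ' ψ' => ψ' = ψ ∧
      ρ' 10 = max (ρ 10) (approxDenominator B M E A) := by
  simp only [euclidProg, mov, Det.seq_arith, ArithOp.eval]
  set ρ₁ : ℕ → ℕ := Function.update _ 29 _ with hρ₁
  have fr : ∀ x ∉ [26, 27, 28, 29], ρ₁ x = ρ x := by
    intro x hx
    simp only [List.mem_cons, List.not_mem_nil, or_false, not_or] at hx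
    simp [hρ₁, hx]
  have f26 : ρ₁ 26 = M := by simp [hρ₁, h6, h21]
  have f27 : ρ₁ 27 = A := by simp [hρ₁, h6, h20]
  have f28 : ρ₁ 28 = 0 := by simp [hρ₁, h6]
  have f29 : ρ₁ 29 = 1 := by simp [hρ₁, h6, h7]
  clear_value ρ₁
  have f5 : ρ₁ 5 = E := (fr 5 (by decide)).trans h5
  refine Det.seq (R := fun ρ' ψ' => ψ' = ψ ∧ ρ' 29 = approxDenominator B M E A ∧
    ρ' 10 = ρ 10 ∧ ρ' 6 = 0) (Det.loop (fun k ρ' ψ' => ψ' = ψ ∧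
      ρ' 26 = ((euclidStep B)^[k] (M, A, 0, 1)).1 ∧
      ρ' 27 = ((euclidStep B)^[k] (M, A, 0, 1)).2.1 ∧
      ρ' 28 = ((euclidStep B)^[k] (M, A, 0, 1)).2.2.1 ∧
      ρ' 29 = ((euclidStep B)^[k] (M, A, 0, 1)).2.2.2) ⟨rfl, f26, f27, f28, f29⟩ ?_ ?_) ?_
  · rintro k - ρ' ψ' hf ⟨rfl, k1, k2, k3, k4⟩
    rw [Function.iterate_succ_apply']
    exact euclidStepProg_det (EuclidInvariant.iterate hB hA k)
      ((hf 6 (by decide)).trans ((fr 6 (by decide)).trans h6))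
      ((hf 21 (by decide)).trans ((fr 21 (by decide)).trans h21))
      ((hf 31 (by decide)).trans ((fr 31 (by decide)).trans h31)) k1 k2 k3 k4
  · rintro ρ' ψ' hf ⟨rfl, k1, k2, k3, k4⟩
    rw [f5] at k4
    exact ⟨rfl, k4, (hf 10 (by decide)).trans (fr 10 (by decide)),
      (hf 6 (by decide)).trans ((fr 6 (by decide)).trans h6)⟩
  · rintro ρ' ψ' ⟨rfl, k1, k2, k3⟩
    refine Det.ifLe (fun h => Det.skip ⟨rfl, ?_⟩) fun h => ?_
    · omega
    · rw [Det.arith_iff]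
      refine ⟨rfl, ?_⟩
      simp only [ArithOp.eval, Function.update_self]
      omega

end

section

variable {n : ℕ} {f : Bits n → Bits n → Bits n}

/-! ### One sample -/

/-- The registers hold the parameters of the algorithm. -/
structure Parameters (n N J K : ℕ) (ρ : ℕ → ℕ) : Prop extends VoteConstants ρ where
  r0 : ρ 0 = n
  r2 : ρ 2 = J
  r3 : ρ 3 = K
  r4 : ρ 4 = 4 * J
  r5 : ρ 5 = 2 * J + 1
  r31 : ρ 31 = 2 * N

theorem Parameters.congr {n N J K : ℕ} {ρ ρ' : ℕ → ℕ} (h : Parameters n N J K ρ)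
    (e : ∀ x ∈ [0, 2, 3, 4, 5, 6, 7, 8, 31, 41, 42], ρ' x = ρ x) : Parameters n N J K ρ' where
  toVoteConstants := h.toVoteConstants.congr fun x hx =>
    e x ((by decide : ∀ x ∈ [6, 7, 8, 41, 42], x ∈ [0, 2, 3, 4, 5, 6, 7, 8, 31, 41, 42]) x hx)
  r0 := (e 0 (by decide)).trans h.r0
  r2 := (e 2 (by decide)).trans h.r2
  r3 := (e 3 (by decide)).trans h.r3
  r4 := (e 4 (by decide)).trans h.r4
  r5 := (e 5 (by decide)).trans h.r5
  r31 := (e 31 (by decide)).trans h.r31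

variable {S : Type*} [Semigroup S]

/-- The basis state `s` holds the encodings of the powers of `g`, and all qubits from register `9`
on are `0`. -/
structure FreshAfterPowers (B : BlackBox S n) (g : S) (J : ℕ) (ρ : ℕ → ℕ) (s : Finset ℕ) :
    Prop where
  powers : HoldsPowers B g J s
  le_fresh : (J + 1) * n ≤ ρ 9
  lt_fresh : ∀ q ∈ s, q < ρ 9

/-- The exponents of the circuit are beyond the index, so that only the cycle of `g` matters. -/
theorem le_baseExponent {J K : ℕ} (hJ : 1 ≤ J) (hK : 1 ≤ K) :
    2 ^ (J - 1) ≤ baseExponent K (J * K) := by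
  have hmem : (J - 1) * K + 0 ∈ Finset.range (J * K) :=
    Finset.mem_range.2 (index_lt (by omega) hK)
  have := Finset.single_le_sum (f := fun k => 2 ^ (k / K)) (fun _ _ => Nat.zero_le _) hmem
  simp only [index_div (show 0 < K from hK)] at this
  exact this.trans (Nat.le_add_left _ _)

/-- The basis state `u` with the encoding of the power `g ^ (T + h)` added to the block at `O`. -/
def writePower (B : BlackBox S n) (g : S) (O T h : ℕ) (u : Finset ℕ) : Finset ℕ :=
  xorBits O (B.enc (spow g (T + h))) u

theorem fixesControls_writePower (B : BlackBox S n) (g : S) {X Q O T : ℕ} (h : X + Q ≤ O) :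
    FixesControls X Q (writePower B g O T) := by
  intro i hi h' u hu
  refine ⟨by rwa [writePower, mem_xorBits_of_outside (by omega)], ?_⟩
  ext q
  by_cases hq : q = X + i
  · subst hq
    simp [writePower, mem_xorBits_of_outside (show X + i < O ∨ O + n ≤ X + i by omega)]
  · simp [writePower, mem_xorBits, hq]

/-- The state after the exponentiation circuit is a superposition of eigenstates with equal
amplitudes, one for each eigenvalue. -/
theorem mapDomain_expMap_uniformState [Finite S] {B : BlackBox S n} {g : S} {J K X : ℕ}
    (hX : (J + 1) * n ≤ X) {σ : Finset ℕ} (hσ : HoldsPowers B g J σ) (hfresh : ∀ q ∈ σ, q < X)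
    (hT : sgIndex g ≤ baseExponent K (J * K)) (α : ℂ) :
    (uniformState X (J * K) σ α).mapDomain (expMap B.mul K (J * K) X) =
      eigenState (sgPeriod g)
        (writePower B g (X + J * K + J * K * n + (J * K + 1) * n) (baseExponent K (J * K)))
        (controlSum K X) X (J * K) (fun _ => α)
        (xorBits (X + J * K + J * K * n) (B.enc (spow g 2)) σ) := by
  rw [eigenState_const (by have := (sgPeriod_mem g).1; omega), uniformState,
    Finsupp.mapDomain_finsetSum]
  refine Finset.sum_congr rfl fun c hc => ?_
  rw [Finsupp.mapDomain_single, expMap_spec hX hσ hfresh (Finset.mem_powerset.1 hc), writePower,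
    spow_index_add g hT]

theorem support_eigenState_zero (r : ℕ) (E : ℕ → Finset ℕ → Finset ℕ) (K X : ℕ)
    (β : ℕ → ℂ) (σ s : Finset ℕ) (hs : s ∈ (eigenState r E (controlSum K X) X 0 β σ).support) :
    ∃ h, s = E h σ := by
  classical
  rw [eigenState_zero r E (by simp [controlSum])] at hs
  obtain ⟨h, -, hh⟩ := Finset.mem_biUnion.1 (Finsupp.support_finsetSum hs)
  exact ⟨h, Finset.mem_singleton.1 (Finsupp.support_single_subset hh)⟩

/-- Measuring the block that holds the powers of `g` and running the Euclidean algorithm, after the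
phase `A` has been found. -/
theorem measure_euclid_wp [Finite S] {B : BlackBox S n} {g : S} {N J K X : ℕ} {ρ : ℕ → ℕ}
    {σ σ' : Finset ℕ} (hρ : Parameters n N J K ρ) (hX : (J + 1) * n ≤ X) (hσ : HoldsPowers B g J σ)
    (hfresh : ∀ q ∈ σ, q < X) (hNJ : 2 * N < 2 ^ J)
    (hT : sgIndex g ≤ baseExponent K (J * K)) {A : ℕ} (hA : A < 2 ^ J) (h20 : ρ 20 = A)
    (h21 : ρ 21 = 2 ^ J) (h33 : ρ 33 = X + J * K + J * K * n + (J * K + 1) * n)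
    (h9 : ρ 9 = X + J * K + J * K * n + (J * K + 1) * n + n)
    (hσ' : Remaining X (J * K) 0 (xorBits (X + J * K + J * K * n) (B.enc (spow g 2)) σ) σ')
    {U : ℕ → ℝ} {Φ : (ℕ → ℕ) → QState → ℝ} (h0 : ∀ ρ ψ, 0 ≤ Φ ρ ψ)
    (hΦ : ∀ ρ' s α, (∀ x ∉ sampleProg.writes, ρ' x = ρ x) → FreshAfterPowers B g J ρ' s →
      ‖α‖ ^ 2 * U (ρ' 10) ≤ Φ ρ' (Finsupp.single s α)) (β : ℕ → ℂ) :
    (∑ s ∈ Finset.range (sgPeriod g), ‖β s‖ ^ 2 *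
      U (max (ρ 10) (approxDenominator (2 * N) (2 ^ J) (2 * J + 1) A))) / (sgPeriod g) ≤
      (measureBlockProg ;; euclidProg).wp f Φ ρ (eigenState (sgPeriod g)
        (writePower B g (X + J * K + J * K * n + (J * K + 1) * n) (baseExponent K (J * K)))
        (controlSum K X) X 0 β σ') := by
  set Y := X + J * K + J * K * n with hY
  set O := Y + (J * K + 1) * n with hO
  have hYn : Y + n ≤ O := by rw [hO]; nlinarith [Nat.zero_le (J * K * n)]
  have hXY : X + J * K ≤ Y := by omega
  have hbase : ∀ q ∈ σ', q < O := by
    intro q hq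
    by_contra hqO
    have := (hσ'.1 q (by omega)).1 hq
    rw [mem_xorBits_of_outside (by omega)] at this
    have := hfresh q this
    omega
  have hlow : ∀ q < X, (q ∈ σ' ↔ q ∈ σ) := fun q hq => by
    rw [hσ'.1 q (by omega), mem_xorBits_of_outside (by omega)]
  have hinj : ∀ h < sgPeriod g, ∀ h' < sgPeriod g,
      writePower B g O (baseExponent K (J * K)) h σ' =
      writePower B g O (baseExponent K (J * K)) h' σ' → h = h' := by
    intro h hh h' hh' e
    have e' := congrArg (readBits n O) e
    have hfr : ∀ q, O ≤ q → q < O + n → q ∉ σ' := fun q hq _ hq' => by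
      have := hbase q hq'
      omega
    rw [writePower, writePower, readBits_xorBits_self hfr, readBits_xorBits_self hfr] at e'
    exact spow_index_injOn g hT hh hh' (B.enc_injective e')
  rw [← Finset.sum_mul, mul_div_right_comm, ← weight_eigenState_zero
    (by have := (sgPeriod_mem g).1; omega) (e := controlSum K X) (by simp [controlSum]) X β σ' hinj,
    Prog.wp_seq]
  refine measureBlockProg_wp (T := {s | ∃ h, s = writePower B g O (baseExponent K (J * K)) h σ'})
    (euclidProg.wp_nonneg h0) hρ.r0 hρ.r6 hρ.r7 ?_ (support_eigenState_zero _ _ _ _ _ _) ?_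
  · rintro ρ' s α fr ⟨h, rfl⟩
    refine (euclidProg_det (B := 2 * N) (M := 2 ^ J) (A := A) hNJ hA (ρ := ρ')
      ((fr 5 (by decide)).trans hρ.r5) ((fr 6 (by decide)).trans hρ.r6)
      ((fr 7 (by decide)).trans hρ.r7) ((fr 20 (by decide)).trans h20)
      ((fr 21 (by decide)).trans h21) ((fr 31 (by decide)).trans hρ.r31)).frame Φ _ h0 ?_
    rintro ρ'' ψ' ⟨⟨rfl, k10⟩, fr'⟩
    have fr'' : ∀ x ∉ sampleProg.writes, ρ'' x = ρ x := by
      intro x hx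
      refine (fr' x fun h => hx ?_).trans (fr x fun h => hx ?_)
      · clear hx; revert x; decide
      · clear hx; revert x; decide
    have k9 : ρ'' 9 = O + n := (fr' 9 (by decide)).trans ((fr 9 (by decide)).trans h9)
    rw [fr 10 (by decide)] at k10
    rw [← k10]
    refine hΦ _ _ _ fr'' ⟨hσ.congr hX fun q hq => ?_, by omega, fun q hq => ?_⟩
    · rw [writePower, mem_xorBits_of_outside (by omega), hlow q hq]
    · by_contra hq'
      rw [writePower, mem_xorBits_of_outside (by omega)] at hq
      have := hbase q hq
      omega
  · intro s hs s' hs' q hq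
    obtain ⟨h, rfl⟩ := support_eigenState_zero _ _ _ _ _ _ _ hs
    obtain ⟨h', rfl⟩ := support_eigenState_zero _ _ _ _ _ _ _ hs'
    rw [h33] at hq
    rw [writePower, writePower, mem_xorBits_of_outside hq, mem_xorBits_of_outside hq]

/-- A sample finds the order of an eigenvalue, and the eigenvalues are uniformly distributed. -/
theorem sampleProg_wp [Finite S] {B : BlackBox S n} {g : S} {N J K : ℕ} {ρ : ℕ → ℕ} {σ : Finset ℕ}
    {α : ℂ} (hρ : Parameters n N J K ρ) (hσ : FreshAfterPowers B g J ρ σ) (hK : 1 ≤ K)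
    (hN : 8 * N ^ 2 ≤ 2 ^ J) (ht : sgIndex g ≤ N) (hr : sgPeriod g ≤ N)
    {U : ℕ → ℝ} (hU : ∀ d, 0 ≤ U d) {Φ : (ℕ → ℕ) → QState → ℝ} (h0 : ∀ ρ ψ, 0 ≤ Φ ρ ψ)
    (hΦ : ∀ ρ' s α, (∀ x ∉ sampleProg.writes, ρ' x = ρ x) → FreshAfterPowers B g J ρ' s →
      ‖α‖ ^ 2 * U (ρ' 10) ≤ Φ ρ' (Finsupp.single s α)) :
    ‖α‖ ^ 2 * ((∑ s ∈ Finset.range (sgPeriod g), U (max (ρ 10) (sgPeriod g / s.gcd (sgPeriod g))) *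
      (1 - (71 / 72) ^ K) ^ J) / sgPeriod g) ≤ sampleProg.wp B.mul Φ ρ (Finsupp.single σ α) := by
  have hr1 := (sgPeriod_mem g).1
  have hN1 : 1 ≤ N := hr1.trans hr
  have hJ : 1 ≤ J := by
    by_contra h
    have : J = 0 := by omega
    subst this
    nlinarith
  have hNJ : 2 * N < 2 ^ J := by nlinarith
  have hT : sgIndex g ≤ baseExponent K (J * K) := by
    refine ht.trans (le_trans ?_ (le_baseExponent hJ hK))
    have : 2 ^ J = 2 * 2 ^ (J - 1) := by rw [← pow_succ', Nat.sub_add_cancel hJ]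
    omega
  rw [sampleProg, Prog.wp_seq]
  refine (hadamardProg_det hρ.r2 hρ.r3 hρ.r6 hρ.r7 rfl hσ.lt_fresh).frame _ _
    (Prog.wp_nonneg _ h0) ?_
  rintro ρ₁ ψ₁ ⟨⟨k11, rfl⟩, fr₁⟩
  have hρ₁ := hρ.congr fun x hx => fr₁ x (by revert x; decide)
  have k9 : ρ₁ 9 = ρ 9 := fr₁ 9 (by decide)
  rw [Prog.wp_seq]
  refine (exponentiateProg_det (f := B.mul) hσ.le_fresh hρ₁.r0 hρ₁.r2 hρ₁.r3 hρ₁.r6 hρ₁.r7 k9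
    k11).frame _ _ (Prog.wp_nonneg _ h0) ?_
  rintro ρ₂ ψ₂ ⟨⟨k14, k33, rfl⟩, fr₂⟩
  have hρ₂ := hρ₁.congr fun x hx => fr₂ x (by revert x; decide)
  rw [mapDomain_expMap_uniformState hσ.le_fresh hσ.powers hσ.lt_fresh hT, Prog.wp_seq]
  refine le_trans ?_ (phaseProg_wp (J := J) (K := K)
    (fixesControls_writePower B g (by omega))
    (fun A => U (max (ρ 10) (approxDenominator (2 * N) (2 ^ J) (2 * J + 1) A)))
    hρ₂.toVoteConstants hρ₂.r2 hρ₂.r3 k14 (by rw [k33, hρ₂.r0]) ?_ ?_)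
  · rw [← mul_div_assoc, Finset.mul_sum]
    gcongr with s hs
    have := digitVal_ge (K := K) (θ := s / sgPeriod g)
      (m := U (max (ρ 10) (sgPeriod g / s.gcd (sgPeriod g))))
      (V := fun A => U (max (ρ 10) (approxDenominator (2 * N) (2 ^ J) (2 * J + 1) A)))
      (fun A => hU _) (hU _) (J := J) ?_ J 0 0 rfl (by simp)
      (round (2 ^ J * (s / sgPeriod g : ℝ))) ?_
    · simpa using this
    · intro A hA z hz
      rw [approxDenominator_eq hN1 hN
        (by rw [← pow_add]; exact Nat.pow_lt_pow_right (by norm_num) (by omega)) hA hr1 hr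
        (by exact_mod_cast hz)]
    · have := abs_sub_round (2 ^ J * (s / sgPeriod g : ℝ))
      simp only [Nat.cast_zero, sub_zero, pow_zero, div_one]
      linarith
  · intro q hq
    by_contra h
    rw [mem_xorBits_of_outside (by omega)] at hq
    have := hσ.lt_fresh q hq
    omega
  · intro ρ₃ A β' σ' g20 g21 gA g9 fr₃ hσ'
    have hρ₃ := hρ₂.congr fun x hx => fr₃ x (by revert x; decide)
    have g10 : ρ₃ 10 = ρ 10 :=
      (fr₃ 10 (by decide)).trans ((fr₂ 10 (by decide)).trans (fr₁ 10 (by decide)))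
    rw [← g10]
    refine measure_euclid_wp hρ₃ hσ.le_fresh hσ.powers hσ.lt_fresh hNJ hT gA g20 g21
      ((fr₃ 33 (by decide)).trans k33) g9 hσ' h0 ?_ β'
    intro ρ' s α' fr hs
    refine hΦ ρ' s α' (fun x hx => (fr x hx).trans ?_) hs
    refine (fr₃ x fun h => hx ?_).trans ((fr₂ x fun h => hx ?_).trans (fr₁ x fun h => hx ?_))
    · clear hx; revert x; decide
    · clear hx; revert x; decide
    · clear hx; revert x; decide

end

section

variable {n : ℕ} {f : Bits n → Bits n → Bits n}

/-! ### Repeated samples -/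

/-- A lower bound for the probability that the largest denominator is `r` after `k` more samples,
when it is `d` now. The phase is found with probability at least `c` in every sample, and it has
the denominator `r` with probability `φ`. -/
noncomputable def sampleVal (c φ : ℝ) (r k d : ℕ) : ℝ :=
  if d = r then c ^ k else if d < r then c ^ k * (1 - (1 - φ) ^ k) else 0

theorem sampleVal_nonneg {c φ : ℝ} (hc : 0 ≤ c) (h0 : 0 ≤ φ) (h1 : φ ≤ 1) (r k d : ℕ) :
    0 ≤ sampleVal c φ r k d := by
  have : (1 - φ) ^ k ≤ 1 := pow_le_one₀ (by linarith) (by linarith)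
  have : 0 ≤ 1 - (1 - φ) ^ k := by linarith
  unfold sampleVal
  split_ifs <;> positivity

theorem totient_div_le_one (r : ℕ) : ((r.totient : ℝ) / r) ≤ 1 :=
  div_le_one_of_le₀ (by exact_mod_cast Nat.totient_le r) (Nat.cast_nonneg r)

/-- Of the `r` equally likely eigenvalues, `φ(r)` have the order `r`. -/
theorem sampleVal_succ_le (c : ℝ) {r : ℕ} (hr : 1 ≤ r) (k d : ℕ) :
    sampleVal c (r.totient / r) r (k + 1) d ≤
      (∑ s ∈ Finset.range r, sampleVal c (r.totient / r) r k (max d (r / s.gcd r)) * c) / r := by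
  have hr0 : (0 : ℝ) < r := by exact_mod_cast hr
  set φ : ℝ := r.totient / r with hφ
  have hle : ∀ s : ℕ, r / s.gcd r ≤ r := fun s => Nat.div_le_self _ _
  rcases lt_trichotomy d r with hd | hd | hd
  · have e : ∀ s ∈ Finset.range r, sampleVal c φ r k (max d (r / s.gcd r)) * c =
        c ^ (k + 1) * (1 - (1 - φ) ^ k) +
          (if r.Coprime s then c ^ (k + 1) * (1 - φ) ^ k else 0) := by
      intro s _
      by_cases hs : r.Coprime s
      · have : s.gcd r = 1 := hs.symm
        rw [if_pos hs, this, Nat.div_one, max_eq_right hd.le, sampleVal, if_pos rfl]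
        ring
      · have h1 : 1 < s.gcd r := by
          have h2 : s.gcd r ≠ 1 := fun h => hs (Nat.Coprime.symm h)
          have := Nat.gcd_pos_of_pos_right s hr
          omega
        have : max d (r / s.gcd r) < r := max_lt hd (Nat.div_lt_self hr h1)
        rw [if_neg hs, sampleVal, if_neg this.ne, if_pos this]
        ring
    rw [Finset.sum_congr rfl e, Finset.sum_add_distrib, ← Finset.sum_filter, Finset.sum_const,
      Finset.sum_const, ← Nat.totient_eq_card_coprime, Finset.card_range, sampleVal, if_neg hd.ne,
      if_pos hd, nsmul_eq_mul, nsmul_eq_mul]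
    have ht : (r.totient : ℝ) = φ * r := by rw [hφ]; field_simp
    rw [ht]
    apply le_of_eq
    field_simp
    ring
  · subst hd
    have e : ∀ s ∈ Finset.range d, sampleVal c φ d k (max d (d / s.gcd d)) * c = c ^ (k + 1) := by
      intro s _
      rw [max_eq_left (hle s), sampleVal, if_pos rfl, pow_succ]
    rw [Finset.sum_congr rfl e, sampleVal, if_pos rfl, Finset.sum_const, Finset.card_range,
      nsmul_eq_mul, mul_div_cancel_left₀ _ hr0.ne']
  · have e : ∀ s ∈ Finset.range r, sampleVal c φ r k (max d (r / s.gcd r)) * c = 0 := by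
      intro s _
      rw [max_eq_left ((hle s).trans hd.le), sampleVal, if_neg hd.ne', if_neg hd.not_gt, zero_mul]
    rw [Finset.sum_congr rfl e, sampleVal, if_neg hd.ne', if_neg hd.not_gt]
    simp

/-- The lower bound `sampleVal` holds for the loop over the samples. -/
theorem sample_iterate {S : Type*} [Semigroup S] [Finite S] {B : BlackBox S n} {g : S} {N J K : ℕ}
    (hK : 1 ≤ K) (hN : 8 * N ^ 2 ≤ 2 ^ J) (ht : sgIndex g ≤ N) (hr : sgPeriod g ≤ N)
    {Φ : (ℕ → ℕ) → QState → ℝ} (h0 : ∀ ρ ψ, 0 ≤ Φ ρ ψ)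
    (hΦ : ∀ ρ' s α, Parameters n N J K ρ' → FreshAfterPowers B g J ρ' s → ρ' 10 = sgPeriod g →
      ‖α‖ ^ 2 ≤ Φ ρ' (Finsupp.single s α)) (k : ℕ) {ρ : ℕ → ℕ} {σ : Finset ℕ} {α : ℂ}
    (hρ : Parameters n N J K ρ) (hσ : FreshAfterPowers B g J ρ σ) :
    ‖α‖ ^ 2 * sampleVal ((1 - (71 / 72) ^ K) ^ J) ((sgPeriod g).totient / sgPeriod g)
      (sgPeriod g) k (ρ 10) ≤ (sampleProg.wp B.mul)^[k] Φ ρ (Finsupp.single σ α) := by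
  have hc : (0 : ℝ) ≤ (1 - (71 / 72) ^ K) ^ J :=
    pow_nonneg (by rw [sub_nonneg]; exact pow_le_one₀ (by norm_num) (by norm_num)) _
  induction k generalizing ρ σ α with
  | zero =>
    simp only [Function.iterate_zero, id_eq, sampleVal, pow_zero, sub_self, mul_zero, ite_self]
    split_ifs with h
    · simpa using hΦ ρ σ α hρ hσ h
    · simpa using h0 _ _
  | succ k ih =>
    rw [Function.iterate_succ_apply']
    refine le_trans ?_ (sampleProg_wp hρ hσ hK hN ht hr
      (sampleVal_nonneg hc (by positivity) (totient_div_le_one _) (sgPeriod g) k)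
      (Prog.iterate_wp_nonneg _ k h0) fun ρ' s α' fr hs =>
        ih (hρ.congr fun x hx => fr x (by revert x; decide)) hs)
    exact mul_le_mul_of_nonneg_left (sampleVal_succ_le _ (sgPeriod_mem g).1 k (ρ 10))
      (sq_nonneg _)

/-- The numbers of votes and of samples are large enough. -/
theorem two_thirds_le_sampleVal {N r : ℕ} (hr : 1 ≤ r) (hrN : r ≤ N) :
    2 / 3 ≤ sampleVal ((1 - (71 / 72) ^ (256 * (2 * N.size + 3))) ^ (2 * N.size + 3))
      (r.totient / r) r (4 * (2 * N.size + 3)) 0 := by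
  have hlog : Nat.log 2 r < N.size :=
    Nat.lt_size.2 ((Nat.pow_log_le_self 2 (by omega)).trans hrN)
  set J := 2 * N.size + 3 with hJ
  have hJ5 : 5 ≤ J := by omega
  rw [sampleVal, if_neg (by omega), if_pos (by omega)]
  have hr0 : (0 : ℝ) < r := by exact_mod_cast hr
  set φ : ℝ := r.totient / r with hφ
  have hφ1 : φ ≤ 1 := totient_div_le_one r
  -- The number of samples is `8` times the expected number that is needed.
  have hφl : 8 ≤ φ * (4 * J : ℕ) := by
    have h1 := le_totient_mul_log_add_one hr
    have h2 : (Nat.log 2 r + 1 : ℝ) ≤ N.size := by exact_mod_cast hlog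
    have h3 : (J : ℝ) = 2 * N.size + 3 := by rw [hJ]; push_cast; ring
    have h4 : 1 ≤ φ * (Nat.log 2 r + 1) := by
      rw [hφ, div_mul_eq_mul_div, one_le_div hr0]
      exact h1
    have h5 : 0 ≤ φ := by positivity
    push_cast
    nlinarith
  have hfail : (1 - φ) ^ (4 * J) ≤ 1 / 9 := by
    calc (1 - φ) ^ (4 * J) ≤ Real.exp (-φ) ^ (4 * J) :=
          pow_le_pow_left₀ (by linarith) (Real.one_sub_le_exp_neg φ) _
      _ = Real.exp (-(φ * (4 * J : ℕ))) := by rw [← Real.exp_nat_mul]; congr 1; ring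
      _ ≤ Real.exp (-8) := Real.exp_le_exp.2 (by linarith)
      _ = (Real.exp 8)⁻¹ := Real.exp_neg 8
      _ ≤ (9 : ℝ)⁻¹ := inv_anti₀ (by norm_num) (by have := Real.add_one_le_exp (8 : ℝ); linarith)
      _ = 1 / 9 := by norm_num
  have hvote : (8 / 9 : ℝ) ≤ ((1 - (71 / 72) ^ (256 * J)) ^ J) ^ (4 * J) := by
    rw [← pow_mul]
    have h1 : ((71 / 72 : ℝ)) ^ (256 * J) ≤ (1 / 32) ^ J := by
      rw [pow_mul]
      -- `(71 / 72) ^ 256 ≤ 1 / 32`, in steps that keep the exponents small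
      have e : ((71 / 72 : ℝ)) ^ 256 = ((71 / 72) ^ 128) ^ 2 := by rw [← pow_mul]
      have : ((71 / 72 : ℝ)) ^ 128 ≤ 17 / 100 := by norm_num
      refine pow_le_pow_left₀ (by positivity) (e.trans_le ?_) _
      exact (pow_le_pow_left₀ (by positivity) this 2).trans (by norm_num)
    have h2 : (J * (4 * J) : ℝ) * (1 / 32) ^ J ≤ 1 / 9 := by
      have h3 : (J : ℝ) ≤ 2 ^ J := by exact_mod_cast Nat.lt_two_pow_self.le
      have h4 : ((1 / 32 : ℝ)) ^ J = (1 / 2 ^ J) * (1 / 2 ^ J) * (1 / 8) ^ J := by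
        rw [← one_div_pow, ← mul_pow, ← mul_pow]; norm_num
      have h5 : ((1 / 8 : ℝ)) ^ J ≤ (1 / 8) ^ 5 :=
        pow_le_pow_of_le_one (by norm_num) (by norm_num) hJ5
      have h6 : (J : ℝ) * (1 / 2 ^ J) ≤ 1 := by
        rw [mul_one_div]
        exact div_le_one_of_le₀ h3 (by positivity)
      calc (J * (4 * J) : ℝ) * (1 / 32) ^ J =
            4 * ((J * (1 / 2 ^ J)) * (J * (1 / 2 ^ J))) * (1 / 8) ^ J := by rw [h4]; ring
        _ ≤ 4 * (1 * 1) * (1 / 8) ^ 5 := by gcongr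
        _ ≤ 1 / 9 := by norm_num
    have h7 : ((71 / 72 : ℝ)) ^ (256 * J) ≤ 1 := pow_le_one₀ (by norm_num) (by norm_num)
    generalize (71 / 72 : ℝ) ^ (256 * J) = ε at h1 h7 ⊢
    have := one_add_mul_le_pow (a := -ε) (by linarith) (J * (4 * J))
    rw [← sub_eq_add_neg] at this
    refine le_trans ?_ this
    push_cast
    nlinarith [mul_le_mul_of_nonneg_left h1 (by positivity : (0 : ℝ) ≤ J * (4 * J))]
  calc (2 / 3 : ℝ) ≤ 8 / 9 * (1 - 1 / 9) := by norm_num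
    _ ≤ _ := mul_le_mul hvote (by linarith) (by norm_num)
        ((by norm_num : (0 : ℝ) ≤ 8 / 9).trans hvote)

end

section

variable {n : ℕ} {f : Bits n → Bits n → Bits n}

/-! ### Set-up and powers -/

theorem setupProg_det {ρ : ℕ → ℕ} {ψ : QState} {N : ℕ} (h0 : ρ 0 = n) (h1 : ρ 1 = N)
    (h6 : ρ 6 = 0) :
    Det f setupProg ρ ψ fun ρ' ψ' => ψ' = ψ ∧
      Parameters n N (2 * N.size + 3) (256 * (2 * N.size + 3)) ρ' := by
  intro Φ v _ hΦ
  refine hΦ _ _ ⟨rfl, ⟨⟨?_, ?_, ?_, ?_, ?_⟩, ?_, ?_, ?_, ?_, ?_, ?_⟩⟩ <;>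
    simp [ArithOp.eval, h0, h1, h6] <;> omega

theorem Det.query_single {x y z : ℕ} {ρ : ℕ → ℕ} {s : Finset ℕ} {α : ℂ}
    {Q : (ℕ → ℕ) → QState → Prop} (hx : ρ x + n ≤ ρ z) (hy : ρ y + n ≤ ρ z)
    (h : Q ρ (Finsupp.single
      (xorBits (ρ z) (f (readBits n (ρ x) s) (readBits n (ρ y) s)) s) α)) :
    Det f (.query x y z) ρ (Finsupp.single s α) Q := by
  refine Det.query_mapDomain (Or.inl hx) (Or.inl hy) ?_
  rw [Finsupp.mapDomain_single]
  exact h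

theorem Det.seq_query_single {d : Prog} {x y z : ℕ} {ρ : ℕ → ℕ} {s : Finset ℕ} {α : ℂ}
    {Q : (ℕ → ℕ) → QState → Prop} (hx : ρ x + n ≤ ρ z) (hy : ρ y + n ≤ ρ z)
    (h : Det f d ρ (Finsupp.single
      (xorBits (ρ z) (f (readBits n (ρ x) s) (readBits n (ρ y) s)) s) α) Q) :
    Det f (.query x y z ;; d) ρ (Finsupp.single s α) Q :=
  Det.seq (R := fun ρ' ψ' => ρ' = ρ ∧ ψ' = _) (Det.query_single hx hy ⟨rfl, rfl⟩)
    (by rintro _ _ ⟨rfl, rfl⟩; exact h)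

theorem Det.seq_measure_single {d : Prog} {x y : ℕ} {ρ : ℕ → ℕ} {s : Finset ℕ} {α : ℂ}
    {Q : (ℕ → ℕ) → QState → Prop}
    (h : Det f d (Function.update ρ x (decide (ρ y ∈ s)).toNat) (Finsupp.single s α) Q) :
    Det f (.measure x y ;; d) ρ (Finsupp.single s α) Q :=
  Det.seq (R := fun ρ' ψ' => ρ' = _ ∧ ψ' = _) (Det.measure_single ⟨rfl, rfl⟩)
    (by rintro _ _ ⟨rfl, rfl⟩; exact h)

theorem readBits_xorBits_fresh {c : ℕ} {w : Bits n} {s : Finset ℕ} (h : ∀ q ∈ s, q < c) :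
    readBits n c (xorBits c w s) = w :=
  readBits_xorBits_self fun q hq _ hqs => by have := h q hqs; omega

theorem xorBits_lt {c : ℕ} {w : Bits n} {s : Finset ℕ} (h : ∀ q ∈ s, q < c) :
    ∀ q ∈ xorBits c w s, q < c + n := by
  intro q hq
  by_contra hq'
  rw [mem_xorBits_of_outside (by omega)] at hq
  have := h q hq
  omega

variable {S : Type*} [Semigroup S] {B : BlackBox S n} {g : S}

theorem powersProg_det {ρ : ℕ → ℕ} {J : ℕ} (h0 : ρ 0 = n) (h2 : ρ 2 = J) (h6 : ρ 6 = 0) :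
    Det B.mul powersProg ρ (Finsupp.single (xorBits 0 (B.enc g) ∅) 1) fun ρ' ψ' =>
      ∃ s, ψ' = Finsupp.single s 1 ∧ FreshAfterPowers B g J ρ' s := by
  simp only [powersProg, mov, inc, Det.seq_arith, ArithOp.eval]
  set ρ₁ : ℕ → ℕ := Function.update _ 12 _ with hρ₁
  have f0 : ρ₁ 0 = n := by simp [hρ₁, h0]
  have f2 : ρ₁ 2 = J := by simp [hρ₁, h2]
  have f6 : ρ₁ 6 = 0 := by simp [hρ₁, h6]
  have f9 : ρ₁ 9 = n := by simp [hρ₁, h0, h6]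
  have f12 : ρ₁ 12 = 0 := by simp [hρ₁, h6]
  clear_value ρ₁
  refine Det.loop (fun i ρ' ψ' => ρ' 12 = i * n ∧ ρ' 9 = (i + 1) * n ∧
    ∃ s, ψ' = Finsupp.single s 1 ∧ FreshAfterPowers B g i ρ' s) ?_ ?_ ?_
  · refine ⟨by simpa using f12, by simpa using f9, _, rfl, ?_, by simp [f9], ?_⟩
    · intro j hj
      obtain rfl : j = 0 := by omega
      rw [Nat.zero_mul, readBits_xorBits_fresh (by simp)]
      rfl
    · rw [f9]
      simpa using xorBits_lt (c := 0) (w := B.enc g) (s := ∅) (by simp)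
  · rintro i - ρ' ψ' fr ⟨k12, k9, s, rfl, hs⟩
    have k0 := (fr 0 (by decide)).trans f0
    have k6 := (fr 6 (by decide)).trans f6
    have e1 : (i + 1) * n = i * n + n := by ring
    have e2 : (i + 1 + 1) * n = i * n + n + n := by ring
    refine Det.seq_query_single (by omega) (by omega) ?_
    rw [Det.seq_arith, Det.arith_iff]
    have hlt := hs.lt_fresh
    rw [k9] at hlt
    have hg := hs.powers i le_rfl
    refine ⟨by simp [ArithOp.eval, k9, k6], by simp [ArithOp.eval, k9, k0, e1, e2], _, rfl, ?_, ?_,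
      ?_⟩
    · rw [k12, k9, hg, B.mul_enc, ← spow_add g Nat.one_le_two_pow Nat.one_le_two_pow, ← two_mul,
        ← pow_succ']
      intro j hj
      rcases hj.lt_or_eq with hj | rfl
      · rw [readBits_xorBits_of_disjoint, hs.powers j (by omega)]
        have : (j + 1) * n ≤ (i + 1) * n := Nat.mul_le_mul_right n (by omega)
        rw [Nat.succ_mul] at this
        omega
      · exact readBits_xorBits_fresh hlt
    · simp [ArithOp.eval, k9, k0, e1, e2]
    · intro q hq
      rw [k9] at hq
      have := xorBits_lt hlt q hq
      simp [ArithOp.eval, k9, k0]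
      omega
  · rintro ρ' ψ' - ⟨-, -, s, rfl, hs⟩
    rw [f2] at hs
    exact ⟨s, rfl, hs⟩

/-! ### Binary search for the index -/

/-- The number with the binary digits `w 0, …, w (k - 1)`, most significant digit first. -/
def bitsNumber (w : ℕ → Bool) : ℕ → ℕ
  | 0 => 0
  | k + 1 => bitsNumber w k + bitsNumber w k + (w k).toNat

theorem bitsNumber_injective {w w' : ℕ → Bool} {k : ℕ} (h : bitsNumber w k = bitsNumber w' k) :
    ∀ i < k, w i = w' i := by
  induction k with
  | zero => intro i hi; omega
  | succ k ih =>
    simp only [bitsNumber] at h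
    have h1 : (w k).toNat ≤ 1 := Bool.toNat_le _
    have h2 : (w' k).toNat ≤ 1 := Bool.toNat_le _
    intro i hi
    rcases Nat.lt_succ_iff_lt_or_eq.1 hi with hi | rfl
    · exact ih (by omega) i hi
    · have e : (w i).toNat = (w' i).toNat := by omega
      revert e
      cases w i <;> cases w' i <;> simp

/-- A bit string as a number. -/
def codeNumber (w : Bits n) : ℕ := bitsNumber (fun k => if h : k < n then w ⟨k, h⟩ else false) n

theorem codeNumber_injective : Function.Injective (codeNumber (n := n)) := by
  intro w w' h
  funext i
  simpa using bitsNumber_injective h i i.2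

/-- The exponent `1 + (e - 1)` is `e` except at `e = 0`, where the algorithm computes `g` itself. -/
theorem powerProg_det {ρ : ℕ → ℕ} {N J K e : ℕ} {s : Finset ℕ} (hρ : Parameters n N J K ρ)
    (hs : FreshAfterPowers B g J ρ s) (h36 : ρ 36 = e) (he : e ≤ 2 ^ J) {α : ℂ} :
    Det B.mul powerProg ρ (Finsupp.single s α) fun ρ' ψ' =>
      ρ' 39 = codeNumber (B.enc (spow g (1 + (e - 1)))) ∧
      ∃ s', ψ' = Finsupp.single s' α ∧ FreshAfterPowers B g J ρ' s' := by
  refine Det.seq (R := fun ρ' ψ' => (∀ x ∉ powerProg.writes, ρ' x = ρ x) ∧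
    ∃ s', ψ' = Finsupp.single s' α ∧ FreshAfterPowers B g J ρ' s' ∧
      readBits n (ρ' 38) s' = B.enc (spow g (1 + (e - 1)))) ?_ ?_
  · simp only [mov, inc, Det.seq_arith, ArithOp.eval]
    set ρ₁ : ℕ → ℕ := Function.update _ 12 _ with hρ₁
    have fr : ∀ x ∉ [12, 37, 38], ρ₁ x = ρ x := by
      intro x hx
      simp only [List.mem_cons, List.not_mem_nil, or_false, not_or] at hx
      simp [hρ₁, hx]
    have f12 : ρ₁ 12 = 0 := by simp [hρ₁, hρ.r6]
    have f37 : ρ₁ 37 = e - 1 := by simp [hρ₁, h36, hρ.r7]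
    have f38 : ρ₁ 38 = 0 := by simp [hρ₁, hρ.r6]
    clear_value ρ₁
    have f2 : ρ₁ 2 = J := (fr 2 (by decide)).trans hρ.r2
    have f9 : ρ₁ 9 = ρ 9 := fr 9 (by decide)
    refine Det.loop (fun i ρ' ψ' => ρ' 37 = (e - 1) / 2 ^ i ∧ ρ' 12 = i * n ∧ ρ' 38 + n ≤ ρ' 9 ∧
      ∃ s', ψ' = Finsupp.single s' α ∧ FreshAfterPowers B g J ρ' s' ∧
        readBits n (ρ' 38) s' = B.enc (spow g (1 + (e - 1) % 2 ^ i))) ?_ ?_ ?_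
    · refine ⟨by simpa using f37, by simpa using f12, ?_, s, rfl, ⟨hs.powers, ?_, ?_⟩, ?_⟩
      · rw [f38, f9]
        have := hs.le_fresh
        rw [Nat.succ_mul] at this
        omega
      · rw [f9]; exact hs.le_fresh
      · rw [f9]; exact hs.lt_fresh
      · have := hs.powers 0 (Nat.zero_le _)
        rw [f38]
        simpa [Nat.mod_one] using this
    · rintro i hi ρ' ψ' fr' ⟨k37, k12, k38, s', rfl, hs', hr⟩
      rw [f2] at hi
      have q : ∀ x ∈ [0, 6, 7, 8], ρ' x = ρ x := fun x hx =>
        (fr' x (by revert x; decide)).trans (fr x (by revert x; decide))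
      have k0 := (q 0 (by decide)).trans hρ.r0
      have k6 := (q 6 (by decide)).trans hρ.r6
      have k7 := (q 7 (by decide)).trans hρ.r7
      have k8 := (q 8 (by decide)).trans hρ.r8
      have hmod : (e - 1) % 2 ^ (i + 1) = (e - 1) % 2 ^ i + 2 ^ i * ((e - 1) / 2 ^ i % 2) := by
        rw [pow_succ, Nat.mod_mul]
      have hdiv : (e - 1) / 2 ^ i / 2 = (e - 1) / 2 ^ (i + 1) := by
        rw [pow_succ, Nat.div_div_eq_div_mul]
      have hsucc : (i + 1) * n = i * n + n := by ring
      have hiJ : (i + 1) * n ≤ (J + 1) * n := Nat.mul_le_mul_right n (by omega)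
      have hle := hs'.le_fresh
      rw [Det.seq_arith]
      refine Det.seq (R := fun ρ'' ψ' => ρ'' 37 = (e - 1) / 2 ^ i ∧ ρ'' 12 = i * n ∧
        ρ'' 38 + n ≤ ρ'' 9 ∧ ρ'' 0 = n ∧ ρ'' 8 = 2 ∧
        ∃ s', ψ' = Finsupp.single s' α ∧ FreshAfterPowers B g J ρ'' s' ∧
        readBits n (ρ'' 38) s' = B.enc (spow g (1 + (e - 1) % 2 ^ (i + 1)))) ?_ ?_
      · refine Det.ifLe (fun h => ?_) fun h => Det.skip ?_
        · simp [ArithOp.eval, k7, k8, k37] at h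
          have hbit : (e - 1) / 2 ^ i % 2 = 1 := by omega
          refine Det.seq_query_single (by simpa using k38) (by simp [k12]; omega) ?_
          rw [Det.seq_arith, Det.arith_iff]
          refine ⟨by simp [ArithOp.eval, k37], by simp [ArithOp.eval, k12],
            by simp [ArithOp.eval, k6, k0], by simp [ArithOp.eval, k0], by simp [ArithOp.eval, k8],
            _, rfl, ⟨?_, ?_, ?_⟩, ?_⟩
          · refine hs'.powers.congr hle fun q hq => ?_
            simp only [Function.update_of_ne (show (9 : ℕ) ≠ 24 by decide)]
            exact mem_xorBits_of_outside (by omega)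
          · simp [ArithOp.eval, k0]; omega
          · intro q hq
            have := xorBits_lt (by simpa using hs'.lt_fresh) q hq
            simpa [ArithOp.eval, k0] using this
          · simp only [ne_eq, Nat.reduceEqDiff, not_false_eq_true,
              Function.update_of_ne, Function.update_self, ArithOp.eval, k6, add_zero, k12]
            rw [readBits_xorBits_fresh hs'.lt_fresh, hr, hs'.powers i (by omega), B.mul_enc,
              ← spow_add g (by omega) Nat.one_le_two_pow, hmod, hbit, mul_one, add_assoc]
        · simp [ArithOp.eval, k7, k8, k37] at h
          refine ⟨by simp [k37], by simp [k12], by simpa using k38, by simp [k0], by simp [k8],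
            _, rfl, ⟨hs'.powers, by simpa using hle, by simpa using hs'.lt_fresh⟩, ?_⟩
          rw [hmod, h]
          simpa using hr
      · rintro ρ'' ψ' ⟨j37, j12, j38, j0, j8, s'', rfl, hs'', hr'⟩
        rw [Det.seq_arith, Det.arith_iff]
        refine ⟨by simp [ArithOp.eval, j37, j8, hdiv], by simp [ArithOp.eval, j12, j0, hsucc],
          by simpa using j38, s'', rfl, ⟨hs''.powers, by simpa using hs''.le_fresh,
            by simpa using hs''.lt_fresh⟩, by simpa using hr'⟩
    · rintro ρ' ψ' fr' ⟨-, -, -, s', rfl, hs', hr⟩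
      rw [f2] at hr
      refine ⟨fun x hx => (fr' x fun h => hx ?_).trans (fr x fun h => hx ?_), s', rfl, hs', ?_⟩
      · clear hx; revert x; decide
      · clear hx; revert x; decide
      · rwa [Nat.mod_eq_of_lt (by have := Nat.two_pow_pos J; omega)] at hr
  · rintro ρ₂ ψ₂ ⟨fr, s', rfl, hs', hr⟩
    simp only [mov, inc, Det.seq_arith, ArithOp.eval]
    set ρ₁ : ℕ → ℕ := Function.update _ 39 _ with hρ₁
    have fr₁ : ∀ x ∉ [17, 39], ρ₁ x = ρ₂ x := by
      intro x hx
      simp only [List.mem_cons, List.not_mem_nil, or_false, not_or] at hx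
      simp [hρ₁, hx]
    have f17 : ρ₁ 17 = ρ₂ 38 := by simp [hρ₁, (fr 6 (by decide)).trans hρ.r6]
    have f39 : ρ₁ 39 = 0 := by simp [hρ₁, (fr 6 (by decide)).trans hρ.r6]
    clear_value ρ₁
    have f0 : ρ₁ 0 = n := (fr₁ 0 (by decide)).trans ((fr 0 (by decide)).trans hρ.r0)
    have f7 : ρ₁ 7 = 1 := (fr₁ 7 (by decide)).trans ((fr 7 (by decide)).trans hρ.r7)
    refine Det.loop (fun i ρ' ψ' => ψ' = Finsupp.single s' α ∧ ρ' 17 = ρ₂ 38 + i ∧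
      ρ' 39 = bitsNumber (fun k => if h : k < n then (readBits n (ρ₂ 38) s') ⟨k, h⟩ else false) i)
      ⟨rfl, f17, f39⟩ ?_ ?_
    · rintro i hi ρ' ψ' fr' ⟨rfl, k17, k39⟩
      rw [f0] at hi
      refine Det.seq_measure_single ?_
      simp only [Det.seq_arith, Det.arith_iff]
      refine ⟨trivial, by simp [ArithOp.eval, k17, (fr' 7 (by decide)).trans f7, add_assoc], ?_⟩
      simp [ArithOp.eval, k39, k17, bitsNumber, hi, readBits]
    · rintro ρ' ψ' fr' ⟨rfl, -, k39⟩
      rw [f0, hr] at k39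
      have e9 : ρ' 9 = ρ₂ 9 := (fr' 9 (by decide)).trans (fr₁ 9 (by decide))
      exact ⟨k39, s', rfl, hs'.powers, by rw [e9]; exact hs'.le_fresh,
        by rw [e9]; exact hs'.lt_fresh⟩

end

section

variable {n : ℕ} {f : Bits n → Bits n → Bits n}
variable {S : Type*} [Semigroup S] {B : BlackBox S n} {g : S}

/-- One step of the binary search. -/
theorem searchStep_det [Finite S] {ρ : ℕ → ℕ} {N J K l D : ℕ} {s : Finset ℕ} {α : ℂ}
    (hρ : Parameters n N J K ρ) (hs : FreshAfterPowers B g J ρ s) (h10 : ρ 10 = sgPeriod g)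
    (h34 : ρ 34 = l) (h35 : ρ 35 = D) (hJ : l + D / 2 + sgPeriod g ≤ 2 ^ J) :
    Det B.mul (.arith .div 35 35 8 ;; .arith .add 36 34 35 ;; powerProg ;; mov 40 39 ;;
      inc 36 10 ;; powerProg ;;
      .ifLe 39 40 (.ifLe 40 39 .skip (inc 34 35)) (inc 34 35)) ρ (Finsupp.single s α)
      fun ρ' ψ' => (∃ s', ψ' = Finsupp.single s' α ∧ FreshAfterPowers B g J ρ' s') ∧
        ρ' 35 = D / 2 ∧ ρ' 34 = if 1 ≤ D / 2 ∧ l + D / 2 < sgIndex g then l + D / 2 else l := by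
  have hr := (sgPeriod_mem g).1
  simp only [Det.seq_arith, ArithOp.eval]
  set ρ₁ : ℕ → ℕ := Function.update _ 36 _ with hρ₁
  have fr : ∀ x ∉ [35, 36], ρ₁ x = ρ x := by
    intro x hx
    simp only [List.mem_cons, List.not_mem_nil, or_false, not_or] at hx
    simp [hρ₁, hx]
  have f35 : ρ₁ 35 = D / 2 := by simp [hρ₁, h35, hρ.r8]
  have f36 : ρ₁ 36 = l + D / 2 := by simp [hρ₁, h34, h35, hρ.r8]
  clear_value ρ₁
  have hρ' := hρ.congr fun x hx => fr x (by revert x; decide)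
  have fresh : ∀ {ρ ρ' : ℕ → ℕ} {s}, FreshAfterPowers B g J ρ s → ρ' 9 = ρ 9 →
      FreshAfterPowers B g J ρ' s := fun h e =>
    ⟨h.powers, by rw [e]; exact h.le_fresh, by rw [e]; exact h.lt_fresh⟩
  refine Det.seq (powerProg_det (e := l + D / 2) hρ' (fresh hs (fr 9 (by decide))) f36
    (by omega)).frame ?_
  rintro ρ₂ ψ₂ ⟨⟨k39, s₂, rfl, hs₂⟩, fr₂⟩
  simp only [mov, inc, Det.seq_arith, ArithOp.eval]
  set ρ₃ : ℕ → ℕ := Function.update _ 36 _ with hρ₃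
  have q : ∀ x ∈ [6, 10, 34, 35, 36], ρ₂ x = ρ₁ x := fun x hx => fr₂ x (by revert x; decide)
  have f6 : ρ₂ 6 = 0 := (q 6 (by decide)).trans hρ'.r6
  have f10 : ρ₂ 10 = sgPeriod g :=
    (q 10 (by decide)).trans ((fr 10 (by decide)).trans h10)
  have e36 : ρ₂ 36 = l + D / 2 := (q 36 (by decide)).trans f36
  have fr₃ : ∀ x ∉ [36, 40], ρ₃ x = ρ₂ x := by
    intro x hx
    simp only [List.mem_cons, List.not_mem_nil, or_false, not_or] at hx
    simp [hρ₃, hx]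
  have g36 : ρ₃ 36 = l + D / 2 + sgPeriod g := by simp [hρ₃, e36, f10]
  have g40 : ρ₃ 40 = codeNumber (B.enc (spow g (1 + (l + D / 2 - 1)))) := by
    simp [hρ₃, k39, f6]
  clear_value ρ₃
  have g34 : ρ₃ 34 = l :=
    (fr₃ 34 (by decide)).trans ((q 34 (by decide)).trans ((fr 34 (by decide)).trans h34))
  have g35 : ρ₃ 35 = D / 2 := (fr₃ 35 (by decide)).trans ((q 35 (by decide)).trans f35)
  have hρ₃' : Parameters n N J K ρ₃ := hρ'.congr fun x hx =>
    (fr₃ x (by revert x; decide)).trans (fr₂ x (by revert x; decide))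
  refine Det.seq (powerProg_det (e := l + D / 2 + sgPeriod g) hρ₃'
    (fresh hs₂ (fr₃ 9 (by decide))) g36 hJ).frame ?_
  rintro ρ₄ ψ₄ ⟨⟨j39, s₄, rfl, hs₄⟩, fr₄⟩
  have j40 := (fr₄ 40 (by decide)).trans g40
  have j34 := (fr₄ 34 (by decide)).trans g34
  have j35 := (fr₄ 35 (by decide)).trans g35
  have heq : ρ₄ 39 = ρ₄ 40 ↔ spow g (1 + (l + D / 2 - 1)) =
      spow g (1 + (l + D / 2 + sgPeriod g - 1)) := by
    rw [j39, j40, codeNumber_injective.eq_iff, B.enc_injective.eq_iff, eq_comm]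
  -- At a probe of width `0` the outcome of the test is irrelevant.
  have hval : (ρ₄ 39 = ρ₄ 40 → (if 1 ≤ D / 2 ∧ l + D / 2 < sgIndex g then l + D / 2 else l) = l) ∧
      (ρ₄ 39 ≠ ρ₄ 40 → (if 1 ≤ D / 2 ∧ l + D / 2 < sgIndex g then l + D / 2 else l) =
        l + D / 2) := by
    rcases Nat.eq_zero_or_pos (D / 2) with h | h
    · simp [h]
    · have e1 : 1 + (l + D / 2 - 1) = l + D / 2 := by omega
      have e2 : 1 + (l + D / 2 + sgPeriod g - 1) = l + D / 2 + sgPeriod g := by omega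
      rw [e1, e2, spow_eq_spow_add_period_iff g (by omega)] at heq
      constructor
      · intro hh
        rw [if_neg (by have := heq.1 hh; omega)]
      · intro hh
        rw [if_pos ⟨h, by_contra fun h' => hh (heq.2 (by omega))⟩]
  have done : ρ₄ 39 ≠ ρ₄ 40 → Det B.mul (.arith .add 34 34 35) ρ₄ (Finsupp.single s₄ α)
      fun ρ' ψ' => (∃ s', ψ' = Finsupp.single s' α ∧ FreshAfterPowers B g J ρ' s') ∧
        ρ' 35 = D / 2 ∧ ρ' 34 = if 1 ≤ D / 2 ∧ l + D / 2 < sgIndex g then l + D / 2 else l := by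
    intro h
    rw [Det.arith_iff]
    exact ⟨⟨s₄, rfl, fresh hs₄ (by simp)⟩, by simp [j35],
      by rw [hval.2 h]; simp [ArithOp.eval, j34, j35]⟩
  refine Det.ifLe (fun h1 => Det.ifLe (fun h2 => Det.skip ?_) fun h2 => ?_) fun h1 => ?_
  · exact ⟨⟨s₄, rfl, hs₄⟩, j35, by rw [hval.1 (by omega), j34]⟩
  · exact done (by omega)
  · exact done (by omega)

/-- The invariant of the search is that the index is greater than register `34` and exceeds it by at
most the step width in register `35`. -/
theorem searchProg_det [Finite S] {ρ : ℕ → ℕ} {N J K : ℕ} {s : Finset ℕ} {α : ℂ}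
    (hρ : Parameters n N J K ρ) (hs : FreshAfterPowers B g J ρ s) (h10 : ρ 10 = sgPeriod g)
    (hN : 8 * N ^ 2 ≤ 2 ^ J) (ht : sgIndex g ≤ N) (hr : sgPeriod g ≤ N) :
    Det B.mul searchProg ρ (Finsupp.single s α) fun ρ' ψ' =>
      (∃ s', ψ' = Finsupp.single s' α) ∧ ρ' 34 + 1 = sgIndex g := by
  have ht1 := (sgIndex_mem g).1
  have hNN : 8 * N ≤ 2 ^ J := by nlinarith
  have hJ : 1 ≤ J := by
    by_contra h
    have : J = 0 := by omega
    subst this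
    omega
  have h2J : 2 ^ J = 2 ^ (J - 1) * 2 := by rw [← pow_succ, Nat.sub_add_cancel hJ]
  refine Det.seq (R := fun ρ' ψ' => ψ' = Finsupp.single s α ∧ ρ' 34 = 0 ∧ ρ' 35 = 2 ^ (J - 1) ∧
    ∀ x ∉ [34, 35], ρ' x = ρ x) ?_ ?_
  · simp only [mov, Det.seq_arith, ArithOp.eval]
    refine Det.seq (R := fun ρ' ψ' => ψ' = Finsupp.single s α ∧ ρ' 34 = 0 ∧ ρ' 35 = 2 ^ J ∧
      ∀ x ∉ [34, 35], ρ' x = ρ x) (Det.loop (fun i ρ' ψ' => ψ' = Finsupp.single s α ∧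
        ρ' 35 = 2 ^ i) ⟨rfl, by simp [hρ.r6, hρ.r7]⟩ ?_ ?_) ?_
    · rintro i - ρ' ψ' - ⟨rfl, k⟩
      rw [Det.arith_iff]
      exact ⟨rfl, by simp [ArithOp.eval, k, pow_succ, mul_two]⟩
    · rintro ρ' ψ' fr ⟨rfl, k⟩
      refine ⟨rfl, (fr 34 (by decide)).trans (by simp [hρ.r6]), by rw [k]; simp [hρ.r2], ?_⟩
      intro x hx
      rw [fr x (by simp [Prog.writes] at hx ⊢; exact hx.2)]
      simp only [List.mem_cons, List.not_mem_nil, or_false, not_or] at hx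
      simp [hx]
    · rintro ρ' ψ' ⟨rfl, k34, k35, fr⟩
      rw [Det.arith_iff]
      refine ⟨rfl, by simpa using k34, by simp [ArithOp.eval, k35, fr 8 (by decide), hρ.r8, h2J],
        ?_⟩
      intro x hx
      have : x ≠ 35 := fun h => hx (by simp [h])
      rw [Function.update_of_ne this, fr x hx]
  · rintro ρ₁ ψ₁ ⟨rfl, f34, f35, fr⟩
    have f2 : ρ₁ 2 = J := (fr 2 (by decide)).trans hρ.r2
    refine Det.loop (fun i ρ' ψ' => ∃ l D s', ψ' = Finsupp.single s' α ∧
      FreshAfterPowers B g J ρ' s' ∧ ρ' 34 = l ∧ ρ' 35 = D ∧ l < sgIndex g ∧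
      ((∃ m, D = 2 ^ m ∧ m + i + 1 = J ∧ sgIndex g ≤ l + D) ∨ (i = J ∧ sgIndex g ≤ l + 1))) ?_ ?_ ?_
    · have e9 : ρ₁ 9 = ρ 9 := fr 9 (by decide)
      exact ⟨0, _, s, rfl, ⟨hs.powers, by rw [e9]; exact hs.le_fresh,
        by rw [e9]; exact hs.lt_fresh⟩, f34, f35, by omega,
        Or.inl ⟨J - 1, rfl, by omega, by omega⟩⟩
    · rintro i hi ρ' ψ' fr' ⟨l, D, s', rfl, hs', k34, k35, hl, hm⟩
      rw [f2] at hi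
      obtain ⟨m, rfl, hm, hlD⟩ := hm.resolve_right (by omega)
      have q : ∀ x ∈ [0, 2, 3, 4, 5, 6, 7, 8, 10, 31, 41, 42], ρ' x = ρ x := fun x hx =>
        (fr' x (by revert x; decide)).trans (fr x (by revert x; decide))
      have hDJ : 2 ^ m ≤ 2 ^ (J - 1) := Nat.pow_le_pow_right (by norm_num) (by omega)
      refine (searchStep_det (hρ.congr fun x hx => q x (by revert x; decide)) hs'
        ((q 10 (by decide)).trans h10) k34 k35 (by omega)).mono ?_
      rintro ρ'' ψ'' ⟨⟨s'', rfl, hs''⟩, j35, j34⟩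
      refine ⟨_, _, s'', rfl, hs'', j34, j35, ?_, ?_⟩
      · split_ifs <;> omega
      · rcases m with _ | m
        · right
          norm_num at hlD ⊢
          omega
        · left
          have e : 2 ^ (m + 1) / 2 = 2 ^ m := by rw [pow_succ]; omega
          have e' : 2 ^ (m + 1) = 2 ^ m + 2 ^ m := by ring
          have := Nat.one_le_two_pow (n := m)
          refine ⟨m, e, by omega, ?_⟩
          rw [e]
          split_ifs <;> omega
    · rintro ρ' ψ' - ⟨l, D, s', rfl, -, k34, -, hl, hm⟩
      rw [f2] at hm
      obtain ⟨-, hl'⟩ := hm.resolve_left (by rintro ⟨m, -, h, -⟩; omega)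
      exact ⟨⟨s', rfl⟩, by omega⟩

/-! ### The algorithm -/

/-- The algorithm succeeds with probability at least `2 / 3`. -/
theorem indexPeriodProg_wp [Finite S] (B : BlackBox S n) (g : S) {N : ℕ} (ht : sgIndex g ≤ N)
    (hr : sgPeriod g ≤ N) {Φ : (ℕ → ℕ) → QState → ℝ} (h0 : ∀ ρ ψ, 0 ≤ Φ ρ ψ)
    (hΦ : ∀ ρ s α, ρ 0 = sgIndex g → ρ 1 = sgPeriod g → ‖α‖ ^ 2 ≤ Φ ρ (Finsupp.single s α)) :
    2 / 3 ≤ indexPeriodProg.wp B.mul Φ (initConfig n N (B.enc g)).reg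
      (initConfig n N (B.enc g)).mem := by
  have hN : 8 * N ^ 2 ≤ 2 ^ (2 * N.size + 3) := by
    have := Nat.lt_size_self N
    rw [pow_add, pow_mul']
    nlinarith
  rw [indexPeriodProg, Prog.wp_seq]
  refine (setupProg_det (N := N) (by simp [initConfig]) (by simp [initConfig])
    (by simp [initConfig])).frame _ _ (Prog.wp_nonneg _ h0) ?_
  rintro ρ₁ ψ₁ ⟨⟨rfl, hρ₁⟩, fr₁⟩
  have f10 : ρ₁ 10 = 0 := (fr₁ 10 (by decide)).trans (by simp [initConfig])
  rw [Prog.wp_seq, mainProg, Prog.wp_seq]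
  refine (powersProg_det (B := B) (g := g) hρ₁.r0 hρ₁.r2 hρ₁.r6).frame _ _
    (Prog.wp_nonneg _ (Prog.wp_nonneg _ h0)) ?_
  rintro ρ₂ ψ₂ ⟨⟨s, rfl, hs⟩, fr₂⟩
  have hρ₂ := hρ₁.congr fun x hx => fr₂ x (by revert x; decide)
  rw [Prog.wp_seq, Prog.wp_loop, hρ₂.r4]
  refine (two_thirds_le_sampleVal (sgPeriod_mem g).1 hr).trans ?_
  have := sample_iterate (B := B) (by omega) hN ht hr
    (Φ := searchProg.wp B.mul (outputProg.wp B.mul Φ))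
    (Prog.wp_nonneg _ (Prog.wp_nonneg _ h0)) ?_ (4 * (2 * N.size + 3)) hρ₂ hs (α := 1)
  · rw [(fr₂ 10 (by decide)).trans f10] at this
    simpa using this
  · intro ρ₃ s α hρ₃ hs h10
    refine (searchProg_det hρ₃ hs h10 hN ht hr).frame _ _ (Prog.wp_nonneg _ h0) ?_
    rintro ρ₄ ψ₄ ⟨⟨⟨s', rfl⟩, h34⟩, fr₄⟩
    have h7 : ρ₄ 7 = 1 := (fr₄ 7 (by decide)).trans hρ₃.r7
    have h6 : ρ₄ 6 = 0 := (fr₄ 6 (by decide)).trans hρ₃.r6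
    have h10' : ρ₄ 10 = sgPeriod g := (fr₄ 10 (by decide)).trans h10
    refine hΦ _ _ _ ?_ ?_
    · simp [ArithOp.eval, h7, h34]
    · simp [ArithOp.eval, h6, h10']

end

theorem lemma1 :
    ∃ (A : Prog) (p q : Polynomial ℕ),
      ∀ (S : Type u) [Semigroup S] [Finite S] (n : ℕ) (B : BlackBox S n) (g : S) (N : ℕ),
        sgIndex g + sgPeriod g ≤ N + 1 →
        (∀ s ∈ A.run B.mul (initConfig n N (B.enc g)), s.mem ≠ 0 →
          s.time ≤ p.eval (n + Nat.log 2 N) ∧ s.queries ≤ q.eval (Nat.log 2 N)) ∧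
        2 / 3 ≤ prob (A.run B.mul (initConfig n N (B.enc g)))
          (fun s => s.reg 0 = sgIndex g ∧ s.reg 1 = sgPeriod g) := by
  obtain ⟨p, hp⟩ := timeBound_polyBounded
  obtain ⟨q, hq⟩ := queryBound_polyBounded
  refine ⟨indexPeriodProg, p, q, ?_⟩
  intro S _ _ n B g N hN
  have ht := (sgIndex_mem g).1
  have hr := (sgPeriod_mem g).1
  -- The time and query bounds hold for all outcomes, including those of probability `0`.
  refine ⟨fun s hs _ => ?_, ?_⟩
  · obtain ⟨h1, h2⟩ := indexPeriodProg_bounds _ _ _ hs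
    exact ⟨h1.trans (hp _), h2.trans (hq _)⟩
  · have := Prog.sum_run (f := B.mul) indexPeriodProg
      (fun ρ ψ => if ρ 0 = sgIndex g ∧ ρ 1 = sgPeriod g then ψ.weight else 0)
      (initConfig n N (B.enc g))
    rw [prob, this]
    refine indexPeriodProg_wp B g (by omega) (by omega) ?_ ?_
    · intro ρ ψ
      split_ifs
      · exact ψ.weight_nonneg
      · exact le_rfl
    · intro ρ s α h0 h1
      rw [if_pos ⟨h0, h1⟩, QState.weight_single]
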